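/- Let $d\ge 2$, $1\le n\le d-1$, write $x=(y,z)\in\mathbb R^n\times\mathbb R^{d-n}=\mathbb R^d$, and let $\frac{2}{d-n}<\sigma<\frac{2}{d-2}$ (no upper bound if $d=2$). Let $$B_1=\Big\{u\in H^1(\mathbb R^d;\mathbb C):\ \int_{\mathbb R^d}|y|^2|u|^2\,dx<\infty\Big\},\qquad \|u\|_{B_1}^2=\|\nabla_x u\|_{L^2}^2+\|yu\|_{L^2}^2+\|u\|_{L^2}^2,$$ and define on $B_1$ the action $$S(u)=\tfrac12\|\nabla_x u\|_{L^2}^2+\tfrac12\|yu\|_{L^2}^2+\tfrac12\|u\|_{L^2}^2-\tfrac1{2\sigma+2}\|u\|_{L^{2\sigma+2}}^{2\sigma+2}$$ and, for real $(a,b)$, the functional $$\begin{aligned}J^{a,b}(u)={}&\tfrac{2a+b(d-n)}2\big(\|\nabla_y u\|_{L^2}^2+\|yu\|_{L^2}^2+\|u\|_{L^2}^2\big)+\tfrac{2a+b(d-n-2)}2\|\nabla_z u\|_{L^2}^2\\&-\tfrac{a(2\sigma+2)+b(d-n)}{2\sigma+2}\|u\|_{L^{2\sigma+2}}^{2\sigma+2},\end{aligned}$$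 which is the derivative at $\lambda=0$ of $S$ along the scaling $u_\lambda(y,z)=e^{a\lambda}u(y,e^{-b\lambda}z)$. Call $(a,b)$ admissible if $$a>0,\quad b\le 0,\quad 2a+b(d-n)\ge 0,\quad \sigma a+b>0,\quad (a,b)\ne(0,0). \tag{3.2}$$ Put $$d^{a,b}=\inf\{S(u):u\in B_1\setminus\{0\},\ J^{a,b}(u)=0\},\qquad U^{a,b}=\{u\in B_1: S(u)=d^{a,b},\ J^{a,b}(u)=0\},$$ $$\beta=\inf_{\gamma\in\Gamma}\max_{s\in[0,1]}S(\gamma(s)),\qquad \Gamma=\{\gamma\in C([0,1];B_1):\gamma(0)=0,\ S(\gamma(1))<0\}.$$ A ground state is a weak solution $Q\in B_1\setminus\{0\}$ of $-\Delta Q+|y|^2Q+Q=|Q|^{2\sigma}Q$ (tested against all functions of $B_1$) whose action is least among all such solutions. Then: 1. For every $(a,b)$ satisfying (3.2) with $2a+b(d-n)>0$, there is $Q\in U^{a,b}$ with $Q\neq0$ (the infimum $d^{a,b}$ is attained), and $d^{a,b}=\beta>0$. In particular $d^{a,b}$ does not depend on such $(a,b)$. 2. $\Gamma\ne\emptyset$,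 $S$ attains its maximum along every path of $\Gamma$, and $\beta>0$. 3. Ground states exist; every element of $U^{1,0}$ is a ground state; and every ground state $Q$ satisfies $S(Q)=\beta$. -/

import Mathlib

open MeasureTheory
open scoped ContDiff

noncomputable section

namespace PartialNLS

/-- The space `ℝᵈ = ℝⁿ × ℝᵐ` (so `d = n + m`) with its Euclidean structure. A point `x = (y, z)` has
the coordinates `y j = x (Sum.inl j)` and `z k = x (Sum.inr k)`. -/
abbrev Space (n m : ℕ) : Type := EuclideanSpace ℝ (Fin n ⊕ Fin m)

/-- `L²(ℝᵈ; ℂ)`. -/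
abbrev L2 (n m : ℕ) : Type := Lp ℂ 2 (volume : Measure (Space n m))

variable {n m : ℕ}

/-- The Euclidean norm `|y|` of the confined variables of `x = (y, z)`. -/
def yNorm (x : Space n m) : ℝ := √(∑ j : Fin n, x (Sum.inl j) ^ 2)

/-- The `i`-th classical partial derivative of a real function on `ℝᵈ`. -/
def partialDeriv (i : Fin n ⊕ Fin m) (φ : Space n m → ℝ) (x : Space n m) : ℝ :=
  fderiv ℝ φ x (EuclideanSpace.single i 1)

/-- `g ∈ L²` is the `i`-th weak (distributional) partial derivative of `u ∈ L²`. -/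
def IsWeakDeriv (i : Fin n ⊕ Fin m) (u g : L2 n m) : Prop :=
  ∀ φ : Space n m → ℝ, ContDiff ℝ ∞ φ → HasCompactSupport φ →
    ∫ x, partialDeriv i φ x • u x = -∫ x, φ x • g x

/-- `w ∈ L²` is the function `|y| u`. -/
def IsMoment (u w : L2 n m) : Prop :=
  ∀ᵐ x, w x = yNorm x • u x

theorem integrable_smul_L2 {φ : Space n m → ℝ} (hc : Continuous φ) (hs : HasCompactSupport φ)
    (u : L2 n m) : Integrable (fun x => φ x • u x) :=
  ((Lp.memLp u).locallyIntegrable (by norm_num)).integrable_smul_left_of_hasCompactSupport hc hs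

theorem continuous_partialDeriv (i : Fin n ⊕ Fin m) {φ : Space n m → ℝ} (h : ContDiff ℝ ∞ φ) :
    Continuous (partialDeriv i φ) :=
  (h.continuous_fderiv (by simp)).clm_apply continuous_const

theorem hasCompactSupport_partialDeriv (i : Fin n ⊕ Fin m) {φ : Space n m → ℝ}
    (h : HasCompactSupport φ) : HasCompactSupport (partialDeriv i φ) :=
  h.fderiv_apply ℝ _

theorem integral_smul_add {φ : Space n m → ℝ} (hc : Continuous φ) (hs : HasCompactSupport φ)
    (u v : L2 n m) :
    ∫ x, φ x • (u + v) x = (∫ x, φ x • u x) + ∫ x, φ x • v x := by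
  rw [← integral_add (integrable_smul_L2 hc hs u) (integrable_smul_L2 hc hs v)]
  refine integral_congr_ae ?_
  filter_upwards [Lp.coeFn_add u v] with x hx
  simp only [hx, Pi.add_apply, smul_add]

theorem integral_smul_smul (φ : Space n m → ℝ) (c : ℂ) (u : L2 n m) :
    ∫ x, φ x • (c • u) x = c * ∫ x, φ x • u x := by
  rw [← integral_const_mul]
  refine integral_congr_ae ?_
  filter_upwards [Lp.coeFn_smul c u] with x hx
  simp only [hx, Pi.smul_apply, smul_eq_mul, Complex.real_smul]
  ring

theorem IsWeakDeriv.add {i : Fin n ⊕ Fin m} {u v g h : L2 n m} (hu : IsWeakDeriv i u g)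
    (hv : IsWeakDeriv i v h) : IsWeakDeriv i (u + v) (g + h) := by
  intro φ hφ hs
  rw [integral_smul_add (continuous_partialDeriv i hφ) (hasCompactSupport_partialDeriv i hs),
    integral_smul_add hφ.continuous hs, hu φ hφ hs, hv φ hφ hs]
  ring

theorem IsWeakDeriv.smul {i : Fin n ⊕ Fin m} {u g : L2 n m} (c : ℂ) (hu : IsWeakDeriv i u g) :
    IsWeakDeriv i (c • u) (c • g) := by
  intro φ hφ hs
  rw [integral_smul_smul, integral_smul_smul, hu φ hφ hs]
  ring

theorem IsMoment.add {u v w r : L2 n m} (hu : IsMoment u w) (hv : IsMoment v r) :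
    IsMoment (u + v) (w + r) := by
  filter_upwards [hu, hv, Lp.coeFn_add u v, Lp.coeFn_add w r] with x h1 h2 h3 h4
  simp only [h1, h2, h3, h4, Pi.add_apply, smul_add]

theorem IsMoment.smul {u w : L2 n m} (c : ℂ) (hu : IsMoment u w) :
    IsMoment (c • u) (c • w) := by
  filter_upwards [hu, Lp.coeFn_smul c u, Lp.coeFn_smul c w] with x h1 h2 h3
  simp only [h1, h2, h3, Pi.smul_apply, smul_eq_mul, Complex.real_smul]
  ring

theorem isWeakDeriv_zero (i : Fin n ⊕ Fin m) : IsWeakDeriv i (0 : L2 n m) 0 := by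
  intro φ _ _
  have h : ∀ ψ : Space n m → ℝ, ∫ x, ψ x • (0 : L2 n m) x = 0 := fun ψ => by
    rw [← zero_smul ℂ (0 : L2 n m), integral_smul_smul, zero_mul]
  rw [h, h, neg_zero]

theorem isMoment_zero : IsMoment (0 : L2 n m) 0 := by
  filter_upwards [Lp.coeFn_zero ℂ 2 (volume : Measure (Space n m))] with x hx
  rw [hx, Pi.zero_apply, smul_zero]

/-- The energy space `B₁ = {u ∈ H¹(ℝᵈ; ℂ) : |y| u ∈ L²}`. A function `u` of this space is recorded
together with `|y| u` and with its weak partial derivatives, all of them in `L²` and all of them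
determined by `u`: the slots are `Sum.inl 0 ↦ u`, `Sum.inl 1 ↦ |y| u`, `Sum.inr i ↦ ∂ᵢ u`.
The inherited norm is `‖u‖² = ‖∇u‖² + ‖|y| u‖² + ‖u‖²` (`L²` norms on the right). -/
def B1 (n m : ℕ) :
    Submodule ℂ (PiLp 2 (fun _ : Fin 2 ⊕ (Fin n ⊕ Fin m) => L2 n m)) where
  carrier := {U | IsMoment (U (Sum.inl 0)) (U (Sum.inl 1)) ∧
    ∀ i, IsWeakDeriv i (U (Sum.inl 0)) (U (Sum.inr i))}
  add_mem' := fun hU hV => ⟨hU.1.add hV.1, fun i => (hU.2 i).add (hV.2 i)⟩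
  zero_mem' := ⟨isMoment_zero, fun i => isWeakDeriv_zero i⟩
  smul_mem' := fun c _ hU => ⟨hU.1.smul c, fun i => (hU.2 i).smul c⟩

/-- The function `u` itself, as an element of `L²`. -/
def val (u : B1 n m) : L2 n m := u.1 (Sum.inl 0)

/-- The function `|y| u`, as an element of `L²`. -/
def moment (u : B1 n m) : L2 n m := u.1 (Sum.inl 1)

/-- The weak partial derivative `∂ᵢ u`, as an element of `L²`. -/
def grad (u : B1 n m) (i : Fin n ⊕ Fin m) : L2 n m := u.1 (Sum.inr i)

/-- `‖∇_y u‖²` in `L²`. -/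
def gradYSq (u : B1 n m) : ℝ := ∑ j : Fin n, ‖grad u (Sum.inl j)‖ ^ 2

/-- `‖∇_z u‖²` in `L²`. -/
def gradZSq (u : B1 n m) : ℝ := ∑ k : Fin m, ‖grad u (Sum.inr k)‖ ^ 2

/-- `∫ |u|^(2σ+2) dx`, that is, the power `2σ+2` of the norm of `u` in `L^(2σ+2)`. -/
def potential (σ : ℝ) (u : B1 n m) : ℝ := ∫ x, ‖val u x‖ ^ (2 * σ + 2)

/-- The action functional `S`. -/
def action (σ : ℝ) (u : B1 n m) : ℝ :=
  (gradYSq u + gradZSq u) / 2 + ‖moment u‖ ^ 2 / 2 + ‖val u‖ ^ 2 / 2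
    - potential σ u / (2 * σ + 2)

/-- The functional `J^{a,b}`, the derivative at `s = 0` of the action `S` along the scaling
`u_s(y, z) = exp (a s) * u (y, exp (-b s) z)`; here `m = d - n`. -/
def J (σ a b : ℝ) (u : B1 n m) : ℝ :=
  (2 * a + b * m) / 2 * gradYSq u + (2 * a + b * (m - 2)) / 2 * gradZSq u
    + (2 * a + b * m) / 2 * ‖moment u‖ ^ 2 + (2 * a + b * m) / 2 * ‖val u‖ ^ 2
    - (a * (2 * σ + 2) + b * m) / (2 * σ + 2) * potential σ u

/-- The conditions on the scaling exponents `(a, b)`; here `m = d - n`. -/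
def AdmissibleExponents (m : ℕ) (σ a b : ℝ) : Prop :=
  0 < a ∧ b ≤ 0 ∧ 0 ≤ 2 * a + b * m ∧ 0 < σ * a + b ∧ (a, b) ≠ (0, 0)

/-- The minimal level `d^{a,b} = inf {S(u) : u ∈ B₁, u ≠ 0, J^{a,b}(u) = 0}`. -/
def minLevel (n m : ℕ) (σ a b : ℝ) : ℝ :=
  sInf (action σ '' {u : B1 n m | u ≠ 0 ∧ J σ a b u = 0})

/-- The set `U^{a,b}` of minimisers. -/
def minimisers (n m : ℕ) (σ a b : ℝ) : Set (B1 n m) :=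
  {u | action σ u = minLevel n m σ a b ∧ J σ a b u = 0}

/-- The set `Γ` of continuous paths in `B₁` from `0` to a point of negative action. -/
def mountainPaths (n m : ℕ) (σ : ℝ) : Set C(unitInterval, B1 n m) :=
  {γ | γ 0 = 0 ∧ action σ (γ 1) < 0}

/-- The mountain pass level `β`, the infimum over `γ ∈ Γ` of the maximum of the action on `γ`. -/
def mountainPassLevel (n m : ℕ) (σ : ℝ) : ℝ :=
  sInf {M | ∃ γ ∈ mountainPaths n m σ, IsGreatest (Set.range fun s => action σ (γ s)) M}

/-- `φ ∈ B₁ \ {0}` is a (weak) solution of `-Δφ + |y|²φ + φ - |φ|^(2σ) φ = 0`, tested against all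
functions of the energy space. `inner ℂ v w` is `∫ conj v * w`. -/
def IsSolution (σ : ℝ) (φ : B1 n m) : Prop :=
  φ ≠ 0 ∧ ∀ v : B1 n m,
    (∑ i, inner ℂ (grad v i) (grad φ i)) + inner ℂ (moment v) (moment φ) + inner ℂ (val v) (val φ)
      - (∫ x, ((‖val φ x‖ ^ (2 * σ) : ℝ) : ℂ) * val φ x * (starRingEnd ℂ) (val v x)) = 0

/-- A ground state: a solution of least action among all solutions. -/
def IsGroundState (σ : ℝ) (Q : B1 n m) : Prop :=
  IsSolution σ Q ∧ ∀ φ : B1 n m, IsSolution σ φ → action σ Q ≤ action σ φ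

end PartialNLS

end

namespace PartialNLS

open scoped Convolution ENNReal NNReal Topology
open Filter ContinuousLinearMap

variable {n m : ℕ}

/-! ### Mollification -/

/-! Write `P` for `potential σ` and `‖·‖` for the norm of `B1`, so that `S = ‖u‖²/2 - P(u)/(2σ+2)`.
Everything follows from one fact: the best constant in the embedding of `B1` into `L^(2σ+2)` is
attained. A suitable multiple `Q` of a maximiser lies on the Nehari manifold `P = ‖·‖²` and
satisfies `P(u) ‖Q‖^(2σ) ≤ ‖u‖^(2σ+2)` for all `u` (`IsOptimizer`). Each level in the theorem is
then `S(Q)`.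

On the Nehari manifold `S` is a positive multiple of `‖u‖²`, and optimality makes `‖Q‖` least.
Solutions are Nehari points (test with the solution itself), and `Q` is a solution by the first
variation of the sharp inequality, so `Q` is a ground state. Varying along the `(a,b)` scaling
instead gives `J^{a,b}(Q) = 0` for all `a`, `b`. Conversely, if `J^{a,b}(u) = 0`, then `S` is
maximal at `u` along the scaling orbit (`action_rescale_le`), and the orbit meets the Nehari
manifold (`exists_rescale_nehari`), so `S(u) ≥ S(Q)`. A mountain path must cross the sphere of
radius `‖Q‖`, where `S ≥ S(Q)`, and the ray through `Q` attains this value.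

Attainment (`Subcritical.exists_maximizer`) is a concentration argument. A lower bound on `P` forces
a fixed mass into some unit ball. The weight `|y|` keeps that ball near `y = 0`, and a translation
in `z`, which preserves norm and potential, brings it to the origin. By local compactness the weak
limit `v` is nonzero. A one-sided Brezis–Lieb inequality gives `M ≤ P(v) + M (1 - ‖v‖²)^(σ+1)`, with
`M` the supremum of `P` on the unit ball, and strict convexity of the power `σ+1` forces `‖v‖ = 1`.
Mollification supplies the Sobolev and compactness estimates for functions known only through weak
derivatives. -/

theorem eLpNorm_two_sq {α F : Type*} [MeasurableSpace α] [NormedAddCommGroup F] (f : α → F)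
    (μ : Measure α) : eLpNorm f 2 μ ^ 2 = ∫⁻ x, ‖f x‖ₑ ^ 2 ∂μ := by
  have h := eLpNorm_nnreal_pow_eq_lintegral (μ := μ) (f := f) (p := 2) (by norm_num)
  simpa only [NNReal.coe_ofNat, ENNReal.rpow_ofNat, ENNReal.coe_ofNat] using h

theorem lintegral_sq_le_of_isProbabilityMeasure {α : Type*} [MeasurableSpace α] {ν : Measure α}
    [IsProbabilityMeasure ν] {g : α → ℝ≥0∞} (hg : AEMeasurable g ν) :
    (∫⁻ t, g t ∂ν) ^ 2 ≤ ∫⁻ t, g t ^ 2 ∂ν := by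
  have h := ENNReal.lintegral_mul_le_Lp_mul_Lq ν Real.HolderConjugate.two_two hg
    (aemeasurable_const (b := (1 : ℝ≥0∞)))
  simp only [Pi.mul_apply, mul_one, ENNReal.rpow_ofNat, one_pow, lintegral_const, measure_univ,
    ENNReal.one_rpow] at h
  calc (∫⁻ t, g t ∂ν) ^ 2 ≤ ((∫⁻ t, g t ^ 2 ∂ν) ^ (1 / 2 : ℝ)) ^ 2 := by gcongr
    _ = ∫⁻ t, g t ^ 2 ∂ν := by
      rw [← ENNReal.rpow_natCast, ← ENNReal.rpow_mul]; norm_num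

/-- Jensen's inequality for the square and a probability density `w`. -/
theorem enorm_integral_smul_sq_le {α : Type*} [MeasurableSpace α] {μ : Measure α} {w : α → ℝ}
    (hw0 : ∀ t, 0 ≤ w t) (hwm : Measurable w) (hw1 : ∫⁻ t, ENNReal.ofReal (w t) ∂μ = 1)
    {f : α → ℂ} (hf : AEStronglyMeasurable f μ) :
    ‖∫ t, w t • f t ∂μ‖ₑ ^ 2 ≤ ∫⁻ t, ENNReal.ofReal (w t) * ‖f t‖ₑ ^ 2 ∂μ := by
  set ν := μ.withDensity fun t => ENNReal.ofReal (w t) with hν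
  have hm : Measurable fun t => ENNReal.ofReal (w t) := hwm.ennreal_ofReal
  have : IsProbabilityMeasure ν := ⟨by rw [hν, withDensity_apply _ .univ]; simpa using hw1⟩
  have key : ∀ g : α → ℝ≥0∞, AEMeasurable g μ →
      ∫⁻ t, g t ∂ν = ∫⁻ t, ENNReal.ofReal (w t) * g t ∂μ := fun g hg => by
    rw [hν, lintegral_withDensity_eq_lintegral_mul₀ hm.aemeasurable hg]; rfl
  rw [← key _ (hf.enorm.pow_const 2)]
  refine le_trans ?_ (lintegral_sq_le_of_isProbabilityMeasure
    (hf.enorm.mono_ac (withDensity_absolutelyContinuous _ _)))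
  gcongr
  rw [key _ hf.enorm]
  refine (enorm_integral_le_lintegral_enorm _).trans (lintegral_mono fun t => ?_)
  rw [enorm_smul, Real.enorm_of_nonneg (hw0 t)]

/-- The mollification of `f` by the normalised bump function `ρ`. -/
noncomputable def mollify (ρ : ContDiffBump (0 : Space n m)) (f : Space n m → ℂ) : Space n m → ℂ :=
  ρ.normed volume ⋆[lsmul ℝ ℝ, volume] f

theorem mollify_apply (ρ : ContDiffBump (0 : Space n m)) (f : Space n m → ℂ) (x : Space n m) :
    mollify ρ f x = ∫ t, ρ.normed volume t • f (x - t) := rfl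

theorem mollify_apply_swap (ρ : ContDiffBump (0 : Space n m)) (f : Space n m → ℂ)
    (x : Space n m) : mollify ρ f x = ∫ t, ρ.normed volume (x - t) • f t := by
  rw [mollify, convolution_lsmul_swap]

theorem lintegral_ofReal_normed (ρ : ContDiffBump (0 : Space n m)) :
    ∫⁻ t, ENNReal.ofReal (ρ.normed volume t) = 1 := by
  rw [← ofReal_integral_eq_lintegral_ofReal ρ.integrable_normed
    (Eventually.of_forall ρ.nonneg_normed), ρ.integral_normed, ENNReal.ofReal_one]

theorem locallyIntegrable_L2 (u : L2 n m) : LocallyIntegrable u volume :=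
  (Lp.memLp u).locallyIntegrable (by norm_num)

theorem aestronglyMeasurable_comp_sub {f : Space n m → ℂ} (hf : AEStronglyMeasurable f volume)
    (x : Space n m) : AEStronglyMeasurable (fun t => f (x - t)) volume :=
  hf.comp_quasiMeasurePreserving (quasiMeasurePreserving_sub_left_of_right_invariant _ x)

theorem enorm_mollify_sq_le (ρ : ContDiffBump (0 : Space n m)) {f : Space n m → ℂ}
    (hf : AEStronglyMeasurable f volume) (x : Space n m) :
    ‖mollify ρ f x‖ₑ ^ 2 ≤ ∫⁻ t, ENNReal.ofReal (ρ.normed volume t) * ‖f (x - t)‖ₑ ^ 2 := by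
  rw [mollify_apply]
  exact enorm_integral_smul_sq_le ρ.nonneg_normed ρ.continuous_normed.measurable
    (lintegral_ofReal_normed ρ) (aestronglyMeasurable_comp_sub hf x)

/-- Averaging a family of bounds over the mollifier. -/
theorem lintegral_normed_mul_le (ρ : ContDiffBump (0 : Space n m)) {F : Space n m → ℝ≥0∞}
    {C : ℝ≥0∞} (hF : ∀ t, ‖t‖ < ρ.rOut → F t ≤ C) :
    ∫⁻ t, ENNReal.ofReal (ρ.normed volume t) * F t ≤ C := by
  calc ∫⁻ t, ENNReal.ofReal (ρ.normed volume t) * F t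
      ≤ ∫⁻ t, ENNReal.ofReal (ρ.normed volume t) * C := by
        refine lintegral_mono fun t => ?_
        by_cases ht : ‖t‖ < ρ.rOut
        · gcongr; exact hF t ht
        · have : ρ.normed volume t = 0 := by
            have := ρ.support_normed_eq (μ := volume)
            rw [← Function.notMem_support, this]
            simpa using ht
          simp [this]
    _ = C := by
        rw [lintegral_mul_const _ ρ.continuous_normed.measurable.ennreal_ofReal,
          lintegral_ofReal_normed, one_mul]

/-- Tonelli. The integrand and the set stay free because the local bound, the global bound and the
mollification error all use it. -/
theorem lintegral_mollify_swap (ρ : ContDiffBump (0 : Space n m)) {G : Space n m → Space n m → ℝ≥0∞}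
    (hG : AEMeasurable (fun p : Space n m × Space n m => G p.1 p.2) (volume.prod volume))
    (s : Set (Space n m)) :
    ∫⁻ x in s, ∫⁻ t, ENNReal.ofReal (ρ.normed volume t) * G x t
      = ∫⁻ t, ENNReal.ofReal (ρ.normed volume t) * ∫⁻ x in s, G x t := by
  have hm : Measurable fun p : Space n m × Space n m => ENNReal.ofReal (ρ.normed volume p.2) :=
    (ρ.continuous_normed.measurable.comp measurable_snd).ennreal_ofReal
  rw [lintegral_lintegral_swap]
  · refine lintegral_congr fun t => ?_
    rw [lintegral_const_mul' _ _ ENNReal.ofReal_ne_top]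
  · refine (hm.aemeasurable.mul hG).mono_measure ?_
    exact Measure.prod_mono Measure.restrict_le_self le_rfl

theorem aemeasurable_sub_sq {f : Space n m → ℂ} (hf : AEStronglyMeasurable f volume) :
    AEMeasurable (fun p : Space n m × Space n m => ‖f (p.1 - p.2)‖ₑ ^ 2)
      (volume.prod volume) :=
  (hf.comp_quasiMeasurePreserving
    (quasiMeasurePreserving_sub_of_right_invariant volume volume)).enorm.pow_const 2

/-- After Jensen only translates by `‖t‖ < ρ.rOut` enter, and such a translate of the ball stays in
the ball with radius enlarged by `ρ.rOut`. -/
theorem lintegral_ball_mollify_sq_le (ρ : ContDiffBump (0 : Space n m)) {f : Space n m → ℂ}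
    (hf : AEStronglyMeasurable f volume) (k : Space n m) (R : ℝ) :
    ∫⁻ x in Metric.ball k R, ‖mollify ρ f x‖ₑ ^ 2
      ≤ ∫⁻ x in Metric.ball k (R + ρ.rOut), ‖f x‖ₑ ^ 2 := by
  calc _ ≤ ∫⁻ x in Metric.ball k R,
        ∫⁻ t, ENNReal.ofReal (ρ.normed volume t) * ‖f (x - t)‖ₑ ^ 2 :=
        lintegral_mono fun x => enorm_mollify_sq_le ρ hf x
    _ = ∫⁻ t, ENNReal.ofReal (ρ.normed volume t) * ∫⁻ x in Metric.ball k R, ‖f (x - t)‖ₑ ^ 2 :=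
        lintegral_mollify_swap ρ (aemeasurable_sub_sq hf) _
    _ ≤ _ := by
        refine lintegral_normed_mul_le ρ fun t ht => ?_
        rw [← lintegral_indicator measurableSet_ball, ← lintegral_indicator measurableSet_ball,
          ← lintegral_sub_right_eq_self
            (fun x => (Metric.ball k (R + ρ.rOut)).indicator (fun x => ‖f x‖ₑ ^ 2) x) t]
        refine lintegral_mono fun x => ?_
        by_cases hx : x ∈ Metric.ball k R
        · have : x - t ∈ Metric.ball k (R + ρ.rOut) := by
            rw [Metric.mem_ball, dist_eq_norm] at hx ⊢
            calc ‖x - t - k‖ = ‖(x - k) - t‖ := by congr 1; abel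
              _ ≤ ‖x - k‖ + ‖t‖ := norm_sub_le _ _
              _ < _ := add_lt_add hx ht
          rw [Set.indicator_of_mem hx, Set.indicator_of_mem this]
        · rw [Set.indicator_of_notMem hx]; exact zero_le

theorem lintegral_mollify_sq_le (ρ : ContDiffBump (0 : Space n m)) {f : Space n m → ℂ}
    (hf : AEStronglyMeasurable f volume) :
    ∫⁻ x, ‖mollify ρ f x‖ₑ ^ 2 ≤ ∫⁻ x, ‖f x‖ₑ ^ 2 := by
  calc _ ≤ ∫⁻ x in Set.univ,
        ∫⁻ t, ENNReal.ofReal (ρ.normed volume t) * ‖f (x - t)‖ₑ ^ 2 := by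
        rw [Measure.restrict_univ]
        exact lintegral_mono fun x => enorm_mollify_sq_le ρ hf x
    _ = ∫⁻ t, ENNReal.ofReal (ρ.normed volume t) * ∫⁻ x in Set.univ, ‖f (x - t)‖ₑ ^ 2 :=
        lintegral_mollify_swap ρ (aemeasurable_sub_sq hf) _
    _ ≤ _ := by
        refine lintegral_normed_mul_le ρ fun t _ => ?_
        rw [Measure.restrict_univ, lintegral_sub_right_eq_self (fun x => ‖f x‖ₑ ^ 2) t]

theorem contDiff_mollify (ρ : ContDiffBump (0 : Space n m)) {f : Space n m → ℂ}
    (hf : LocallyIntegrable f volume) : ContDiff ℝ 1 (mollify ρ f) :=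
  ρ.hasCompactSupport_normed.contDiff_convolution_left (n := 1) (lsmul ℝ ℝ)
    ρ.contDiff_normed hf

/-- Mollification commutes with weak differentiation. -/
theorem fderiv_mollify_single (ρ : ContDiffBump (0 : Space n m)) {i : Fin n ⊕ Fin m}
    {u g : L2 n m} (h : IsWeakDeriv i u g) (x : Space n m) :
    fderiv ℝ (mollify ρ u) x (EuclideanSpace.single i 1) = mollify ρ g x := by
  have hd := ρ.hasCompactSupport_normed.hasFDerivAt_convolution_left (μ := volume) (lsmul ℝ ℝ)
    (ρ.contDiff_normed (μ := volume) (n := 1)) (locallyIntegrable_L2 u) x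
  have hcd : ContDiff ℝ ∞ (ρ.normed volume) := ρ.contDiff_normed
  have hint : Integrable (fun t => (fderiv ℝ (ρ.normed volume) t).smulRight (u (x - t))) := by
    have := (ρ.hasCompactSupport_normed (μ := volume)).fderiv ℝ |>.convolutionExists_left
      ((lsmul ℝ ℝ).precompL (Space n m)) (hcd.continuous_fderiv (by simp))
      (locallyIntegrable_L2 u) x
    refine this.integrable.congr (Eventually.of_forall fun t => ?_)
    ext v
    simp [precompL_apply]
  -- The reflected mollifier centred at `x` is the test function in the definition of the weak
  -- derivative.
  set φ : Space n m → ℝ := fun t => ρ.normed volume (x - t) with hφ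
  have hφd : ∀ t, fderiv ℝ φ t = - fderiv ℝ (ρ.normed volume) (x - t) := fun t => by
    have h1 : HasFDerivAt (fun t : Space n m => x - t) (-ContinuousLinearMap.id ℝ _) t :=
      (hasFDerivAt_id t).const_sub x
    have h2 := ((hcd.differentiable (by simp)) (x - t)).hasFDerivAt.comp t h1
    rw [show φ = ρ.normed volume ∘ fun t => x - t from rfl, h2.fderiv]
    ext v; simp
  have h1 := h φ (hcd.comp (contDiff_const.sub contDiff_id))
    (ρ.hasCompactSupport_normed.comp_homeomorph (Homeomorph.subLeft x))
  rw [mollify_apply_swap]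
  have h2 : ∫ t, φ t • g t = - ∫ t, partialDeriv i φ t • u t := by rw [h1, neg_neg]
  rw [show (∫ t, ρ.normed volume (x - t) • g t) = ∫ t, φ t • g t from rfl, h2]
  rw [mollify, hd.fderiv, convolution_def]
  have h3 : (∫ t, ((lsmul ℝ ℝ).precompL (Space n m)) (fderiv ℝ (ρ.normed volume) t) (u (x - t)))
      = ∫ t, (fderiv ℝ (ρ.normed volume) t).smulRight (u (x - t)) := by
    refine integral_congr_ae (Eventually.of_forall fun t => ?_)
    ext v
    simp [precompL_apply]
  -- After `t ↦ x - t`, the minus sign from differentiating the reflection cancels the one in the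
  -- weak derivative.
  rw [h3, ContinuousLinearMap.integral_apply hint, ← integral_neg,
    ← integral_sub_left_eq_self _ volume x]
  refine integral_congr_ae (Eventually.of_forall fun t => ?_)
  simp [partialDeriv, hφd]

/-! ### Translations and the error of mollification. -/

theorem norm_le_sum_single {L : Space n m →L[ℝ] ℂ} :
    ‖L‖ ≤ ∑ i, ‖L (EuclideanSpace.single i 1)‖ := by
  refine L.opNorm_le_bound (Finset.sum_nonneg fun i _ => norm_nonneg _) fun x => ?_
  have hx : x = ∑ i, x i • EuclideanSpace.single i (1 : ℝ) := by
    ext j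
    rw [WithLp.ofLp_sum, Finset.sum_apply, Finset.sum_eq_single j] <;>
      simp +contextual [eq_comm]
  conv_lhs => rw [hx]
  rw [map_sum, Finset.sum_mul]
  refine (norm_sum_le _ _).trans (Finset.sum_le_sum fun i _ => ?_)
  rw [map_smul, norm_smul, mul_comm]
  gcongr
  exact EuclideanSpace.norm_eq x ▸ Real.le_sqrt_of_sq_le
    (Finset.single_le_sum (f := fun i => ‖x i‖ ^ 2) (fun i _ => sq_nonneg _) (Finset.mem_univ i))

theorem eLpNorm_fderiv_le (w : Space n m → ℂ) (hw : ContDiff ℝ 1 w) (p : ℝ≥0∞) (hp : 1 ≤ p)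
    (μ : Measure (Space n m)) :
    eLpNorm (fderiv ℝ w) p μ
      ≤ ∑ i, eLpNorm (fun x => fderiv ℝ w x (EuclideanSpace.single i 1)) p μ := by
  have hc := hw.continuous_fderiv one_ne_zero
  calc eLpNorm (fderiv ℝ w) p μ
      ≤ eLpNorm (∑ i, fun x => ‖fderiv ℝ w x (EuclideanSpace.single i 1)‖) p μ := by
        refine eLpNorm_mono_real fun x => ?_
        rw [Finset.sum_apply]
        exact norm_le_sum_single
    _ ≤ ∑ i, eLpNorm (fun x => ‖fderiv ℝ w x (EuclideanSpace.single i 1)‖) p μ :=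
        eLpNorm_sum_le (fun i _ =>
          (hc.clm_apply continuous_const).norm.aestronglyMeasurable) hp
    _ = _ := by simp only [eLpNorm_norm]

/-- The increment is the integral of the derivative along the segment. Jensen in the parameter and
translation invariance of the measure finish. -/
theorem lintegral_sub_translate_sq_le {w : Space n m → ℂ} (hw : ContDiff ℝ 1 w)
    (h : Space n m) :
    ∫⁻ x, ‖w x - w (x - h)‖ₑ ^ 2 ≤ ‖h‖ₑ ^ 2 * ∫⁻ x, ‖fderiv ℝ w x‖ₑ ^ 2 := by
  have hc := hw.continuous_fderiv one_ne_zero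
  have hcont : Continuous fun p : Space n m × ℝ => fderiv ℝ w (p.1 - p.2 • h) h :=
    (hc.comp (by fun_prop)).clm_apply continuous_const
  have ftc : ∀ x, w x - w (x - h) = ∫ t in Set.Icc (0 : ℝ) 1, fderiv ℝ w (x - t • h) h := by
    intro x
    have hderiv : ∀ t ∈ Set.uIcc (0 : ℝ) 1, HasDerivAt (fun t : ℝ => - w (x - t • h))
        (fderiv ℝ w (x - t • h) h) t := fun t _ => by
      have h1 : HasDerivAt (fun t : ℝ => x - t • h) (-h) t := by
        simpa using ((hasDerivAt_id t).smul_const h).const_sub x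
      have h2 := ((hw.differentiable one_ne_zero) (x - t • h)).hasFDerivAt.comp_hasDerivAt t h1
      have h3 := h2.neg
      rw [map_neg, neg_neg] at h3
      exact h3
    have := intervalIntegral.integral_eq_sub_of_hasDerivAt hderiv
      (Continuous.intervalIntegrable (hcont.comp (Continuous.prodMk_right x)) _ _)
    rw [intervalIntegral.integral_of_le zero_le_one, ← integral_Icc_eq_integral_Ioc] at this
    rw [this]; simp; ring
  have step : ∀ x, ‖w x - w (x - h)‖ₑ ^ 2
      ≤ ∫⁻ t in Set.Icc (0 : ℝ) 1, ‖fderiv ℝ w (x - t • h) h‖ₑ ^ 2 := fun x => by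
    rw [ftc x]
    have := enorm_integral_smul_sq_le (μ := volume.restrict (Set.Icc (0 : ℝ) 1))
      (w := fun _ => 1) (fun _ => zero_le_one) measurable_const (by simp)
      (f := fun t => fderiv ℝ w (x - t • h) h)
      (hcont.comp (Continuous.prodMk_right x)).aestronglyMeasurable
    simpa using this
  calc _ ≤ ∫⁻ x, ∫⁻ t in Set.Icc (0 : ℝ) 1, ‖fderiv ℝ w (x - t • h) h‖ₑ ^ 2 :=
        lintegral_mono step
    _ = ∫⁻ t in Set.Icc (0 : ℝ) 1, ∫⁻ x, ‖fderiv ℝ w (x - t • h) h‖ₑ ^ 2 :=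
        lintegral_lintegral_swap (hcont.enorm.measurable.pow_const 2).aemeasurable
    _ ≤ ∫⁻ _ in Set.Icc (0 : ℝ) 1, ‖h‖ₑ ^ 2 * ∫⁻ x, ‖fderiv ℝ w x‖ₑ ^ 2 := by
        refine lintegral_mono fun t => ?_
        dsimp only
        rw [lintegral_sub_right_eq_self (fun x => ‖fderiv ℝ w x h‖ₑ ^ 2) (t • h),
          ← lintegral_const_mul _ (hc.enorm.measurable.pow_const 2)]
        refine lintegral_mono fun x => ?_
        dsimp only
        rw [← mul_pow, mul_comm]
        gcongr
        exact (fderiv ℝ w x).le_opENorm h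
    _ = _ := by simp

/-- A sequence of mollifiers concentrating at the origin. -/
noncomputable def bumpSeq (k : ℕ) : ContDiffBump (0 : Space n m) where
  rIn := 1 / (k + 2)
  rOut := 2 / (k + 2)
  rIn_pos := by positivity
  rIn_lt_rOut := by gcongr; norm_num

theorem bumpSeq_rOut_le_one (k : ℕ) : (bumpSeq k : ContDiffBump (0 : Space n m)).rOut ≤ 1 := by
  change (2 : ℝ) / (k + 2) ≤ 1
  rw [div_le_one (by positivity)]; linarith [k.cast_nonneg (α := ℝ)]

theorem tendsto_bumpSeq_rOut :
    Tendsto (fun k => (bumpSeq k : ContDiffBump (0 : Space n m)).rOut) atTop (𝓝 0) := by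
  change Tendsto (fun k : ℕ => (2 : ℝ) / (k + 2)) atTop (𝓝 0)
  exact tendsto_const_nhds.div_atTop (tendsto_atTop_add_const_right _ _ tendsto_natCast_atTop_atTop)

/-- Lebesgue differentiation. It applies because the ratio of outer to inner radius stays equal to
`2`. -/
theorem ae_tendsto_mollify_bumpSeq (u : L2 n m) :
    ∀ᵐ x, Tendsto (fun k => mollify (bumpSeq k) u x) atTop (𝓝 (u x)) :=
  ContDiffBump.ae_convolution_tendsto_right_of_locallyIntegrable (K := 2) tendsto_bumpSeq_rOut
    (Eventually.of_forall fun k => by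
      change (2 : ℝ) / (k + 2) ≤ 2 * (1 / (k + 2))
      rw [mul_one_div]) (locallyIntegrable_L2 u)

theorem eLpNorm_fderiv_mollify_le (ρ : ContDiffBump (0 : Space n m)) {u : L2 n m}
    {g : Fin n ⊕ Fin m → L2 n m} (h : ∀ i, IsWeakDeriv i u (g i)) (μ : Measure (Space n m)) :
    eLpNorm (fderiv ℝ (mollify ρ u)) 2 μ ≤ ∑ i, eLpNorm (mollify ρ (g i)) 2 μ := by
  refine (eLpNorm_fderiv_le _ (contDiff_mollify ρ (locallyIntegrable_L2 u)) 2
    (by norm_num) μ).trans_eq ?_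
  simp only [fderiv_mollify_single ρ (h _)]

theorem eLpNorm_mollify_le (ρ : ContDiffBump (0 : Space n m)) (u : L2 n m) :
    eLpNorm (mollify ρ u) 2 volume ≤ eLpNorm u 2 volume := by
  rw [← ENNReal.pow_le_pow_left_iff two_ne_zero, eLpNorm_two_sq, eLpNorm_two_sq]
  exact lintegral_mollify_sq_le ρ (Lp.aestronglyMeasurable u)

theorem eLpNorm_ball_mollify_le (ρ : ContDiffBump (0 : Space n m)) (u : L2 n m)
    (k : Space n m) (R : ℝ) :
    eLpNorm (mollify ρ u) 2 (volume.restrict (Metric.ball k R))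
      ≤ eLpNorm u 2 (volume.restrict (Metric.ball k (R + ρ.rOut))) := by
  rw [← ENNReal.pow_le_pow_left_iff two_ne_zero, eLpNorm_two_sq, eLpNorm_two_sq]
  exact lintegral_ball_mollify_sq_le ρ (Lp.aestronglyMeasurable u) k R

/-- Translations are Lipschitz in `L²` on functions with weak derivatives in `L²`. -/
theorem eLpNorm_sub_translate_le {u : L2 n m} {g : Fin n ⊕ Fin m → L2 n m}
    (h : ∀ i, IsWeakDeriv i u (g i)) (t : Space n m) :
    eLpNorm (fun x => u x - u (x - t)) 2 volume ≤ ‖t‖ₑ * ∑ i, eLpNorm (g i) 2 volume := by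
  -- The estimate for smooth functions passes to `u` by Fatou, since the mollifications converge
  -- almost everywhere.
  refine Lp.eLpNorm_le_of_ae_tendsto (u := atTop)
    (f := fun k x => mollify (bumpSeq k) u x - mollify (bumpSeq k) u (x - t))
    (Eventually.of_forall fun k => ?_) (fun k => ?_) ?_
  · refine le_trans ?_ (mul_le_mul_right ((eLpNorm_fderiv_mollify_le (bumpSeq k) h volume).trans
      (Finset.sum_le_sum fun i _ => eLpNorm_mollify_le (bumpSeq k) (g i))) _)
    rw [← ENNReal.pow_le_pow_left_iff two_ne_zero, mul_pow, eLpNorm_two_sq, eLpNorm_two_sq]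
    exact lintegral_sub_translate_sq_le (contDiff_mollify _ (locallyIntegrable_L2 u)) t
  · have hc := (contDiff_mollify (bumpSeq k) (locallyIntegrable_L2 u)).continuous
    exact (hc.sub (hc.comp (by fun_prop))).aestronglyMeasurable
  · have h1 := ae_tendsto_mollify_bumpSeq u
    have h2 := (measurePreserving_sub_right volume t).quasiMeasurePreserving.ae h1
    filter_upwards [h1, h2] with x hx1 hx2
    exact hx1.sub hx2

/-- The error of mollification at scale `δ` is at most `δ` times the gradient. -/
theorem eLpNorm_mollify_sub_le (ρ : ContDiffBump (0 : Space n m)) {u : L2 n m}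
    {g : Fin n ⊕ Fin m → L2 n m} (h : ∀ i, IsWeakDeriv i u (g i)) :
    eLpNorm (fun x => mollify ρ u x - u x) 2 volume
      ≤ ENNReal.ofReal ρ.rOut * ∑ i, eLpNorm (g i) 2 volume := by
  have hu := Lp.aestronglyMeasurable u
  have hG : AEStronglyMeasurable (fun p : Space n m × Space n m => u (p.1 - p.2) - u p.1)
      (volume.prod volume) :=
    (hu.comp_quasiMeasurePreserving
      (quasiMeasurePreserving_sub_of_right_invariant volume volume)).sub hu.comp_fst
  have step : ∀ x, ‖mollify ρ u x - u x‖ₑ ^ 2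
      ≤ ∫⁻ t, ENNReal.ofReal (ρ.normed volume t) * ‖u (x - t) - u x‖ₑ ^ 2 := fun x => by
    have hi : Integrable (fun t => ρ.normed volume t • u (x - t)) := by
      have := (ρ.hasCompactSupport_normed (μ := volume)).convolutionExists_left (lsmul ℝ ℝ)
        ρ.continuous_normed (locallyIntegrable_L2 u) x
      simpa [ConvolutionExistsAt] using this
    -- The mollifier has mass one, so the error is an average of increments over `‖t‖ < ρ.rOut`,
    -- each controlled by the translation estimate.
    have : mollify ρ u x - u x = ∫ t, ρ.normed volume t • (u (x - t) - u x) := by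
      simp only [smul_sub]
      rw [integral_sub hi (ρ.integrable_normed.smul_const _), integral_smul_const,
        ρ.integral_normed, one_smul, mollify_apply]
    rw [this]
    exact enorm_integral_smul_sq_le ρ.nonneg_normed ρ.continuous_normed.measurable
      (lintegral_ofReal_normed ρ)
      ((aestronglyMeasurable_comp_sub hu x).sub aestronglyMeasurable_const)
  rw [← ENNReal.pow_le_pow_left_iff two_ne_zero, eLpNorm_two_sq]
  calc _ ≤ ∫⁻ x in Set.univ,
        ∫⁻ t, ENNReal.ofReal (ρ.normed volume t) * ‖u (x - t) - u x‖ₑ ^ 2 := by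
        rw [Measure.restrict_univ]; exact lintegral_mono step
    _ = ∫⁻ t, ENNReal.ofReal (ρ.normed volume t) *
          ∫⁻ x in Set.univ, ‖u (x - t) - u x‖ₑ ^ 2 :=
        lintegral_mollify_swap ρ (hG.enorm.pow_const 2) _
    _ ≤ _ := by
        refine lintegral_normed_mul_le ρ fun t ht => ?_
        rw [Measure.restrict_univ]
        have h1 := eLpNorm_sub_translate_le h t
        calc ∫⁻ x, ‖u (x - t) - u x‖ₑ ^ 2 = eLpNorm (fun x => u x - u (x - t)) 2 volume ^ 2 := by
              rw [eLpNorm_two_sq]; simp only [enorm_sub_rev]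
          _ ≤ (ENNReal.ofReal ρ.rOut * ∑ i, eLpNorm (g i) 2 volume) ^ 2 := by
              gcongr
              refine h1.trans ?_
              gcongr
              rw [← ofReal_norm]
              exact ENNReal.ofReal_le_ofReal ht.le

/-! ### Local Sobolev estimates -/

/-- A Lebesgue exponent `r < 2` whose Sobolev conjugate is at least `q`. -/
theorem exists_sobolev_exponent {d : ℕ} (hd : 2 ≤ d) {q : ℝ≥0} (hq0 : 0 < q)
    (hq : (q : ℝ) * (d - 2) < 2 * d) :
    ∃ r : ℝ≥0, 1 ≤ r ∧ r < 2 ∧ (r : ℝ)⁻¹ - (d : ℝ)⁻¹ ≤ (q : ℝ)⁻¹ := by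
  have hd' : (2 : ℝ) ≤ d := by exact_mod_cast hd
  have hq0' : (0 : ℝ) < q := by exact_mod_cast hq0
  have h1 : (1 / 2 : ℝ) < (q : ℝ)⁻¹ + (d : ℝ)⁻¹ := by
    rw [inv_eq_one_div, inv_eq_one_div, div_add_div _ _ hq0'.ne' (by positivity),
      div_lt_div_iff₀ (by norm_num) (by positivity)]
    nlinarith
  -- `s` is `1/r`. Subcriticality of `q` says `1/q + 1/d > 1/2`, hence `r < 2`; the cap at `1` keeps
  -- `1 ≤ r`.
  set s : ℝ := min 1 ((q : ℝ)⁻¹ + (d : ℝ)⁻¹) with hs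
  have hs1 : s ≤ 1 := min_le_left _ _
  have hs2 : 1 / 2 < s := lt_min (by norm_num) h1
  have hs0 : 0 < s := by linarith
  have hc : ((s.toNNReal⁻¹ : ℝ≥0) : ℝ) = s⁻¹ := by rw [NNReal.coe_inv, Real.coe_toNNReal s hs0.le]
  refine ⟨s.toNNReal⁻¹, ?_, ?_, ?_⟩
  · rw [← NNReal.coe_le_coe, hc]
    exact (one_le_inv₀ hs0).2 hs1
  · rw [← NNReal.coe_lt_coe, hc, NNReal.coe_ofNat, inv_lt_comm₀ hs0 (by norm_num)]; linarith
  · rw [hc, inv_inv]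
    linarith [min_le_right 1 ((q : ℝ)⁻¹ + (d : ℝ)⁻¹)]

/-- Cut off between radii `1` and `2`, apply the Gagliardo–Nirenberg–Sobolev inequality with an
exponent `r < 2`, and return from `L^r` to `L²` by Hölder on the ball. Since `r < 2 ≤ d`, the case
`d = 2` needs no separate treatment. -/
theorem exists_local_sobolev_contDiff (hd : 2 ≤ n + m) {q : ℝ≥0} (hq0 : 0 < q)
    (hq : (q : ℝ) * ((n + m : ℕ) - 2) < 2 * (n + m : ℕ)) :
    ∃ C : ℝ≥0, ∀ w : Space n m → ℂ, ContDiff ℝ 1 w →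
      eLpNorm w q (volume.restrict (Metric.ball 0 1))
        ≤ C * (eLpNorm w 2 (volume.restrict (Metric.ball 0 3))
          + eLpNorm (fderiv ℝ w) 2 (volume.restrict (Metric.ball 0 3))) := by
  obtain ⟨r, hr1, hr2, hrq⟩ := exists_sobolev_exponent hd hq0 hq
  have hfin : Module.finrank ℝ (Space n m) = n + m := by simp
  set χ : ContDiffBump (0 : Space n m) := ⟨1, 2, one_pos, one_lt_two⟩ with hχ
  have hχc : ContDiff ℝ 1 χ := χ.contDiff
  obtain ⟨A, hA⟩ := (χ.hasCompactSupport.fderiv ℝ).exists_bound_of_continuous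
    (hχc.continuous_fderiv one_ne_zero)
  have hA0 : 0 ≤ A := (norm_nonneg _).trans (hA 0)
  set B : Set (Space n m) := Metric.ball 0 3 with hB
  set K := eLpNormLESNormFDerivOfLeConst ℂ (volume : Measure (Space n m)) B r q
  set V : ℝ≥0∞ := (volume.restrict B) Set.univ ^ (1 / (r : ℝ) - 1 / 2)
  have hV : V ≠ ⊤ := by
    refine ENNReal.rpow_ne_top_of_nonneg ?_ ?_
    · have : (1 : ℝ) ≤ r := by exact_mod_cast hr1
      have : (r : ℝ) < 2 := by exact_mod_cast hr2
      rw [sub_nonneg]; gcongr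
    · rw [Measure.restrict_apply_univ]; exact measure_ball_lt_top.ne
  refine ⟨K * V.toNNReal * (A.toNNReal + 1), fun w hw => ?_⟩
  set v : Space n m → ℂ := fun x => χ x • w x with hv
  have hvc : ContDiff ℝ 1 v := hχc.smul hw
  have hts : tsupport v ⊆ Metric.closedBall 0 2 := by
    refine (closure_mono (Function.support_smul_subset_left χ w)).trans ?_
    exact χ.tsupport_eq.le
  have hcb : Metric.closedBall (0 : Space n m) 2 ⊆ B :=
    Metric.closedBall_subset_ball (by norm_num)
  have hpt : ∀ x, ‖fderiv ℝ v x‖ ≤ A * ‖w x‖ + ‖fderiv ℝ w x‖ := fun x => by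
    have h1 := ((hχc.differentiable one_ne_zero) x).hasFDerivAt.smul
      ((hw.differentiable one_ne_zero) x).hasFDerivAt
    have h1' : fderiv ℝ v x = _ := h1.fderiv
    rw [h1', add_comm]
    refine (norm_add_le _ _).trans (add_le_add ?_ ?_)
    · rw [ContinuousLinearMap.norm_smulRight_apply]
      gcongr; exact hA x
    · rw [norm_smul, Real.norm_of_nonneg χ.nonneg]
      exact mul_le_of_le_one_left (norm_nonneg _) χ.le_one
  have hfc := hw.continuous_fderiv one_ne_zero
  calc eLpNorm w q (volume.restrict (Metric.ball 0 1))
      = eLpNorm v q (volume.restrict (Metric.ball 0 1)) := by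
        refine eLpNorm_congr_ae ((ae_restrict_iff' measurableSet_ball).2
          (Eventually.of_forall fun x hx => ?_))
        rw [hv]; dsimp only
        rw [χ.one_of_mem_closedBall (Metric.ball_subset_closedBall hx), one_smul]
    _ ≤ eLpNorm v q volume := eLpNorm_mono_measure _ Measure.restrict_le_self
    _ ≤ K * eLpNorm (fderiv ℝ v) r volume := by
        refine eLpNorm_le_eLpNorm_fderiv_of_le volume hvc
          ((subset_tsupport v).trans (hts.trans hcb)) hr1 ?_ ?_ Metric.isBounded_ball
        · rw [hfin]
          exact hr2.trans_le (by exact_mod_cast hd)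
        · rw [hfin]; exact hrq
    _ = K * eLpNorm (fderiv ℝ v) r (volume.restrict B) := by
        rw [← eLpNorm_norm (fderiv ℝ v), ← eLpNorm_norm (fderiv ℝ v),
          eLpNorm_restrict_eq_of_support_subset]
        exact fun x hx => hcb (hts (support_fderiv_subset ℝ fun h0 => hx (by simp [h0])))
    _ ≤ K * (eLpNorm (fderiv ℝ v) 2 (volume.restrict B) * V) := by
        gcongr
        have := eLpNorm_le_eLpNorm_mul_rpow_measure_univ (μ := volume.restrict B)
          (f := fderiv ℝ v) (p := r) (q := 2) (by exact_mod_cast hr2.le)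
          (hvc.continuous_fderiv one_ne_zero).aestronglyMeasurable
        simpa only [ENNReal.toReal_ofNat, ENNReal.coe_toReal] using this
    _ ≤ K * ((A.toNNReal * eLpNorm w 2 (volume.restrict B)
          + eLpNorm (fderiv ℝ w) 2 (volume.restrict B)) * V) := by
        gcongr
        calc eLpNorm (fderiv ℝ v) 2 (volume.restrict B)
            ≤ eLpNorm ((A • fun x => ‖w x‖) + fun x => ‖fderiv ℝ w x‖) 2
                (volume.restrict B) :=
              eLpNorm_mono_real hpt
          _ ≤ _ := by
              refine (eLpNorm_add_le (hw.continuous.norm.const_smul A).aestronglyMeasurable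
                hfc.norm.aestronglyMeasurable (by norm_num)).trans ?_
              rw [eLpNorm_const_smul, eLpNorm_norm, eLpNorm_norm,
                Real.enorm_of_nonneg hA0]
              rfl
    _ ≤ K * (((A.toNNReal + 1) * eLpNorm w 2 (volume.restrict B)
          + (A.toNNReal + 1) * eLpNorm (fderiv ℝ w) 2 (volume.restrict B)) * V) := by
        gcongr
        · exact le_self_add
        · exact le_mul_of_one_le_left zero_le le_add_self
    _ = _ := by
        rw [ENNReal.coe_mul, ENNReal.coe_mul, ENNReal.coe_toNNReal hV]
        push_cast
        ring

theorem eLpNorm_comp_add_right_ball {F : Type*} [NormedAddCommGroup F] (f : Space n m → F)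
    (p : ℝ≥0∞) (k : Space n m) (R : ℝ) (hf : Continuous f) :
    eLpNorm (fun x => f (x + k)) p (volume.restrict (Metric.ball 0 R))
      = eLpNorm f p (volume.restrict (Metric.ball k R)) := by
  have h := (measurePreserving_add_right (volume : Measure (Space n m)) k).restrict_preimage
    (measurableSet_ball (x := k) (ε := R))
  have hpre : (fun x : Space n m => x + k) ⁻¹' Metric.ball k R = Metric.ball 0 R := by
    ext x; simp [dist_eq_norm]
  rw [hpre] at h
  exact eLpNorm_comp_measurePreserving hf.aestronglyMeasurable h

/-- A local Sobolev inequality, uniform in the centre of the ball. -/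
theorem exists_local_sobolev (hd : 2 ≤ n + m) {q : ℝ≥0} (hq0 : 0 < q)
    (hq : (q : ℝ) * ((n + m : ℕ) - 2) < 2 * (n + m : ℕ)) :
    ∃ C : ℝ≥0, ∀ (u : L2 n m) (g : Fin n ⊕ Fin m → L2 n m), (∀ i, IsWeakDeriv i u (g i)) →
      ∀ k, eLpNorm u q (volume.restrict (Metric.ball k 1))
        ≤ C * (eLpNorm u 2 (volume.restrict (Metric.ball k 4))
          + ∑ i, eLpNorm (g i) 2 (volume.restrict (Metric.ball k 4))) := by
  obtain ⟨C, hC⟩ := exists_local_sobolev_contDiff hd hq0 hq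
  refine ⟨C, fun u g h k => ?_⟩
  have hcd : ∀ j, ContDiff ℝ 1 (mollify (bumpSeq j) u) := fun j =>
    contDiff_mollify _ (locallyIntegrable_L2 u)
  -- The radius grows from `3` to `4` because every mollifier has outer radius at most `1`.
  have hmono : ∀ (f : L2 n m) (j : ℕ), eLpNorm (mollify (bumpSeq j) f) 2
      (volume.restrict (Metric.ball k 3)) ≤ eLpNorm f 2 (volume.restrict (Metric.ball k 4)) :=
    fun f j => (eLpNorm_ball_mollify_le _ f k 3).trans
      (eLpNorm_mono_measure _ (Measure.restrict_mono_set _ (Metric.ball_subset_ball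
        (by linarith [bumpSeq_rOut_le_one (n := n) (m := m) j]))))
  refine Lp.eLpNorm_le_of_ae_tendsto (u := atTop) (f := fun j => mollify (bumpSeq j) u)
    (Eventually.of_forall fun j => ?_) (fun j => (hcd j).continuous.aestronglyMeasurable)
    (ae_restrict_of_ae (ae_tendsto_mollify_bumpSeq u))
  have h1 := hC (fun x => mollify (bumpSeq j) u (x + k)) ((hcd j).comp (by fun_prop))
  have hfd : fderiv ℝ (fun x => mollify (bumpSeq j) u (x + k))
      = fun x => fderiv ℝ (mollify (bumpSeq j) u) (x + k) :=
    funext fun x => fderiv_comp_add_right k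
  rw [hfd] at h1
  rw [eLpNorm_comp_add_right_ball _ _ _ _ (hcd j).continuous,
    eLpNorm_comp_add_right_ball _ _ _ _ (hcd j).continuous,
    eLpNorm_comp_add_right_ball _ _ _ _ ((hcd j).continuous_fderiv one_ne_zero)] at h1
  refine h1.trans ?_
  gcongr
  · exact hmono u j
  · exact (eLpNorm_fderiv_mollify_le _ h _).trans (Finset.sum_le_sum fun i _ => hmono (g i) j)

/-! ### The Hilbert space `B1` -/

/-- Makes instance search prefer the Hilbert space structure over `WithCStarModule`. -/
noncomputable instance : Inner ℂ (B1 n m) := InnerProductSpace.toInner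

@[simp] theorem val_add (u v : B1 n m) : val (u + v) = val u + val v := rfl
@[simp] theorem val_sub (u v : B1 n m) : val (u - v) = val u - val v := rfl
@[simp] theorem val_smul (c : ℂ) (u : B1 n m) : val (c • u) = c • val u := rfl
@[simp] theorem moment_smul (c : ℂ) (u : B1 n m) : moment (c • u) = c • moment u := rfl
@[simp] theorem grad_smul (c : ℂ) (u : B1 n m) (i : Fin n ⊕ Fin m) :
    grad (c • u) i = c • grad u i := rfl

theorem isWeakDeriv_grad (u : B1 n m) (i : Fin n ⊕ Fin m) : IsWeakDeriv i (val u) (grad u i) :=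
  u.2.2 i

theorem isMoment_moment (u : B1 n m) : IsMoment (val u) (moment u) := u.2.1

theorem norm_sq_eq (u : B1 n m) :
    ‖u‖ ^ 2 = gradYSq u + gradZSq u + ‖moment u‖ ^ 2 + ‖val u‖ ^ 2 := by
  rw [Submodule.coe_norm, PiLp.norm_sq_eq_of_L2, Fintype.sum_sum_type, Fintype.sum_sum_type,
    Fin.sum_univ_two]
  change ‖val u‖ ^ 2 + ‖moment u‖ ^ 2 + (gradYSq u + gradZSq u) = _
  ring

theorem inner_eq (v u : B1 n m) :
    inner ℂ v u = (∑ i, inner ℂ (grad v i) (grad u i)) + inner ℂ (moment v) (moment u)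
      + inner ℂ (val v) (val u) := by
  rw [Submodule.coe_inner, PiLp.inner_apply, Fintype.sum_sum_type, Fin.sum_univ_two]
  change inner ℂ (val v) (val u) + inner ℂ (moment v) (moment u)
    + ∑ i, inner ℂ (grad v i) (grad u i) = _
  ring

theorem gradYSq_nonneg (u : B1 n m) : 0 ≤ gradYSq u := Finset.sum_nonneg fun _ _ => sq_nonneg _

theorem gradZSq_nonneg (u : B1 n m) : 0 ≤ gradZSq u := Finset.sum_nonneg fun _ _ => sq_nonneg _

theorem norm_val_le (u : B1 n m) : ‖val u‖ ≤ ‖u‖ := by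
  refine le_of_sq_le_sq ?_ (norm_nonneg _)
  rw [norm_sq_eq u]
  nlinarith [gradYSq_nonneg u, gradZSq_nonneg u, sq_nonneg ‖moment u‖]

theorem norm_moment_le (u : B1 n m) : ‖moment u‖ ≤ ‖u‖ := by
  refine le_of_sq_le_sq ?_ (norm_nonneg _)
  rw [norm_sq_eq u]
  nlinarith [gradYSq_nonneg u, gradZSq_nonneg u, sq_nonneg ‖val u‖]

/-- `val` as a continuous linear map. -/
noncomputable def valL : B1 n m →L[ℂ] L2 n m :=
  LinearMap.mkContinuous
    { toFun := val, map_add' := fun _ _ => rfl, map_smul' := fun _ _ => rfl } 1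
    fun u => by rw [one_mul]; exact norm_val_le u

/-- Integration against a test function is an inner product in `L²`. -/
theorem exists_inner_eq_integral_smul {φ : Space n m → ℝ} (hc : Continuous φ)
    (hs : HasCompactSupport φ) :
    ∃ f : L2 n m, ∀ u : L2 n m, ∫ x, φ x • u x = inner ℂ f u := by
  have hf : MemLp (fun x => (φ x : ℂ)) 2 volume :=
    (Complex.continuous_ofReal.comp hc).memLp_of_hasCompactSupport
      (hs.comp_left (g := fun r : ℝ => (r : ℂ)) Complex.ofReal_zero)
  refine ⟨hf.toLp _, fun u => ?_⟩
  rw [L2.inner_def]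
  refine integral_congr_ae ?_
  filter_upwards [hf.coeFn_toLp] with x hx
  rw [hx]
  simp [mul_comm]

theorem continuous_integral_smul {φ : Space n m → ℝ} (hc : Continuous φ)
    (hs : HasCompactSupport φ) : Continuous fun u : L2 n m => ∫ x, φ x • u x := by
  obtain ⟨f, hf⟩ := exists_inner_eq_integral_smul hc hs
  simp only [hf]
  exact continuous_const.inner continuous_id

theorem exists_ae_tendsto_subseq {u : ℕ → L2 n m} {v : L2 n m} (h : Tendsto u atTop (𝓝 v)) :
    ∃ ns : ℕ → ℕ, StrictMono ns ∧ ∀ᵐ x, Tendsto (fun k => u (ns k) x) atTop (𝓝 (v x)) :=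
  (tendstoInMeasure_of_tendsto_Lp h).exists_seq_tendsto_ae

/-- A pointwise relation survives `L²` limits because a subsequence converges almost everywhere; the
second subsequence is drawn from the first so that both components converge along it. -/
theorem isClosed_isMoment :
    IsClosed {p : L2 n m × L2 n m | IsMoment p.1 p.2} := by
  refine IsSeqClosed.isClosed fun s p hs hp => ?_
  have h1 : Tendsto (fun k => (s k).1) atTop (𝓝 p.1) := (continuous_fst.tendsto _).comp hp
  have h2 : Tendsto (fun k => (s k).2) atTop (𝓝 p.2) := (continuous_snd.tendsto _).comp hp
  obtain ⟨a, ha, ha'⟩ := exists_ae_tendsto_subseq h1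
  obtain ⟨b, hb, hb'⟩ := exists_ae_tendsto_subseq (h2.comp ha.tendsto_atTop)
  have hall : ∀ᵐ x, ∀ k, (s k).2 x = yNorm x • (s k).1 x := ae_all_iff.2 hs
  filter_upwards [ha', hb', hall] with x hx1 hx2 hx3
  refine tendsto_nhds_unique hx2 ?_
  simp only [Function.comp_apply, hx3]
  exact (hx1.comp hb.tendsto_atTop).const_smul (yNorm x)

/-- Each weak derivative identity equates two continuous functionals on `L²`. Closedness gives
completeness, hence the Riesz representation used for weak limits. -/
theorem isClosed_B1 : IsClosed (B1 n m : Set (PiLp 2 fun _ : Fin 2 ⊕ (Fin n ⊕ Fin m) => L2 n m)) := by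
  have hc : ∀ s, Continuous fun U : PiLp 2 (fun _ : Fin 2 ⊕ (Fin n ⊕ Fin m) => L2 n m) => U s :=
    fun s => PiLp.continuous_apply 2 _ s
  have h1 := isClosed_isMoment.preimage ((hc (Sum.inl 0)).prodMk (hc (Sum.inl 1)))
  have h2 : IsClosed {U : PiLp 2 (fun _ : Fin 2 ⊕ (Fin n ⊕ Fin m) => L2 n m) |
      ∀ i, IsWeakDeriv i (U (Sum.inl 0)) (U (Sum.inr i))} := by
    simp only [IsWeakDeriv, Set.ofPred_forall]
    refine isClosed_iInter fun i => isClosed_iInter fun φ => isClosed_iInter fun hφ =>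
      isClosed_iInter fun hs => isClosed_eq ?_ ?_
    · exact (continuous_integral_smul (continuous_partialDeriv i hφ)
        (hasCompactSupport_partialDeriv i hs)).comp (hc _)
    · exact ((continuous_integral_smul hφ.continuous hs).comp (hc _)).neg
  exact h1.inter h2

instance : CompleteSpace (B1 n m) := isClosed_B1.completeSpace_coe

/-- Separability is what makes bounded sequences weakly subconvergent in `exists_weak_limit`. -/
instance : SecondCountableTopology (B1 n m) := by
  have : Fact ((2 : ℝ≥0∞) ≠ ⊤) := ⟨by norm_num⟩
  have : SecondCountableTopology (PiLp 2 fun _ : Fin 2 ⊕ (Fin n ⊕ Fin m) => L2 n m) :=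
    (PiLp.homeomorph 2 fun _ : Fin 2 ⊕ (Fin n ⊕ Fin m) => L2 n m).secondCountableTopology
  exact inferInstanceAs (SecondCountableTopology
    (B1 n m : Set (PiLp 2 fun _ : Fin 2 ⊕ (Fin n ⊕ Fin m) => L2 n m)))

theorem continuous_yNorm : Continuous (yNorm : Space n m → ℝ) := by
  unfold yNorm; fun_prop

/-- A nonzero element of the energy space, given by a bump function. -/
theorem exists_potential_pos (σ : ℝ) (hσ : 0 < σ) : ∃ u : B1 n m, 0 < potential σ u := by
  set f : ContDiffBump (0 : Space n m) := ⟨1, 2, one_pos, one_lt_two⟩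
  have hf : ContDiff ℝ ∞ f := f.contDiff
  have hs := f.hasCompactSupport
  have memLp : ∀ {φ : Space n m → ℝ}, Continuous φ → HasCompactSupport φ →
      MemLp (fun x => (φ x : ℂ)) 2 volume := fun hc hs =>
    (Complex.continuous_ofReal.comp hc).memLp_of_hasCompactSupport
      (hs.comp_left (g := fun r : ℝ => (r : ℂ)) Complex.ofReal_zero)
  have h0 := memLp hf.continuous hs
  have h1 : MemLp (fun x => ((yNorm x * f x : ℝ) : ℂ)) 2 volume :=
    memLp (continuous_yNorm.mul hf.continuous) hs.mul_left
  have h2 := fun i => memLp (continuous_partialDeriv i hf) (hasCompactSupport_partialDeriv i hs)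
  let U : PiLp 2 (fun _ : Fin 2 ⊕ (Fin n ⊕ Fin m) => L2 n m) := WithLp.toLp 2
    (Sum.elim ![h0.toLp _, h1.toLp _] fun i => (h2 i).toLp _)
  have hU : U ∈ B1 n m := by
    refine ⟨?_, fun i φ hφ hφs => ?_⟩
    · change ∀ᵐ x, (h1.toLp _) x = yNorm x • (h0.toLp _) x
      filter_upwards [h0.coeFn_toLp, h1.coeFn_toLp] with x hx0 hx1
      rw [hx0, hx1]; simp
    · change ∫ x, partialDeriv i φ x • (h0.toLp _) x = -∫ x, φ x • ((h2 i).toLp _) x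
      have e1 : ∫ x, partialDeriv i φ x • (h0.toLp _) x
          = ((∫ x, partialDeriv i φ x * f x : ℝ) : ℂ) := by
        rw [← integral_complex_ofReal]
        refine integral_congr_ae ?_
        filter_upwards [h0.coeFn_toLp] with x hx
        rw [hx]; simp
      have e2 : ∫ x, φ x • ((h2 i).toLp _) x = ((∫ x, φ x * partialDeriv i f x : ℝ) : ℂ) := by
        rw [← integral_complex_ofReal]
        refine integral_congr_ae ?_
        filter_upwards [(h2 i).coeFn_toLp] with x hx
        rw [hx]; simp
      have hint : ∀ {a b : Space n m → ℝ}, Continuous a → HasCompactSupport a → Continuous b →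
          Integrable fun x => a x * b x := fun ha hs hb =>
        (ha.mul hb).integrable_of_hasCompactSupport hs.mul_right
      rw [e1, e2, ← Complex.ofReal_neg]
      congr 1
      have := integral_mul_fderiv_eq_neg_fderiv_mul_of_integrable (𝕜 := ℝ) (μ := volume)
        (f := φ) (g := f) (v := EuclideanSpace.single i 1)
        (hint (continuous_partialDeriv i hφ) (hasCompactSupport_partialDeriv i hφs) hf.continuous)
        (hint hφ.continuous hφs (continuous_partialDeriv i hf))
        (hint hφ.continuous hφs hf.continuous)
        (fun x _ => hφ.differentiable (by simp) x) (fun x _ => hf.differentiable (by simp) x)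
      simp only [partialDeriv]
      rw [this, neg_neg]
  refine ⟨⟨U, hU⟩, ?_⟩
  have e : potential σ (⟨U, hU⟩ : B1 n m) = ∫ x, f x ^ (2 * σ + 2) := by
    refine integral_congr_ae ?_
    filter_upwards [h0.coeFn_toLp] with x hx
    change ‖(h0.toLp _) x‖ ^ _ = _
    rw [hx, Complex.norm_of_nonneg f.nonneg]
  rw [e]
  refine Continuous.integral_pos_of_hasCompactSupport_nonneg_nonzero (x := 0)
    (hf.continuous.rpow_const fun x => Or.inr (by positivity)) ?_
    (fun x => Real.rpow_nonneg f.nonneg _) ?_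
  · exact hs.comp_left (g := fun r : ℝ => r ^ (2 * σ + 2)) (Real.zero_rpow (by positivity))
  · rw [f.one_of_mem_closedBall (by simp [f]), Real.one_rpow]; exact one_ne_zero

/-! ### Affine changes of the unconfined variable -/

/-- The affine map `(y, z) ↦ (y, c z + e)`. -/
def zAffine (c : ℝ) (e : Fin m → ℝ) (x : Space n m) : Space n m :=
  WithLp.toLp 2 (Sum.elim (fun j => x (Sum.inl j)) fun k => c * x (Sum.inr k) + e k)

@[simp] theorem zAffine_inl (c : ℝ) (e : Fin m → ℝ) (x : Space n m) (j : Fin n) :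
    zAffine c e x (Sum.inl j) = x (Sum.inl j) := rfl

@[simp] theorem zAffine_inr (c : ℝ) (e : Fin m → ℝ) (x : Space n m) (k : Fin m) :
    zAffine c e x (Sum.inr k) = c * x (Sum.inr k) + e k := rfl

@[simp] theorem yNorm_zAffine (c : ℝ) (e : Fin m → ℝ) (x : Space n m) :
    yNorm (zAffine c e x) = yNorm x := rfl

theorem contDiff_zAffine (c : ℝ) (e : Fin m → ℝ) :
    ContDiff ℝ ∞ (zAffine c e : Space n m → Space n m) := by
  rw [contDiff_euclidean]
  rintro (j | k)
  · simp only [zAffine_inl]; fun_prop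
  · simp only [zAffine_inr]; fun_prop

/-- `zAffine` as a homeomorphism. -/
noncomputable def zAffineHomeo {c : ℝ} (hc : c ≠ 0) (e : Fin m → ℝ) : Space n m ≃ₜ Space n m where
  toFun := zAffine c e
  invFun := zAffine c⁻¹ fun k => -(c⁻¹ * e k)
  left_inv x := by
    ext (j | k)
    · simp
    · simp; field_simp; ring
  right_inv x := by
    ext (j | k)
    · simp
    · simp; field_simp; ring
  continuous_toFun := (contDiff_zAffine _ _).continuous
  continuous_invFun := (contDiff_zAffine _ _).continuous

/-- Up to a translation the map is diagonal, with determinant `c ^ m`. -/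
theorem map_zAffine {c : ℝ} (hc : 0 < c) (e : Fin m → ℝ) :
    Measure.map (zAffine c e) (volume : Measure (Space n m))
      = ENNReal.ofReal ((c ^ m)⁻¹) • volume := by
  classical
  set b := (EuclideanSpace.basisFun (Fin n ⊕ Fin m) ℝ).toBasis
  set D : Matrix (Fin n ⊕ Fin m) (Fin n ⊕ Fin m) ℝ :=
    Matrix.diagonal (Sum.elim (fun _ => 1) fun _ => c) with hD
  set L : Space n m →ₗ[ℝ] Space n m := Matrix.toLin b b D with hL
  have hdet : LinearMap.det L = c ^ m := by
    rw [hL, LinearMap.det_toLin, hD, Matrix.det_diagonal, Fintype.prod_sum_type]; simp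
  have happ : ∀ x s, L x s = Sum.elim (fun _ => 1) (fun _ => c) s * x s := fun x s => by
    have : L x = Matrix.toLin b b D x := rfl
    rw [this, Matrix.toLin_apply]
    simp only [b, OrthonormalBasis.coe_toBasis, EuclideanSpace.basisFun_apply, WithLp.ofLp_sum,
      Finset.sum_apply, hD, Matrix.mulVec_diagonal]
    rw [Finset.sum_eq_single s] <;> simp +contextual [eq_comm]
  have hcomp : (zAffine c e : Space n m → Space n m)
      = (fun x => x + WithLp.toLp 2 (Sum.elim (fun _ => 0) e)) ∘ L := by
    funext x
    ext (j | k) <;> simp [happ]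
  have hLm : Measurable L := L.continuous_of_finiteDimensional.measurable
  rw [hcomp, ← Measure.map_map (measurable_add_const _) hLm,
    Measure.map_linearMap_addHaar_eq_smul_addHaar _ (by rw [hdet]; positivity),
    Measure.map_smul, map_add_right_eq_self, hdet, abs_of_pos (by positivity)]

theorem quasiMeasurePreserving_zAffine {c : ℝ} (hc : 0 < c) (e : Fin m → ℝ) :
    Measure.QuasiMeasurePreserving (zAffine c e : Space n m → Space n m) volume volume where
  measurable := (contDiff_zAffine c e).continuous.measurable
  absolutelyContinuous := by
    rw [map_zAffine hc e]; exact Measure.smul_absolutelyContinuous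

theorem integral_comp_zAffine {F : Type*} [NormedAddCommGroup F] [NormedSpace ℝ F] {c : ℝ}
    (hc : 0 < c) (e : Fin m → ℝ) (f : Space n m → F) :
    ∫ x, f (zAffine c e x) = (c ^ m)⁻¹ • ∫ x, f x := by
  have h := (zAffineHomeo (n := n) hc.ne' e).measurableEmbedding.integral_map (μ := volume) f
  change ∫ y, f y ∂(Measure.map (zAffine c e) volume) = ∫ x, f (zAffine c e x) at h
  rw [← h, map_zAffine hc e, integral_smul_measure, ENNReal.toReal_ofReal (by positivity)]

theorem lintegral_comp_zAffine {c : ℝ} (hc : 0 < c) (e : Fin m → ℝ) (f : Space n m → ℝ≥0∞) :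
    ∫⁻ x, f (zAffine c e x) = ENNReal.ofReal ((c ^ m)⁻¹) * ∫⁻ x, f x := by
  have h := (zAffineHomeo (n := n) hc.ne' e).measurableEmbedding.lintegral_map (μ := volume) f
  change ∫⁻ y, f y ∂(Measure.map (zAffine c e) volume) = ∫⁻ x, f (zAffine c e x) at h
  rw [← h, map_zAffine hc e, lintegral_smul_measure, smul_eq_mul]

theorem memLp_comp_zAffine {c : ℝ} (hc : 0 < c) (e : Fin m → ℝ) (u : L2 n m) :
    MemLp (fun x => u (zAffine c e x)) 2 volume := by
  have h : MemLp u 2 (Measure.map (zAffine c e) volume) := by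
    rw [map_zAffine hc e]
    exact (Lp.memLp u).smul_measure ENNReal.ofReal_ne_top
  exact h.comp_of_map (contDiff_zAffine c e).continuous.aemeasurable

/-- The substitution `u ↦ u(y, c z + e)` on `L²`. -/
noncomputable def substL2 {c : ℝ} (hc : 0 < c) (e : Fin m → ℝ) (u : L2 n m) : L2 n m :=
  (memLp_comp_zAffine hc e u).toLp _

theorem coeFn_substL2 {c : ℝ} (hc : 0 < c) (e : Fin m → ℝ) (u : L2 n m) :
    ∀ᵐ x, substL2 hc e u x = u (zAffine c e x) := (memLp_comp_zAffine hc e u).coeFn_toLp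

theorem norm_sq_L2 (u : L2 n m) : ‖u‖ ^ 2 = ∫ x, ‖u x‖ ^ 2 := by
  have h := L2.inner_def (𝕜 := ℂ) u u
  have h2 : inner ℂ u u = ((∫ x, ‖u x‖ ^ 2 : ℝ) : ℂ) := by
    rw [h, ← integral_complex_ofReal]
    refine integral_congr_ae (Eventually.of_forall fun x => ?_)
    dsimp only
    rw [inner_self_eq_norm_sq_to_K]; simp
  rw [inner_self_eq_norm_sq_to_K] at h2
  exact Complex.ofReal_injective (by rw [← h2]; norm_cast)

theorem norm_sq_substL2 {c : ℝ} (hc : 0 < c) (e : Fin m → ℝ) (u : L2 n m) :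
    ‖substL2 hc e u‖ ^ 2 = (c ^ m)⁻¹ * ‖u‖ ^ 2 := by
  rw [norm_sq_L2, norm_sq_L2, ← smul_eq_mul, ← integral_comp_zAffine hc e]
  refine integral_congr_ae ?_
  filter_upwards [coeFn_substL2 hc e u] with x hx
  rw [hx]

/-- The scaling factors of the map `zAffine`. -/
def zFactor (c : ℝ) : Fin n ⊕ Fin m → ℝ := Sum.elim (fun _ => 1) fun _ => c

/-- Both sides are derivatives at `0` of the same function of one variable, because `zAffine` sends
a coordinate line to a coordinate line at speed `zFactor c i`. -/
theorem partialDeriv_comp_zAffine (c : ℝ) (e : Fin m → ℝ) (i : Fin n ⊕ Fin m)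
    {φ : Space n m → ℝ} (hφ : ContDiff ℝ ∞ φ) (x : Space n m) :
    partialDeriv i (fun x => φ (zAffine c e x)) x
      = zFactor c i * partialDeriv i φ (zAffine c e x) := by
  have hline : ∀ t : ℝ, zAffine c e (x + t • EuclideanSpace.single i 1)
      = zAffine c e x + (zFactor c i * t) • EuclideanSpace.single i 1 := fun t => by
    ext (j | k)
    · rcases i with i | i <;> simp [zFactor]
    · rcases i with i | i
      · simp [zFactor]
      · simp [zFactor]; split_ifs <;> ring
  have hψ : Differentiable ℝ (fun x => φ (zAffine c e x)) :=
    (hφ.comp (contDiff_zAffine c e)).differentiable (by simp)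
  have hφ' : Differentiable ℝ φ := hφ.differentiable (by simp)
  have h1 : HasDerivAt (fun t : ℝ => x + t • EuclideanSpace.single i (1 : ℝ))
      (EuclideanSpace.single i 1) 0 := by
    simpa using ((hasDerivAt_id (0 : ℝ)).smul_const (EuclideanSpace.single i (1 : ℝ))).const_add x
  have h2 : HasDerivAt (fun t : ℝ => zAffine c e x
      + (zFactor c i * t) • EuclideanSpace.single i (1 : ℝ))
      (zFactor c i • EuclideanSpace.single i 1) 0 := by
    simpa using (((hasDerivAt_id (0 : ℝ)).const_mul (zFactor c i)).smul_const
      (EuclideanSpace.single i (1 : ℝ))).const_add (zAffine c e x)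
  have h3 : HasDerivAt (fun t : ℝ => φ (zAffine c e (x + t • EuclideanSpace.single i 1)))
      (partialDeriv i (fun x => φ (zAffine c e x)) x) 0 := by
    have := (hψ (x + (0 : ℝ) • EuclideanSpace.single i 1)).hasFDerivAt.comp_hasDerivAt 0 h1
    rw [zero_smul, add_zero] at this
    exact this
  have h4 : HasDerivAt (fun t : ℝ => φ (zAffine c e (x + t • EuclideanSpace.single i 1)))
      (zFactor c i * partialDeriv i φ (zAffine c e x)) 0 := by
    simp only [hline]
    have := (hφ' (zAffine c e x + (zFactor c i * 0) • EuclideanSpace.single i 1)).hasFDerivAt.comp_hasDerivAt 0 h2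
    rw [mul_zero, zero_smul, add_zero, map_smul, smul_eq_mul] at this
    exact this
  exact h3.unique h4

theorem integral_smul_substL2 {c : ℝ} (hc : 0 < c) (e : Fin m → ℝ) (φ : Space n m → ℝ)
    (u : L2 n m) :
    ∫ x, φ (zAffine c e x) • substL2 hc e u x = (c ^ m)⁻¹ • ∫ x, φ x • u x := by
  rw [← integral_comp_zAffine hc e]
  refine integral_congr_ae ?_
  filter_upwards [coeFn_substL2 hc e u] with x hx
  rw [hx]

/-- Move the substitution onto the test function. The Jacobian appears on both sides and cancels,
leaving only the chain rule factor. -/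
theorem IsWeakDeriv.subst {c : ℝ} (hc : 0 < c) (e : Fin m → ℝ) {i : Fin n ⊕ Fin m}
    {u g : L2 n m} (h : IsWeakDeriv i u g) :
    IsWeakDeriv i (substL2 hc e u) ((zFactor c i : ℂ) • substL2 hc e g) := by
  intro φ hφ hs
  set ψ : Space n m → ℝ := fun x => φ ((zAffineHomeo hc.ne' e).symm x) with hψ
  have hψc : ContDiff ℝ ∞ ψ := hφ.comp (contDiff_zAffine _ _)
  have hψs : HasCompactSupport ψ := hs.comp_homeomorph _
  have hφψ : φ = fun x => ψ (zAffine c e x) := by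
    funext x
    exact congrArg φ ((zAffineHomeo hc.ne' e).symm_apply_apply x).symm
  have h1 : ∀ x, partialDeriv i φ x • substL2 hc e u x
      = (zFactor c i : ℂ) * (partialDeriv i ψ (zAffine c e x) • substL2 hc e u x) := fun x => by
    rw [hφψ, partialDeriv_comp_zAffine c e i hψc]
    simp only [Complex.real_smul]; push_cast; ring
  simp only [h1]
  rw [integral_smul_smul, integral_const_mul, integral_smul_substL2 hc e (partialDeriv i ψ) u,
    h ψ hψc hψs, smul_neg, ← integral_smul_substL2 hc e ψ g, mul_neg, hφψ]

/-- The substitution `u ↦ u(y, c z + e)` on the energy space. -/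
noncomputable def subst {c : ℝ} (hc : 0 < c) (e : Fin m → ℝ) (u : B1 n m) : B1 n m :=
  ⟨WithLp.toLp 2 (Sum.elim ![substL2 hc e (val u), substL2 hc e (moment u)]
    fun i => (zFactor c i : ℂ) • substL2 hc e (grad u i)), by
    refine ⟨?_, fun i => (isWeakDeriv_grad u i).subst hc e⟩
    change ∀ᵐ x, substL2 hc e (moment u) x = yNorm x • substL2 hc e (val u) x
    have h := (quasiMeasurePreserving_zAffine hc e).ae (isMoment_moment u)
    filter_upwards [h, coeFn_substL2 hc e (val u), coeFn_substL2 hc e (moment u)]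
      with x h1 h2 h3
    rw [h2, h3, h1, yNorm_zAffine]⟩

theorem val_subst {c : ℝ} (hc : 0 < c) (e : Fin m → ℝ) (u : B1 n m) :
    val (subst hc e u) = substL2 hc e (val u) := rfl

theorem norm_sq_val_subst {c : ℝ} (hc : 0 < c) (e : Fin m → ℝ) (u : B1 n m) :
    ‖val (subst hc e u)‖ ^ 2 = (c ^ m)⁻¹ * ‖val u‖ ^ 2 := norm_sq_substL2 hc e _

theorem norm_sq_moment_subst {c : ℝ} (hc : 0 < c) (e : Fin m → ℝ) (u : B1 n m) :
    ‖moment (subst hc e u)‖ ^ 2 = (c ^ m)⁻¹ * ‖moment u‖ ^ 2 := norm_sq_substL2 hc e _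

theorem norm_sq_grad_subst {c : ℝ} (hc : 0 < c) (e : Fin m → ℝ) (u : B1 n m)
    (i : Fin n ⊕ Fin m) :
    ‖grad (subst hc e u) i‖ ^ 2 = zFactor c i ^ 2 * ((c ^ m)⁻¹ * ‖grad u i‖ ^ 2) := by
  change ‖(zFactor c i : ℂ) • substL2 hc e (grad u i)‖ ^ 2 = _
  rw [norm_smul, mul_pow, norm_sq_substL2, Complex.norm_real, Real.norm_eq_abs, sq_abs]

theorem gradYSq_subst {c : ℝ} (hc : 0 < c) (e : Fin m → ℝ) (u : B1 n m) :
    gradYSq (subst hc e u) = (c ^ m)⁻¹ * gradYSq u := by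
  simp only [gradYSq, norm_sq_grad_subst, Finset.mul_sum]
  simp [zFactor]

theorem gradZSq_subst {c : ℝ} (hc : 0 < c) (e : Fin m → ℝ) (u : B1 n m) :
    gradZSq (subst hc e u) = c ^ 2 * (c ^ m)⁻¹ * gradZSq u := by
  simp only [gradZSq, norm_sq_grad_subst, Finset.mul_sum]
  simp [zFactor, mul_assoc]

theorem potential_subst {c : ℝ} (hc : 0 < c) (e : Fin m → ℝ) (σ : ℝ) (u : B1 n m) :
    potential σ (subst hc e u) = (c ^ m)⁻¹ * potential σ u := by
  refine Eq.trans (integral_congr_ae ?_)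
    (integral_comp_zAffine hc e fun x => ‖val u x‖ ^ (2 * σ + 2))
  filter_upwards [coeFn_substL2 hc e (val u)] with x hx
  rw [val_subst, hx]

theorem gradYSq_smul (c : ℂ) (u : B1 n m) : gradYSq (c • u) = ‖c‖ ^ 2 * gradYSq u := by
  simp only [gradYSq, grad_smul, norm_smul, mul_pow, Finset.mul_sum]

theorem gradZSq_smul (c : ℂ) (u : B1 n m) : gradZSq (c • u) = ‖c‖ ^ 2 * gradZSq u := by
  simp only [gradZSq, grad_smul, norm_smul, mul_pow, Finset.mul_sum]

theorem potential_smul (σ : ℝ) (c : ℂ) (u : B1 n m) :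
    potential σ (c • u) = ‖c‖ ^ (2 * σ + 2) * potential σ u := by
  rw [potential, potential, ← integral_const_mul]
  refine integral_congr_ae ?_
  filter_upwards [Lp.coeFn_smul c (val u)] with x hx
  rw [val_smul, hx, Pi.smul_apply, norm_smul, Real.mul_rpow (norm_nonneg _) (norm_nonneg _)]

theorem potential_nonneg (σ : ℝ) (u : B1 n m) : 0 ≤ potential σ u :=
  integral_nonneg fun _ => Real.rpow_nonneg (norm_nonneg _) _

/-- Translations in `z` preserve the norm. -/
theorem norm_subst_one (e : Fin m → ℝ) (u : B1 n m) : ‖subst one_pos e u‖ = ‖u‖ := by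
  rw [← sq_eq_sq₀ (norm_nonneg _) (norm_nonneg _), norm_sq_eq, norm_sq_eq, gradYSq_subst,
    gradZSq_subst, norm_sq_val_subst, norm_sq_moment_subst]
  simp

/-! ### The Sobolev embedding and the potential -/

/-- By Tonelli, each point lies in balls whose centres fill a set of measure `|B_R|`. Integrating
over centres replaces a covering argument when local estimates are made global. -/
theorem lintegral_lintegral_ball (R : ℝ) {F : Space n m → ℝ≥0∞} (hF : AEMeasurable F volume) :
    ∫⁻ k, ∫⁻ x in Metric.ball k R, F x = volume (Metric.ball (0 : Space n m) R) * ∫⁻ x, F x := by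
  have h1 : ∀ k, ∫⁻ x in Metric.ball k R, F x
      = ∫⁻ x, (Metric.ball (0 : Space n m) R).indicator 1 (x - k) * F x := fun k => by
    rw [← lintegral_indicator measurableSet_ball]
    refine lintegral_congr fun x => ?_
    by_cases hx : x ∈ Metric.ball k R
    · have : x - k ∈ Metric.ball (0 : Space n m) R := by simpa [dist_eq_norm] using hx
      rw [Set.indicator_of_mem hx, Set.indicator_of_mem this, Pi.one_apply, one_mul]
    · have : x - k ∉ Metric.ball (0 : Space n m) R := by simpa [dist_eq_norm] using hx
      rw [Set.indicator_of_notMem hx, Set.indicator_of_notMem this, zero_mul]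
  have hind : Measurable ((Metric.ball (0 : Space n m) R).indicator (1 : Space n m → ℝ≥0∞)) :=
    measurable_one.indicator measurableSet_ball
  simp only [h1]
  rw [lintegral_lintegral_swap]
  · have h2 : ∀ x, ∫⁻ k, (Metric.ball (0 : Space n m) R).indicator 1 (x - k) * F x
        = volume (Metric.ball (0 : Space n m) R) * F x := fun x => by
      rw [lintegral_mul_const (F x) (f := fun k => (Metric.ball (0 : Space n m) R).indicator 1 (x - k))
          (hind.comp (by fun_prop : Measurable fun k => x - k)),
        lintegral_sub_left_eq_self
          (fun y => (Metric.ball (0 : Space n m) R).indicator (1 : Space n m → ℝ≥0∞) y) x,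
        lintegral_indicator_one measurableSet_ball]
    simp only [h2]
    rw [lintegral_const_mul'' _ hF]
  · exact (hind.comp (measurable_snd.sub measurable_fst)).aemeasurable.mul hF.comp_snd

/-- The `L²` norms of all the components of `u` over the ball of radius `4` about `k`. -/
noncomputable def localNorm (u : B1 n m) (k : Space n m) : ℝ≥0∞ :=
  ∑ s, eLpNorm (u.1 s) 2 (volume.restrict (Metric.ball k 4))

theorem eLpNorm_slot_le (u : B1 n m) (s : Fin 2 ⊕ (Fin n ⊕ Fin m)) :
    eLpNorm (u.1 s) 2 volume ≤ ‖u‖ₑ := by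
  rw [← Lp.enorm_def, enorm_le_iff_norm_le]
  exact PiLp.norm_apply_le u.1 s

theorem localNorm_le (u : B1 n m) (k : Space n m) :
    localNorm u k ≤ (Fintype.card (Fin 2 ⊕ (Fin n ⊕ Fin m)) : ℝ≥0∞) * ‖u‖ₑ := by
  rw [← nsmul_eq_mul]
  exact Finset.sum_le_card_nsmul _ _ _ fun s _ =>
    (eLpNorm_mono_measure _ Measure.restrict_le_self).trans (eLpNorm_slot_le u s)

theorem exists_lintegral_localNorm_sq_le :
    ∃ C : ℝ≥0, ∀ u : B1 n m, ∫⁻ k, localNorm u k ^ 2 ≤ C * ‖u‖ₑ ^ 2 := by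
  set N : ℝ≥0 := ((Fintype.card (Fin 2 ⊕ (Fin n ⊕ Fin m)) : ℕ) : ℝ≥0)
  set V := volume (Metric.ball (0 : Space n m) 4)
  have hV : V ≠ ⊤ := measure_ball_lt_top.ne
  refine ⟨N * (V.toNNReal * N), fun u => ?_⟩
  have h1 : ∀ k, localNorm u k ^ 2 ≤ N * ∑ s, ∫⁻ x in Metric.ball k 4, ‖u.1 s x‖ₑ ^ 2 := fun k => by
    simp only [← eLpNorm_two_sq]
    have := ENNReal.rpow_sum_le_const_mul_sum_rpow (Finset.univ)
      (fun s => eLpNorm (u.1 s) 2 (volume.restrict (Metric.ball k 4))) (p := 2) (by norm_num)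
    norm_num at this
    simpa [N, localNorm] using this
  calc ∫⁻ k, localNorm u k ^ 2
      ≤ ∫⁻ k, N * ∑ s, ∫⁻ x in Metric.ball k 4, ‖u.1 s x‖ₑ ^ 2 := lintegral_mono h1
    _ = N * ∫⁻ k, ∑ s, ∫⁻ x in Metric.ball k 4, ‖u.1 s x‖ₑ ^ 2 :=
        lintegral_const_mul' _ _ ENNReal.coe_ne_top
    _ = N * ∑ s, V * ∫⁻ x, ‖u.1 s x‖ₑ ^ 2 := by
        have hm : ∀ s, AEMeasurable (fun x => ‖u.1 s x‖ₑ ^ 2) volume := fun s =>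
          (Lp.aestronglyMeasurable _).enorm.pow_const 2
        rw [lintegral_finsetSum']
        · simp only [lintegral_lintegral_ball 4 (hm _)]
          rfl
        · intro s _
          have h := (hm s).comp_snd (μ := (volume : Measure (Space n m)))
          have hs : MeasurableSet {p : Space n m × Space n m | dist p.2 p.1 < 4} :=
            measurableSet_lt (by fun_prop) measurable_const
          have h2 := (h.indicator hs).lintegral_prod_right'
          refine h2.congr (Eventually.of_forall fun k => ?_)
          dsimp only
          rw [← lintegral_indicator measurableSet_ball]
          rfl
    _ ≤ N * ∑ _s : Fin 2 ⊕ (Fin n ⊕ Fin m), V * ‖u‖ₑ ^ 2 := by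
        gcongr with s
        rw [← eLpNorm_two_sq]
        gcongr
        exact eLpNorm_slot_le u s
    _ = _ := by
        rw [Finset.sum_const, nsmul_eq_mul, Finset.card_univ]
        push_cast
        rw [ENNReal.coe_toNNReal hV]
        simp [N]
        ring

theorem exists_eLpNorm_ball_le (hd : 2 ≤ n + m) {q : ℝ≥0} (hq0 : 0 < q)
    (hq : (q : ℝ) * ((n + m : ℕ) - 2) < 2 * (n + m : ℕ)) :
    ∃ C : ℝ≥0, ∀ (u : B1 n m) (k : Space n m),
      eLpNorm (val u) q (volume.restrict (Metric.ball k 1)) ≤ C * localNorm u k := by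
  obtain ⟨C, hC⟩ := exists_local_sobolev hd hq0 hq
  refine ⟨C, fun u k => (hC (val u) (grad u) (isWeakDeriv_grad u) k).trans ?_⟩
  gcongr
  rw [localNorm, Fintype.sum_sum_type (α₁ := Fin 2), Fin.sum_univ_two]
  gcongr
  · exact le_self_add
  · exact le_rfl

theorem eLpNorm_rpow_eq {α F : Type*} [MeasurableSpace α] [NormedAddCommGroup F] (f : α → F)
    (μ : Measure α) {p : ℝ≥0} (hp : 0 < p) :
    eLpNorm f p μ ^ (p : ℝ) = ∫⁻ x, ‖f x‖ₑ ^ (p : ℝ) ∂μ :=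
  eLpNorm_nnreal_pow_eq_lintegral hp.ne'

/-- The `L^p` norm is controlled by the local `L^p` norms and the energy norm. -/
theorem exists_lintegral_rpow_le (hd : 2 ≤ n + m) {p : ℝ≥0} (hp2 : 2 < p)
    (hp : (p : ℝ) * ((n + m : ℕ) - 2) < 2 * (n + m : ℕ)) :
    ∃ C : ℝ≥0, ∀ (u : B1 n m) (s : ℝ≥0),
      (∀ k, eLpNorm (val u) p (volume.restrict (Metric.ball k 1)) ≤ s) →
      ∫⁻ x, ‖val u x‖ₑ ^ (p : ℝ) ≤ C * (s : ℝ≥0∞) ^ ((p : ℝ) - 2) * ‖u‖ₑ ^ 2 := by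
  have hp0 : 0 < p := lt_trans (by norm_num) hp2
  have hp2' : (2 : ℝ) < p := by exact_mod_cast hp2
  have hp3 : 0 ≤ (p : ℝ) - 2 := by linarith
  obtain ⟨C, hC⟩ := exists_eLpNorm_ball_le hd hp0 hp
  obtain ⟨D, hD⟩ := exists_lintegral_localNorm_sq_le (n := n) (m := m)
  set V := volume (Metric.ball (0 : Space n m) 1) with hVdef
  have hV : V ≠ ⊤ := measure_ball_lt_top.ne
  have hV0 : V ≠ 0 := (Metric.measure_ball_pos _ _ one_pos).ne'
  refine ⟨V.toNNReal⁻¹ * (C ^ 2 * D), fun u s hs => ?_⟩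
  have h1 : ∀ k, ∫⁻ x in Metric.ball k 1, ‖val u x‖ₑ ^ (p : ℝ)
      ≤ (s : ℝ≥0∞) ^ ((p : ℝ) - 2) * (C ^ 2 * localNorm u k ^ 2) := fun k => by
    rw [← eLpNorm_rpow_eq _ _ hp0, ← mul_pow]
    set e := eLpNorm (val u) p (volume.restrict (Metric.ball k 1)) with he
    -- Of the `p` powers, `p - 2` are bounded uniformly by `s`; the other two give the squared local
    -- norm, whose integral over the centres is at most a multiple of `‖u‖²`.
    calc e ^ (p : ℝ) = e ^ (((p : ℝ) - 2) + 2) := by rw [sub_add_cancel]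
      _ = e ^ ((p : ℝ) - 2) * e ^ (2 : ℝ) :=
          ENNReal.rpow_add_of_nonneg _ _ hp3 (by norm_num)
      _ = e ^ ((p : ℝ) - 2) * e ^ 2 := by rw [ENNReal.rpow_ofNat]
      _ ≤ _ := mul_le_mul' (ENNReal.rpow_le_rpow (hs k) hp3) (pow_le_pow_left' (hC u k) 2)
  have h2 : V * ∫⁻ x, ‖val u x‖ₑ ^ (p : ℝ)
      ≤ C ^ 2 * D * (s : ℝ≥0∞) ^ ((p : ℝ) - 2) * ‖u‖ₑ ^ 2 := by
    rw [← lintegral_lintegral_ball 1 ((Lp.aestronglyMeasurable _).enorm.pow_const _)]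
    refine (lintegral_mono h1).trans ?_
    rw [lintegral_const_mul' _ _ (ENNReal.rpow_ne_top_of_nonneg hp3 ENNReal.coe_ne_top),
      lintegral_const_mul' _ _ (by finiteness)]
    calc _ ≤ (s : ℝ≥0∞) ^ ((p : ℝ) - 2) * (C ^ 2 * (D * ‖u‖ₑ ^ 2)) := by gcongr; exact hD u
      _ = _ := by ring
  have hc : ((V.toNNReal⁻¹ : ℝ≥0) : ℝ≥0∞) = V⁻¹ := by
    rw [ENNReal.coe_inv ((ENNReal.toNNReal_ne_zero).2 ⟨hV0, hV⟩), ENNReal.coe_toNNReal hV]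
  calc ∫⁻ x, ‖val u x‖ₑ ^ (p : ℝ) = V⁻¹ * (V * ∫⁻ x, ‖val u x‖ₑ ^ (p : ℝ)) := by
        rw [← mul_assoc, ENNReal.inv_mul_cancel hV0 hV, one_mul]
    _ ≤ V⁻¹ * (C ^ 2 * D * (s : ℝ≥0∞) ^ ((p : ℝ) - 2) * ‖u‖ₑ ^ 2) := by gcongr
    _ = _ := by
        rw [ENNReal.coe_mul, hc]; push_cast; ring

/-- The embedding of the energy space into `L^p`. -/
theorem exists_eLpNorm_le (hd : 2 ≤ n + m) {p : ℝ≥0} (hp2 : 2 < p)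
    (hp : (p : ℝ) * ((n + m : ℕ) - 2) < 2 * (n + m : ℕ)) :
    ∃ C : ℝ≥0, ∀ u : B1 n m, eLpNorm (val u) p volume ≤ C * ‖u‖ₑ := by
  have hp0 : 0 < p := lt_trans (by norm_num) hp2
  have hp0' : (0 : ℝ) < p := by exact_mod_cast hp0
  have hp2' : (2 : ℝ) < p := by exact_mod_cast hp2
  obtain ⟨C, hC⟩ := exists_eLpNorm_ball_le hd hp0 hp
  obtain ⟨D, hD⟩ := exists_lintegral_rpow_le hd hp2 hp
  set N : ℝ≥0 := ((Fintype.card (Fin 2 ⊕ (Fin n ⊕ Fin m)) : ℕ) : ℝ≥0) with hN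
  refine ⟨(D * (C * N) ^ ((p : ℝ) - 2)) ^ (1 / (p : ℝ)), fun u => ?_⟩
  -- The uniform local bound comes from the local Sobolev inequality and `localNorm u k ≤ N ‖u‖`.
  have h := hD u (C * (N * ‖u‖₊)) fun k => (hC u k).trans (by
    push_cast
    gcongr
    rw [← enorm_eq_nnnorm]
    simpa [hN] using localNorm_le u k)
  rw [← eLpNorm_rpow_eq _ _ hp0] at h
  rw [← ENNReal.rpow_le_rpow_iff hp0', ENNReal.mul_rpow_of_nonneg _ _ hp0'.le]
  refine h.trans_eq ?_
  have hK : ∀ X : ℝ≥0, ((X ^ (1 / (p : ℝ)) : ℝ≥0) : ℝ≥0∞) ^ (p : ℝ) = X := fun X => by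
    rw [← ENNReal.coe_rpow_of_nonneg _ hp0'.le, ← NNReal.rpow_mul, one_div,
      inv_mul_cancel₀ hp0'.ne', NNReal.rpow_one]
  rw [hK, ← mul_assoc C N, ENNReal.coe_mul (C * N), ENNReal.coe_mul D,
    ENNReal.mul_rpow_of_nonneg _ _ (by linarith : (0 : ℝ) ≤ (p : ℝ) - 2), ← enorm_eq_nnnorm,
    ENNReal.coe_rpow_of_nonneg _ (by linarith : (0 : ℝ) ≤ (p : ℝ) - 2)]
  have : ‖u‖ₑ ^ (p : ℝ) = ‖u‖ₑ ^ ((p : ℝ) - 2) * ‖u‖ₑ ^ 2 := by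
    rw [← ENNReal.rpow_ofNat, ← ENNReal.rpow_add_of_nonneg _ _ (by linarith) (by norm_num)]
    norm_num
  rw [this]
  ring

/-! ### The potential for subcritical powers. -/

/-- The hypotheses of the main theorem on the dimensions and on the power `σ`. -/
structure Subcritical (n m : ℕ) (σ : ℝ) : Prop where
  two_le : 2 ≤ n + m
  pos : 0 < σ
  lt : σ * ((n : ℝ) + m - 2) < 2

section

variable {σ : ℝ}

theorem Subcritical.mul_lt (h : Subcritical n m σ) :
    (2 * σ + 2) * ((n + m : ℕ) - 2) < 2 * ((n + m : ℕ) : ℝ) := by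
  have := h.lt
  push_cast
  nlinarith

/-- The exponent `2σ + 2` as a nonnegative real number. -/
noncomputable def expo (σ : ℝ) : ℝ≥0 := (2 * σ + 2).toNNReal

theorem Subcritical.coe_expo (h : Subcritical n m σ) : (expo σ : ℝ) = 2 * σ + 2 :=
  Real.coe_toNNReal _ (by linarith [h.pos])

theorem Subcritical.two_lt_expo (h : Subcritical n m σ) : 2 < expo σ := by
  rw [← NNReal.coe_lt_coe, h.coe_expo]
  simpa using h.pos

theorem Subcritical.expo_pos (h : Subcritical n m σ) : 0 < expo σ :=
  lt_trans (by norm_num) h.two_lt_expo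

theorem Subcritical.expo_mul_lt (h : Subcritical n m σ) :
    (expo σ : ℝ) * ((n + m : ℕ) - 2) < 2 * (n + m : ℕ) := by
  rw [h.coe_expo]; exact h.mul_lt

theorem Subcritical.memLp (h : Subcritical n m σ) (u : B1 n m) :
    MemLp (val u) (expo σ) volume := by
  obtain ⟨C, hC⟩ := exists_eLpNorm_le h.two_le h.two_lt_expo h.expo_mul_lt
  exact ⟨Lp.aestronglyMeasurable _, (hC u).trans_lt (by finiteness)⟩

theorem Subcritical.potential_eq (h : Subcritical n m σ) (u : B1 n m) :
    potential σ u = (eLpNorm (val u) (expo σ) volume).toReal ^ (2 * σ + 2) := by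
  rw [ENNReal.toReal_rpow, ← h.coe_expo, eLpNorm_rpow_eq _ _ h.expo_pos, potential,
    integral_eq_lintegral_of_nonneg_ae (Eventually.of_forall fun x =>
      Real.rpow_nonneg (norm_nonneg _) _)
      ((Lp.aestronglyMeasurable (val u)).norm.aemeasurable.pow_const _).aestronglyMeasurable]
  congr 1
  refine lintegral_congr fun x => ?_
  rw [h.coe_expo, ← ofReal_norm, ENNReal.ofReal_rpow_of_nonneg (norm_nonneg _)
    (by linarith [h.pos])]

theorem Subcritical.integrable_rpow (h : Subcritical n m σ) (u : B1 n m) :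
    Integrable fun x => ‖val u x‖ ^ (2 * σ + 2) := by
  have := (h.memLp u).integrable_norm_rpow (by exact_mod_cast h.expo_pos.ne') (by finiteness)
  simpa only [ENNReal.coe_toReal, h.coe_expo] using this

theorem Subcritical.exists_potential_le (h : Subcritical n m σ) :
    ∃ C : ℝ, 0 ≤ C ∧ ∀ u : B1 n m, potential σ u ≤ C * ‖u‖ ^ (2 * σ + 2) := by
  obtain ⟨C, hC⟩ := exists_eLpNorm_le h.two_le h.two_lt_expo h.expo_mul_lt
  refine ⟨(C : ℝ) ^ (2 * σ + 2), by positivity, fun u => ?_⟩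
  rw [h.potential_eq, ← Real.mul_rpow C.coe_nonneg (norm_nonneg _)]
  refine Real.rpow_le_rpow ENNReal.toReal_nonneg ?_ (by linarith [h.pos])
  have := ENNReal.toReal_mono (by finiteness) (hC u)
  simpa using this

/-- By Minkowski and the embedding, the `L^(2σ+2)` norm is Lipschitz in the energy norm; the
potential is a power of it. -/
theorem Subcritical.continuous_potential (h : Subcritical n m σ) :
    Continuous (potential σ : B1 n m → ℝ) := by
  obtain ⟨C, hC⟩ := exists_eLpNorm_le h.two_le h.two_lt_expo h.expo_mul_lt
  set N : B1 n m → ℝ := fun u => (eLpNorm (val u) (expo σ) volume).toReal with hN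
  have h1 : ∀ u v : B1 n m, N u ≤ N v + C * ‖u - v‖ := fun u v => by
    have hle : eLpNorm (val u) (expo σ) volume
        ≤ eLpNorm (val v) (expo σ) volume + C * ‖u - v‖ₑ := by
      refine le_trans ?_ (add_le_add_right (hC (u - v)) _)
      have he : eLpNorm (val u) (expo σ) volume
          = eLpNorm (val v + val (u - v) : Space n m → ℂ) (expo σ) volume := by
        refine eLpNorm_congr_ae ?_
        filter_upwards [Lp.coeFn_sub (val u) (val v)] with x hx
        rw [Pi.add_apply, val_sub, hx, Pi.sub_apply, add_sub_cancel]
      rw [he]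
      refine eLpNorm_add_le (Lp.aestronglyMeasurable _) (Lp.aestronglyMeasurable _) ?_
      exact_mod_cast (show (1 : ℝ≥0) ≤ 2 by norm_num).trans h.two_lt_expo.le
    have hv := (h.memLp v).2.ne
    have := ENNReal.toReal_mono (by finiteness) hle
    rw [ENNReal.toReal_add hv (by finiteness)] at this
    simpa using this
  have hNc : Continuous N := by
    refine (LipschitzWith.of_dist_le_mul (K := C) fun u v => ?_).continuous
    rw [Real.dist_eq, dist_eq_norm, abs_sub_le_iff]
    constructor
    · linarith [h1 u v]
    · rw [norm_sub_rev]; linarith [h1 v u]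
  have : (potential σ : B1 n m → ℝ) = fun u => N u ^ (2 * σ + 2) := funext h.potential_eq
  rw [this]
  exact hNc.rpow_const fun _ => Or.inr (by linarith [h.pos])

theorem Subcritical.ofReal_potential (h : Subcritical n m σ) (u : B1 n m) :
    ENNReal.ofReal (potential σ u) = ∫⁻ x, ‖val u x‖ₑ ^ (expo σ : ℝ) := by
  rw [h.potential_eq, ← eLpNorm_rpow_eq _ _ h.expo_pos, h.coe_expo,
    ← ENNReal.ofReal_rpow_of_nonneg ENNReal.toReal_nonneg (by linarith [h.pos]),
    ENNReal.ofReal_toReal (h.memLp u).2.ne]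

end

/-! ### Mass bounds and weak limits -/

/-- Split at the threshold `T` with `T ^ (q - p) = 1 / ε`: below it the quadratic term dominates
with `K = T ^ (p - 2)`, above it the `q`-th power does. -/
theorem exists_rpow_le_interpolation {p q ε : ℝ} (hp : 2 < p) (hpq : p < q) (hε : 0 < ε) :
    ∃ K > 0, ∀ a : ℝ, 0 ≤ a → a ^ p ≤ ε * a ^ q + K * a ^ 2 := by
  have hqp : 0 < q - p := sub_pos.2 hpq
  set T : ℝ := (1 / ε) ^ (1 / (q - p)) with hT
  have hT0 : 0 < T := by positivity
  have hTq : T ^ (q - p) = 1 / ε := by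
    rw [hT, ← Real.rpow_mul (by positivity), one_div_mul_cancel hqp.ne', Real.rpow_one]
  refine ⟨T ^ (p - 2), by positivity, fun a ha => ?_⟩
  rcases le_or_gt a T with h | h
  · have h1 : a ^ p = a ^ (p - 2) * a ^ 2 := by
      rw [← Real.rpow_two, ← Real.rpow_add_of_nonneg ha (by linarith) (by norm_num),
        sub_add_cancel]
    have h2 : a ^ (p - 2) ≤ T ^ (p - 2) := Real.rpow_le_rpow ha h (by linarith)
    have h3 : 0 ≤ ε * a ^ q := by positivity
    rw [h1]
    nlinarith [mul_le_mul_of_nonneg_right h2 (sq_nonneg a)]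
  · have h1 : a ^ q = a ^ p * a ^ (q - p) := by
      rw [← Real.rpow_add_of_nonneg ha (by linarith) (by linarith), add_sub_cancel]
    have h2 : 1 / ε ≤ a ^ (q - p) := hTq ▸ Real.rpow_le_rpow hT0.le h.le hqp.le
    have h3 : 1 ≤ ε * a ^ (q - p) := by rwa [div_le_iff₀' hε] at h2
    have h4 : 0 ≤ a ^ p := by positivity
    rw [h1]
    nlinarith [mul_le_mul_of_nonneg_left h3 h4, mul_nonneg (Real.rpow_nonneg hT0.le (p - 2)) (sq_nonneg a)]

theorem exists_larger_exponent {p d : ℝ} (h : p * (d - 2) < 2 * d) (hd : 2 ≤ d) :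
    ∃ q, p < q ∧ q * (d - 2) < 2 * d := by
  rcases hd.eq_or_lt with h2 | h2
  · exact ⟨p + 1, by linarith, by rw [← h2]; norm_num⟩
  · have hd' : 0 < d - 2 := by linarith
    obtain ⟨q, h1, h2⟩ := exists_between ((lt_div_iff₀ hd').2 h)
    exact ⟨q, h1, (lt_div_iff₀ hd').1 h2⟩

section

variable {σ : ℝ}

/-- A lower bound on the potential gives a lower bound on the mass of some unit ball. -/
theorem Subcritical.exists_ball_mass (h : Subcritical n m σ) {η : ℝ} (hη : 0 < η) :
    ∃ c : ℝ, 0 < c ∧ ∀ u : B1 n m, ‖u‖ ≤ 1 → η ≤ potential σ u →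
      ∃ k, ENNReal.ofReal c ≤ ∫⁻ x in Metric.ball k 1, ‖val u x‖ₑ ^ 2 := by
  set p := expo σ with hp
  have hp2 : (2 : ℝ) < p := by exact_mod_cast h.two_lt_expo
  obtain ⟨q', hq1, hq2⟩ := exists_larger_exponent h.expo_mul_lt (by exact_mod_cast h.two_le)
  set q : ℝ≥0 := q'.toNNReal
  have hqc : (q : ℝ) = q' := Real.coe_toNNReal _ (by linarith)
  rw [← hqc] at hq1 hq2
  have hq0 : 0 < q := by
    rw [← NNReal.coe_lt_coe, NNReal.coe_zero]; linarith
  obtain ⟨C, hC⟩ := exists_lintegral_rpow_le h.two_le h.two_lt_expo h.expo_mul_lt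
  obtain ⟨D, hD⟩ := exists_eLpNorm_ball_le h.two_le hq0 hq2
  set N : ℝ≥0 := ((Fintype.card (Fin 2 ⊕ (Fin n ⊕ Fin m)) : ℕ) : ℝ≥0) with hN
  -- If every local `L^p` norm were at most `s`, the potential would be at most `C η / (2 (C + 1)) <
  -- η`.
  set s : ℝ := (η / (2 * (C + 1))) ^ (1 / ((p : ℝ) - 2)) with hs
  have hs0 : 0 < s := by positivity
  have hsp : s ^ ((p : ℝ) - 2) = η / (2 * (C + 1)) := by
    rw [hs, ← Real.rpow_mul (by positivity), one_div_mul_cancel (by linarith), Real.rpow_one]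
  set B : ℝ := ((D * N : ℝ≥0) : ℝ) ^ (q : ℝ) with hB
  have hB0 : 0 ≤ B := by positivity
  -- `B` bounds the local `L^q` integral, so this `ε` lets the `q`-th power account for at most half
  -- of `s ^ p`. The mass must supply the other half, whence the constant `s ^ p / (2 K)`.
  obtain ⟨K, hK, hK'⟩ := exists_rpow_le_interpolation (ε := s ^ (p : ℝ) / (2 * (B + 1))) hp2 hq1
    (by positivity)
  refine ⟨s ^ (p : ℝ) / (2 * K), by positivity, fun u hu hηu => ?_⟩
  have hu' : ‖u‖ₑ ≤ 1 := by
    rw [← ofReal_norm]; exact ENNReal.ofReal_le_one.2 hu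
  have hk : ∃ k, ENNReal.ofReal s < eLpNorm (val u) p (volume.restrict (Metric.ball k 1)) := by
    by_contra! hcon
    have h1 := hC u s.toNNReal hcon
    rw [← h.ofReal_potential] at h1
    have h2 : ENNReal.ofReal (potential σ u)
        ≤ ENNReal.ofReal (C * (η / (2 * (C + 1)))) := by
      refine h1.trans ?_
      calc _ ≤ (C : ℝ≥0∞) * ((s.toNNReal : ℝ≥0) : ℝ≥0∞) ^ ((p : ℝ) - 2) * 1 ^ 2 := by gcongr
        _ = _ := by
            rw [one_pow, mul_one, ← hsp, ENNReal.ofReal_mul C.coe_nonneg,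
              ENNReal.ofReal_coe_nnreal,
              ← ENNReal.ofReal_rpow_of_nonneg hs0.le (by linarith)]
            rfl
    rw [ENNReal.ofReal_le_ofReal_iff (by positivity)] at h2
    have h3 : C * (η / (2 * (C + 1))) < η := by
      rw [← mul_div_assoc, div_lt_iff₀ (by positivity)]
      nlinarith [C.coe_nonneg, mul_nonneg C.coe_nonneg hη.le]
    linarith
  obtain ⟨k, hk⟩ := hk
  refine ⟨k, ?_⟩
  have hmass : ∫⁻ x in Metric.ball k 1, ‖val u x‖ₑ ^ 2 ≠ ⊤ := by
    rw [← eLpNorm_two_sq]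
    exact ENNReal.pow_ne_top ((Lp.memLp (val u)).restrict _).2.ne
  set X := (∫⁻ x in Metric.ball k 1, ‖val u x‖ₑ ^ 2).toReal with hX
  have hqint : ∫⁻ x in Metric.ball k 1, ‖val u x‖ₑ ^ (q : ℝ) ≤ ENNReal.ofReal B := by
    rw [← eLpNorm_rpow_eq _ _ hq0, hB, ← ENNReal.ofReal_rpow_of_nonneg (by positivity)
      (by positivity), ENNReal.ofReal_coe_nnreal]
    gcongr
    refine (hD u k).trans ?_
    push_cast
    gcongr
    refine (localNorm_le u k).trans ?_
    calc _ ≤ ((Fintype.card (Fin 2 ⊕ (Fin n ⊕ Fin m)) : ℕ) : ℝ≥0∞) * 1 := by gcongr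
      _ = _ := by simp [hN]
  have h5 : ENNReal.ofReal (s ^ (p : ℝ))
      ≤ ENNReal.ofReal (s ^ (p : ℝ) / (2 * (B + 1)) * B + K * X) := by
    rw [ENNReal.ofReal_add (by positivity) (by positivity), ENNReal.ofReal_mul (by positivity),
      ENNReal.ofReal_mul hK.le, ENNReal.ofReal_toReal hmass]
    calc ENNReal.ofReal (s ^ (p : ℝ))
        = ENNReal.ofReal s ^ (p : ℝ) := (ENNReal.ofReal_rpow_of_nonneg hs0.le p.coe_nonneg).symm
      _ ≤ eLpNorm (val u) p (volume.restrict (Metric.ball k 1)) ^ (p : ℝ) := by gcongr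
      _ = ∫⁻ x in Metric.ball k 1, ‖val u x‖ₑ ^ (p : ℝ) := eLpNorm_rpow_eq _ _ h.expo_pos
      _ ≤ ∫⁻ x in Metric.ball k 1, (ENNReal.ofReal (s ^ (p : ℝ) / (2 * (B + 1)))
            * ‖val u x‖ₑ ^ (q : ℝ) + ENNReal.ofReal K * ‖val u x‖ₑ ^ 2) := by
          refine lintegral_mono fun x => ?_
          have := ENNReal.ofReal_le_ofReal (hK' ‖val u x‖ (norm_nonneg _))
          rw [ENNReal.ofReal_add (by positivity) (by positivity),
            ENNReal.ofReal_mul (by positivity), ENNReal.ofReal_mul hK.le,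
            ← ENNReal.ofReal_rpow_of_nonneg (norm_nonneg _) (by positivity),
            ← ENNReal.ofReal_rpow_of_nonneg (norm_nonneg _) (by positivity),
            ENNReal.ofReal_pow (norm_nonneg _), ofReal_norm] at this
          exact this
      _ = ENNReal.ofReal (s ^ (p : ℝ) / (2 * (B + 1)))
            * (∫⁻ x in Metric.ball k 1, ‖val u x‖ₑ ^ (q : ℝ))
          + ENNReal.ofReal K * ∫⁻ x in Metric.ball k 1, ‖val u x‖ₑ ^ 2 := by
          have hm := (Lp.aestronglyMeasurable (val u)).restrict (s := Metric.ball k 1) |>.enorm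
          rw [lintegral_add_right' _ ((hm.pow_const 2).const_mul _),
            lintegral_const_mul' _ _ ENNReal.ofReal_ne_top,
            lintegral_const_mul' _ _ ENNReal.ofReal_ne_top]
      _ ≤ _ := by gcongr
  rw [ENNReal.ofReal_le_ofReal_iff (by positivity)] at h5
  rw [ENNReal.ofReal_le_iff_le_toReal hmass, ← hX, div_le_iff₀ (by positivity)]
  have h6 : s ^ (p : ℝ) / (2 * (B + 1)) * B ≤ s ^ (p : ℝ) / 2 := by
    rw [div_mul_eq_mul_div, div_le_div_iff₀ (by positivity) (by norm_num)]
    nlinarith [Real.rpow_nonneg hs0.le (p : ℝ)]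
  linarith

end

/-! ### Confinement in `y` and weak compactness. -/

/-- The component `(y, 0)` has norm `|y|`. -/
theorem yNorm_eq_norm (x : Space n m) :
    yNorm x = ‖(WithLp.toLp 2 fun j => x (Sum.inl j) : EuclideanSpace ℝ (Fin n))‖ := by
  simp [yNorm, EuclideanSpace.norm_eq]

theorem yNorm_le_norm (x : Space n m) : yNorm x ≤ ‖x‖ := by
  rw [yNorm, EuclideanSpace.norm_eq]
  refine Real.sqrt_le_sqrt ?_
  rw [Fintype.sum_sum_type]
  simp only [Real.norm_eq_abs, sq_abs]
  exact le_add_of_nonneg_right (Finset.sum_nonneg fun _ _ => sq_nonneg _)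

theorem yNorm_le_add (k x : Space n m) : yNorm k ≤ yNorm x + ‖x - k‖ := by
  refine le_trans ?_ (add_le_add_right (yNorm_le_norm (x - k)) _)
  simp only [yNorm_eq_norm]
  have : (WithLp.toLp 2 fun j => k (Sum.inl j) : EuclideanSpace ℝ (Fin n))
      = WithLp.toLp 2 (fun j => x (Sum.inl j)) - WithLp.toLp 2 fun j => (x - k) (Sum.inl j) := by
    ext j; simp
  rw [this]
  exact norm_sub_le _ _

/-- Confinement: a ball carrying mass lies near the subspace `y = 0`. -/
theorem yNorm_center_le {u : B1 n m} (hu : ‖u‖ ≤ 1) {c : ℝ} (hc : 0 < c) {k : Space n m}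
    (h : ENNReal.ofReal c ≤ ∫⁻ x in Metric.ball k 1, ‖val u x‖ₑ ^ 2) :
    yNorm k ≤ 1 + √(1 / c) := by
  by_contra! hcon
  set r := yNorm k - 1 with hr
  have hr1 : √(1 / c) < r := by linarith
  have hr0 : 0 < r := (Real.sqrt_nonneg _).trans_lt hr1
  -- Chebyshev: `|y| ≥ r` throughout the unit ball about `k`, while the second moment is at most
  -- `1`.
  have h1 : ENNReal.ofReal (r ^ 2) * ∫⁻ x in Metric.ball k 1, ‖val u x‖ₑ ^ 2 ≤ 1 := by
    calc _ = ∫⁻ x in Metric.ball k 1, ENNReal.ofReal (r ^ 2) * ‖val u x‖ₑ ^ 2 :=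
          (lintegral_const_mul' _ _ ENNReal.ofReal_ne_top).symm
      _ ≤ ∫⁻ x in Metric.ball k 1, ‖moment u x‖ₑ ^ 2 := by
          refine lintegral_mono_ae ?_
          filter_upwards [ae_restrict_of_ae (isMoment_moment u),
            ae_restrict_mem measurableSet_ball] with x hx hxk
          rw [hx, enorm_smul, mul_pow, ENNReal.ofReal_pow hr0.le, Real.enorm_of_nonneg
            (show 0 ≤ yNorm x from Real.sqrt_nonneg _)]
          gcongr
          have := yNorm_le_add k x
          rw [Metric.mem_ball, dist_eq_norm] at hxk
          change r ≤ yNorm x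
          linarith
      _ ≤ ∫⁻ x, ‖moment u x‖ₑ ^ 2 := lintegral_mono' Measure.restrict_le_self le_rfl
      _ = ‖moment u‖ₑ ^ 2 := by rw [← eLpNorm_two_sq, Lp.enorm_def]
      _ ≤ 1 ^ 2 := by
          gcongr
          rw [← ofReal_norm]
          exact ENNReal.ofReal_le_one.2 ((norm_moment_le u).trans hu)
      _ = 1 := one_pow 2
  have h2 : ENNReal.ofReal (r ^ 2 * c) ≤ 1 := by
    rw [ENNReal.ofReal_mul (by positivity)]
    exact (mul_le_mul_right h _).trans h1
  rw [ENNReal.ofReal_le_one] at h2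
  have h3 : 1 / c < r ^ 2 := (Real.sqrt_lt' hr0).1 hr1
  rw [div_lt_iff₀ hc] at h3
  linarith

/-- Confinement bounds the `y`-part of the centre, and the `z`-part is removed by translation. One
fixed ball thus catches mass of every translated function, so mass cannot escape along a maximising
sequence. -/
theorem Subcritical.exists_subst_mass {σ : ℝ} (h : Subcritical n m σ) {η : ℝ} (hη : 0 < η) :
    ∃ c R : ℝ, 0 < c ∧ ∀ u : B1 n m, ‖u‖ ≤ 1 → η ≤ potential σ u →
      ∃ e, ENNReal.ofReal c
        ≤ ∫⁻ x in Metric.ball 0 R, ‖val (subst one_pos e u) x‖ₑ ^ 2 := by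
  obtain ⟨c, hc, H⟩ := h.exists_ball_mass (n := n) (m := m) hη
  -- The radius is `1` for the ball plus `1 + √(1 / c)` for the distance of its translated centre
  -- from the origin.
  refine ⟨c, 2 + √(1 / c), hc, fun u hu hηu => ?_⟩
  obtain ⟨k, hk⟩ := H u hu hηu
  have hky := yNorm_center_le hu hc hk
  set e : Fin m → ℝ := fun j => k (Sum.inr j) with he
  refine ⟨e, hk.trans ?_⟩
  have h1 : ∫⁻ x in Metric.ball k 1, ‖val u x‖ₑ ^ 2
      = ∫⁻ x, (Metric.ball k 1).indicator (fun x => ‖val u x‖ₑ ^ 2) (zAffine 1 e x) := by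
    rw [lintegral_comp_zAffine one_pos, lintegral_indicator measurableSet_ball]; simp
  rw [h1, ← lintegral_indicator measurableSet_ball]
  refine lintegral_mono_ae ?_
  filter_upwards [coeFn_substL2 one_pos e (val u)] with x hx
  by_cases hxk : zAffine 1 e x ∈ Metric.ball k 1
  · have hx0 : x ∈ Metric.ball (0 : Space n m) (2 + √(1 / c)) := by
      rw [Metric.mem_ball, dist_eq_norm] at hxk
      rw [mem_ball_zero_iff]
      set k' : Space n m := WithLp.toLp 2 (Sum.elim (fun j => k (Sum.inl j)) fun _ => 0) with hk'
      have hk'n : ‖k'‖ = yNorm k := by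
        rw [EuclideanSpace.norm_eq, Fintype.sum_sum_type, yNorm]; simp [hk']
      have hxe : x = (zAffine 1 e x - k) + k' := by
        ext (j | j) <;> simp [hk', he]
      calc ‖x‖ = ‖(zAffine 1 e x - k) + k'‖ := by rw [← hxe]
        _ ≤ ‖zAffine 1 e x - k‖ + ‖k'‖ := norm_add_le _ _
        _ < _ := by rw [hk'n]; linarith
    rw [Set.indicator_of_mem hxk, Set.indicator_of_mem hx0, val_subst, hx]
  · rw [Set.indicator_of_notMem hxk]; exact zero_le

/-- Weak sequential compactness of bounded sets in a separable Hilbert space. -/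
theorem exists_weak_limit {H : Type*} [NormedAddCommGroup H] [InnerProductSpace ℂ H]
    [CompleteSpace H] [SecondCountableTopology H] (u : ℕ → H) {C : ℝ} (hu : ∀ j, ‖u j‖ ≤ C) :
    ∃ (v : H) (φ : ℕ → ℕ), StrictMono φ ∧
      ∀ ℓ : H →L[ℂ] ℂ, Tendsto (fun j => ℓ (u (φ j))) atTop (𝓝 (ℓ v)) := by
  have hseq := WeakDual.isSeqCompact_closedBall ℂ H (0 : StrongDual ℂ H) C
  set x : ℕ → WeakDual ℂ H := fun j => StrongDual.toWeakDual (InnerProductSpace.toDual ℂ H (u j))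
  obtain ⟨f, -, φ, hφ, hlim⟩ := hseq (x := x) fun j => by
    change InnerProductSpace.toDual ℂ H (u j) ∈ Metric.closedBall (0 : StrongDual ℂ H) C
    rw [mem_closedBall_zero_iff, LinearIsometryEquiv.norm_map]
    exact hu j
  refine ⟨(InnerProductSpace.toDual ℂ H).symm (WeakDual.toStrongDual f), φ, hφ, fun ℓ => ?_⟩
  have h1 : ∀ w, Tendsto (fun j => inner ℂ (u (φ j)) w) atTop
      (𝓝 (inner ℂ ((InnerProductSpace.toDual ℂ H).symm (WeakDual.toStrongDual f)) w)) :=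
    fun w => by
      rw [InnerProductSpace.toDual_symm_apply]
      exact ((WeakDual.eval_continuous w).tendsto f).comp hlim
  have h2 : ∀ y, ℓ y = inner ℂ ((InnerProductSpace.toDual ℂ H).symm ℓ) y := fun y =>
    (InnerProductSpace.toDual_symm_apply).symm
  simp only [h2]
  -- The Riesz map puts `u j` in the conjugate-linear slot; conjugation exchanges the slots.
  have h3 := (Complex.continuous_conj.tendsto _).comp
    (h1 ((InnerProductSpace.toDual ℂ H).symm ℓ))
  simpa only [Function.comp_def, inner_conj_symm] using h3

/-! ### Local compactness -/

/-- Point evaluation of the mollification as a continuous functional on the energy space. -/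
theorem exists_mollify_functional (ρ : ContDiffBump (0 : Space n m)) (x : Space n m) :
    ∃ ℓ : B1 n m →L[ℂ] ℂ, ∀ u, ℓ u = mollify ρ (val u) x := by
  obtain ⟨f, hf⟩ := exists_inner_eq_integral_smul (φ := fun t => ρ.normed volume (x - t))
    (ρ.continuous_normed.comp (continuous_const.sub continuous_id))
    (ρ.hasCompactSupport_normed.comp_homeomorph (Homeomorph.subLeft x))
  refine ⟨(innerSL ℂ f).comp valL, fun u => ?_⟩
  rw [mollify_apply_swap, hf]
  rfl

theorem exists_enorm_mollify_sq_le (ρ : ContDiffBump (0 : Space n m)) :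
    ∃ C : ℝ≥0, ∀ (u : L2 n m) (x : Space n m), ‖mollify ρ u x‖ₑ ^ 2 ≤ C * ‖u‖ₑ ^ 2 := by
  obtain ⟨C, hC⟩ := (ρ.hasCompactSupport_normed (μ := volume)).exists_bound_of_continuous
    ρ.continuous_normed
  refine ⟨C.toNNReal, fun u x => (enorm_mollify_sq_le ρ (Lp.aestronglyMeasurable u) x).trans ?_⟩
  calc _ ≤ ∫⁻ t, (C.toNNReal : ℝ≥0∞) * ‖u (x - t)‖ₑ ^ 2 := by
        refine lintegral_mono fun t => ?_
        gcongr
        exact ENNReal.ofReal_le_ofReal ((Real.le_norm_self _).trans (hC t))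
    _ = _ := by
        rw [lintegral_const_mul' _ _ ENNReal.coe_ne_top,
          lintegral_sub_left_eq_self (fun t => ‖u t‖ₑ ^ 2) x, ← eLpNorm_two_sq, Lp.enorm_def]

theorem sum_eLpNorm_grad_le (u : B1 n m) :
    ∑ i, eLpNorm (grad u i) 2 volume ≤ ((n + m : ℕ) : ℝ≥0∞) * ‖u‖ₑ := by
  have : ((n + m : ℕ) : ℝ≥0∞) * ‖u‖ₑ = ∑ _i : Fin n ⊕ Fin m, ‖u‖ₑ := by simp
  rw [this]
  exact Finset.sum_le_sum fun i _ => eLpNorm_slot_le u (Sum.inr i)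

/-- Local compactness: weak convergence in the energy space implies convergence in `L²(ν)` for
every finite measure `ν` bounded by the Lebesgue measure. -/
theorem tendsto_eLpNorm_of_weak {w : ℕ → B1 n m} {C : ℝ} (hb : ∀ j, ‖w j‖ ≤ C)
    (hw : ∀ ℓ : B1 n m →L[ℂ] ℂ, Tendsto (fun j => ℓ (w j)) atTop (𝓝 0))
    {ν : Measure (Space n m)} [IsFiniteMeasure ν] (hν : ν ≤ volume) :
    Tendsto (fun j => eLpNorm (val (w j)) 2 ν) atTop (𝓝 0) := by
  have hac : ν ≪ volume := Measure.absolutelyContinuous_of_le hν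
  have hbe : ∀ j, ‖w j‖ₑ ≤ ENNReal.ofReal C := fun j => by
    rw [← ofReal_norm]; exact ENNReal.ofReal_le_ofReal (hb j)
  have hmc : ∀ i j, Continuous (mollify (bumpSeq i) (val (w j))) := fun i j =>
    (contDiff_mollify _ (locallyIntegrable_L2 _)).continuous
  -- At a fixed scale, weak convergence gives pointwise convergence of the mollifications, and they
  -- are uniformly bounded, so a constant dominates because `ν` is finite.
  have h1 : ∀ i, Tendsto (fun j => eLpNorm (mollify (bumpSeq i) (val (w j))) 2 ν) atTop (𝓝 0) := by
    intro i
    obtain ⟨D, hD⟩ := exists_enorm_mollify_sq_le (n := n) (m := m) (bumpSeq i)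
    have h2 : Tendsto (fun j => ∫⁻ x, ‖mollify (bumpSeq i) (val (w j)) x‖ₑ ^ 2 ∂ν) atTop
        (𝓝 (∫⁻ _, 0 ∂ν)) := by
      refine tendsto_lintegral_of_dominated_convergence (fun _ => D * ENNReal.ofReal C ^ 2)
        (fun j => ((hmc i j).enorm.measurable.pow_const 2)) (fun j => ?_) ?_ ?_
      · refine Eventually.of_forall fun x =>
          (hD _ x).trans (mul_le_mul' le_rfl (pow_le_pow_left' ?_ 2))
        refine le_trans ?_ (hbe j)
        exact enorm_le_iff_norm_le.2 (norm_val_le _)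
      · rw [lintegral_const]
        exact ENNReal.mul_ne_top (by finiteness) (measure_ne_top _ _)
      · refine Eventually.of_forall fun x => ?_
        obtain ⟨ℓ, hℓ⟩ := exists_mollify_functional (bumpSeq i) x
        have h3 := hw ℓ
        simp only [hℓ] at h3
        have h4 := ((ENNReal.continuous_pow 2).tendsto _).comp h3.enorm
        simpa [Function.comp_def] using h4
    rw [lintegral_zero] at h2
    have h5 := ((ENNReal.continuous_rpow_const (y := 1 / 2)).tendsto 0).comp h2
    rw [ENNReal.zero_rpow_of_pos (by norm_num)] at h5
    refine h5.congr fun j => ?_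
    rw [Function.comp_apply, ← eLpNorm_two_sq, ← ENNReal.rpow_natCast, ← ENNReal.rpow_mul]
    norm_num
  -- The mollification error is uniform in `j`, being bounded through the gradients; the scale can
  -- be fixed before `j` tends to infinity.
  have h2 : ∀ i j, eLpNorm (val (w j)) 2 ν ≤ eLpNorm (mollify (bumpSeq i) (val (w j))) 2 ν
      + ENNReal.ofReal (bumpSeq i : ContDiffBump (0 : Space n m)).rOut
        * (((n + m : ℕ) : ℝ≥0∞) * ENNReal.ofReal C) := fun i j => by
    set f : Space n m → ℂ := mollify (bumpSeq i) (val (w j))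
    have hdiff : eLpNorm (fun x => f x - val (w j) x) 2 ν
        ≤ ENNReal.ofReal (bumpSeq i : ContDiffBump (0 : Space n m)).rOut
        * (((n + m : ℕ) : ℝ≥0∞) * ENNReal.ofReal C) := by
      refine (eLpNorm_mono_measure _ hν).trans
        ((eLpNorm_mollify_sub_le _ (isWeakDeriv_grad (w j))).trans ?_)
      gcongr
      refine (sum_eLpNorm_grad_le (w j)).trans ?_
      gcongr
      exact hbe j
    have hsplit : (val (w j) : Space n m → ℂ) = f - fun x => f x - val (w j) x := by
      funext x; simp
    calc eLpNorm (val (w j)) 2 ν = eLpNorm (f - fun x => f x - val (w j) x) 2 ν := by rw [← hsplit]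
      _ ≤ _ := eLpNorm_sub_le (hmc i j).aestronglyMeasurable
          ((hmc i j).aestronglyMeasurable.sub ((Lp.aestronglyMeasurable _).mono_ac hac))
          (by norm_num)
      _ ≤ _ := by gcongr
  have h3 : Tendsto (fun i => ENNReal.ofReal (bumpSeq i : ContDiffBump (0 : Space n m)).rOut
        * (((n + m : ℕ) : ℝ≥0∞) * ENNReal.ofReal C)) atTop (𝓝 0) := by
    have h4 := ENNReal.tendsto_ofReal (tendsto_bumpSeq_rOut (n := n) (m := m))
    have h5 := ENNReal.Tendsto.mul_const (b := ((n + m : ℕ) : ℝ≥0∞) * ENNReal.ofReal C) h4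
      (Or.inr (by finiteness))
    simpa using h5
  rw [ENNReal.tendsto_nhds_zero]
  intro ε hε
  have hε2 : 0 < ε / 2 := ENNReal.half_pos hε.ne'
  obtain ⟨i, hi⟩ := ((ENNReal.tendsto_nhds_zero.1 h3) (ε / 2) hε2).exists
  filter_upwards [(ENNReal.tendsto_nhds_zero.1 (h1 i)) (ε / 2) hε2] with j hj
  calc _ ≤ _ := h2 i j
    _ ≤ ε / 2 + ε / 2 := add_le_add hj hi
    _ = ε := ENNReal.add_halves ε

/-- A finite measure below Lebesgue measure with the same null sets. -/
theorem exists_finite_measure_le :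
    ∃ ν : Measure (Space n m), IsFiniteMeasure ν ∧ ν ≤ volume ∧ volume ≪ ν := by
  obtain ⟨g, hg0, hgm, hg⟩ := exists_pos_lintegral_lt_of_sigmaFinite
    (volume : Measure (Space n m)) one_ne_zero
  set f : Space n m → ℝ≥0∞ := fun x => min (g x : ℝ≥0∞) 1
  have hfm : Measurable f := hgm.coe_nnreal_ennreal.min measurable_const
  refine ⟨volume.withDensity f, ?_, ?_, ?_⟩
  · refine isFiniteMeasure_withDensity ?_
    exact ((lintegral_mono fun x => min_le_left _ _).trans_lt (hg.trans (by simp))).ne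
  · conv_rhs => rw [← withDensity_one (μ := (volume : Measure (Space n m)))]
    exact withDensity_mono (Eventually.of_forall fun x => min_le_right _ _)
  · refine withDensity_absolutelyContinuous' hfm.aemeasurable (Eventually.of_forall fun x => ?_)
    have : (0 : ℝ≥0∞) < g x := by exact_mod_cast hg0 x
    exact (lt_min this one_pos).ne'

/-- Weak convergence in the energy space implies a.e. convergence of a subsequence. -/
theorem exists_ae_tendsto_of_weak {u : ℕ → B1 n m} {v : B1 n m} {C : ℝ} (hb : ∀ j, ‖u j‖ ≤ C)
    (hw : ∀ ℓ : B1 n m →L[ℂ] ℂ, Tendsto (fun j => ℓ (u j)) atTop (𝓝 (ℓ v))) :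
    ∃ φ : ℕ → ℕ, StrictMono φ ∧
      ∀ᵐ x, Tendsto (fun j => val (u (φ j)) x) atTop (𝓝 (val v x)) := by
  -- A finite measure with the Lebesgue null sets yields almost everywhere convergence on the whole
  -- space, without a diagonal argument over balls.
  obtain ⟨ν, hfin, hle, hac⟩ := exists_finite_measure_le (n := n) (m := m)
  have hac' : ν ≪ volume := Measure.absolutelyContinuous_of_le hle
  have h1 : Tendsto (fun j => eLpNorm (val (u j - v)) 2 ν) atTop (𝓝 0) := by
    refine tendsto_eLpNorm_of_weak (C := C + ‖v‖)
      (fun j => (norm_sub_le _ _).trans (add_le_add_left (hb j) _)) (fun ℓ => ?_) hle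
    simpa using (hw ℓ).sub_const (ℓ v)
  have h2 : TendstoInMeasure ν (fun j => (val (u j) : Space n m → ℂ)) atTop (val v) := by
    refine tendstoInMeasure_of_tendsto_eLpNorm (p := 2) (by norm_num)
      (fun j => (Lp.aestronglyMeasurable _).mono_ac hac')
      ((Lp.aestronglyMeasurable _).mono_ac hac') (h1.congr fun j => ?_)
    refine eLpNorm_congr_ae (hac'.ae_le ?_)
    rw [val_sub]
    exact Lp.coeFn_sub _ _
  obtain ⟨φ, hφ, h3⟩ := h2.exists_seq_tendsto_ae
  exact ⟨φ, hφ, hac.ae_le h3⟩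

/-! ### Existence of maximizers -/

/-- With `τ ^ p = 1 - ε`: if `‖b‖ ≤ (1 - τ) ‖a‖` then `‖a - b‖ ≥ τ ‖a‖`; otherwise `b` alone
controls `a`. The bound `1 ≤ K` keeps the pointwise limit in the Fatou argument nonnegative. -/
theorem exists_rpow_sub_bound {p ε : ℝ} (hp : 0 < p) (hε0 : 0 < ε) (hε1 : ε < 1) :
    ∃ K : ℝ, 1 ≤ K ∧ ∀ a b : ℂ, (1 - ε) * ‖a‖ ^ p ≤ ‖a - b‖ ^ p + K * ‖b‖ ^ p := by
  set τ : ℝ := (1 - ε) ^ (1 / p) with hτ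
  have h1ε : 0 < 1 - ε := by linarith
  have hτ0 : 0 < τ := by positivity
  have hτ1 : τ < 1 := Real.rpow_lt_one h1ε.le (by linarith) (by positivity)
  have hτp : τ ^ p = 1 - ε := by
    rw [hτ, ← Real.rpow_mul h1ε.le, one_div_mul_cancel hp.ne', Real.rpow_one]
  have hθ0 : 0 < 1 - τ := by linarith
  refine ⟨((1 - τ)⁻¹) ^ p, Real.one_le_rpow ((one_le_inv₀ hθ0).2 (by linarith)) hp.le,
    fun a b => ?_⟩
  rcases le_or_gt ‖b‖ ((1 - τ) * ‖a‖) with h | h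
  · have h1 : τ * ‖a‖ ≤ ‖a - b‖ := by
      have := norm_sub_norm_le a b
      linarith
    have h2 := Real.rpow_le_rpow (by positivity) h1 hp.le
    rw [Real.mul_rpow hτ0.le (norm_nonneg _), hτp] at h2
    have h3 : 0 ≤ ((1 - τ)⁻¹) ^ p * ‖b‖ ^ p := by positivity
    linarith
  · have h1 : ‖a‖ ≤ (1 - τ)⁻¹ * ‖b‖ := by
      rw [inv_mul_eq_div, le_div_iff₀ hθ0]; linarith
    have h2 := Real.rpow_le_rpow (norm_nonneg _) h1 hp.le
    rw [Real.mul_rpow (by positivity) (norm_nonneg _)] at h2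
    have h3 : 0 ≤ ‖a - b‖ ^ p := by positivity
    have h4 : 0 ≤ ‖a‖ ^ p := by positivity
    nlinarith

section

variable {σ : ℝ}

/-- A one-sided Brezis–Lieb lemma. -/
theorem Subcritical.le_of_tendsto_ae (h : Subcritical n m σ) {u : ℕ → B1 n m} {v : B1 n m}
    (hae : ∀ᵐ x, Tendsto (fun j => val (u j) x) atTop (𝓝 (val v x))) {A B : ℝ} (hB : 0 ≤ B)
    {a b : ℕ → ℝ} (ha : Tendsto a atTop (𝓝 A)) (hb : Tendsto b atTop (𝓝 B))
    (hau : ∀ j, potential σ (u j - v) ≤ a j) (hbu : ∀ j, b j ≤ potential σ (u j)) :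
    B ≤ potential σ v + A := by
  set p := 2 * σ + 2 with hp
  have hp0 : 0 < p := by have := h.pos; positivity
  have key : ∀ ε : ℝ, 0 < ε → ε < 1 → (1 - ε) * B ≤ (1 - ε) * potential σ v + A := by
    intro ε hε0 hε1
    obtain ⟨K, hK1, hK⟩ := exists_rpow_sub_bound hp0 hε0 hε1
    -- `F j` is nonnegative and tends to `(K - (1 - ε)) ‖v‖ ^ p`. Fatou applies, and the terms with
    -- `K` cancel from the resulting inequality.
    set F : ℕ → Space n m → ℝ := fun j x =>
      ‖val (u j - v) x‖ ^ p + K * ‖val v x‖ ^ p - (1 - ε) * ‖val (u j) x‖ ^ p with hF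
    have hsub : ∀ᵐ x, ∀ j, val (u j - v) x = val (u j) x - val v x :=
      ae_all_iff.2 fun j => Lp.coeFn_sub _ _
    have hF0 : ∀ j, 0 ≤ᵐ[volume] F j := fun j => by
      filter_upwards [hsub] with x hx
      have := hK (val (u j) x) (val v x)
      simp only [hF, hx j, Pi.zero_apply]
      linarith
    have hFi : ∀ j, Integrable (F j) := fun j =>
      ((h.integrable_rpow (u j - v)).add ((h.integrable_rpow v).const_mul K)).sub
        ((h.integrable_rpow (u j)).const_mul (1 - ε))
    have hFint : ∀ j, ∫ x, F j x
        = potential σ (u j - v) + K * potential σ v - (1 - ε) * potential σ (u j) := fun j => by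
      simp only [hF]
      rw [integral_sub, integral_add, integral_const_mul, integral_const_mul]
      · rfl
      · exact h.integrable_rpow (u j - v)
      · exact (h.integrable_rpow v).const_mul K
      · exact (h.integrable_rpow (u j - v)).add ((h.integrable_rpow v).const_mul K)
      · exact (h.integrable_rpow (u j)).const_mul (1 - ε)
    set G : Space n m → ℝ := fun x => (K - (1 - ε)) * ‖val v x‖ ^ p with hG
    have hFG : ∀ᵐ x, Tendsto (fun j => F j x) atTop (𝓝 (G x)) := by
      filter_upwards [hae, hsub] with x hx hxs
      have hc : Continuous fun z : ℂ => ‖z‖ ^ p :=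
        continuous_norm.rpow_const fun _ => Or.inr hp0.le
      have h1 : Tendsto (fun j => ‖val (u j - v) x‖ ^ p) atTop (𝓝 0) := by
        simp only [hxs]
        have := (hc.tendsto _).comp (hx.sub_const (val v x))
        simpa [Function.comp_def, Real.zero_rpow hp0.ne'] using this
      have h2 := (h1.add_const (K * ‖val v x‖ ^ p)).sub
        (((hc.tendsto _).comp hx).const_mul (1 - ε))
      refine (h2.congr fun j => rfl).trans_eq ?_
      simp only [hG]
      congr 1; ring
    set U : ℕ → ℝ := fun j => a j + K * potential σ v - (1 - ε) * b j with hU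
    have hUF : ∀ j, ∫ x, F j x ≤ U j := fun j => by
      rw [hFint, hU]
      have := mul_le_mul_of_nonneg_left (hbu j) (by linarith : 0 ≤ 1 - ε)
      linarith [hau j]
    have hUlim : Tendsto U atTop (𝓝 (A + K * potential σ v - (1 - ε) * B)) :=
      (ha.add_const _).sub (hb.const_mul _)
    have hL0 : 0 ≤ A + K * potential σ v - (1 - ε) * B :=
      ge_of_tendsto' hUlim fun j => (integral_nonneg_of_ae (hF0 j)).trans (hUF j)
    have hfatou : ∫⁻ x, ENNReal.ofReal (G x)
        ≤ ENNReal.ofReal (A + K * potential σ v - (1 - ε) * B) := by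
      calc ∫⁻ x, ENNReal.ofReal (G x)
          = ∫⁻ x, liminf (fun j => ENNReal.ofReal (F j x)) atTop := by
            refine lintegral_congr_ae ?_
            filter_upwards [hFG] with x hx
            exact ((ENNReal.tendsto_ofReal hx).liminf_eq).symm
        _ ≤ liminf (fun j => ∫⁻ x, ENNReal.ofReal (F j x)) atTop :=
            lintegral_liminf_le' fun j => (hFi j).aestronglyMeasurable.aemeasurable.ennreal_ofReal
        _ ≤ liminf (fun j => ENNReal.ofReal (U j)) atTop := by
            refine liminf_le_liminf (Eventually.of_forall fun j => ?_)
            rw [← ofReal_integral_eq_lintegral_ofReal (hFi j) (hF0 j)]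
            exact ENNReal.ofReal_le_ofReal (hUF j)
        _ = _ := (ENNReal.tendsto_ofReal hUlim).liminf_eq
    have hG0 : 0 ≤ᵐ[volume] G := Eventually.of_forall fun x =>
      mul_nonneg (by linarith) (by positivity)
    rw [← ofReal_integral_eq_lintegral_ofReal ((h.integrable_rpow v).const_mul _) hG0,
      ENNReal.ofReal_le_ofReal_iff hL0] at hfatou
    have : ∫ x, G x = (K - (1 - ε)) * potential σ v := integral_const_mul _ _
    rw [this] at hfatou
    linarith
  by_contra! hcon
  set δ := B - (potential σ v + A) with hδ
  have hδ0 : 0 < δ := by linarith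
  have hP := potential_nonneg σ v
  -- `ε` is small enough that `ε B` is at most half of the supposed defect `δ`.
  have h1 := key (min (1 / 2) (δ / (2 * (B + 1)))) (lt_min (by norm_num) (by positivity))
    ((min_le_left _ _).trans_lt (by norm_num))
  have h2 : min (1 / 2) (δ / (2 * (B + 1))) * B ≤ δ / 2 := by
    calc _ ≤ δ / (2 * (B + 1)) * B := by gcongr; exact min_le_right _ _
      _ ≤ δ / 2 := by
        rw [div_mul_eq_mul_div, div_le_div_iff₀ (by positivity) (by norm_num)]
        nlinarith
  have h3 : 0 ≤ min (1 / 2) (δ / (2 * (B + 1))) * potential σ v :=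
    mul_nonneg (le_min (by norm_num) (by positivity)) hP
  nlinarith

theorem potential_zero (hσ : 0 < σ) : potential σ (0 : B1 n m) = 0 := by
  have := potential_smul σ 0 (0 : B1 n m)
  rwa [smul_zero, norm_zero, Real.zero_rpow (by positivity), zero_mul] at this

/-- The best constant in the embedding of the energy space into `L^(2σ+2)` is attained. -/
theorem Subcritical.exists_maximizer (h : Subcritical n m σ) :
    ∃ Q : B1 n m, ‖Q‖ = 1 ∧ 0 < potential σ Q ∧
      ∀ u : B1 n m, potential σ u ≤ potential σ Q * ‖u‖ ^ (2 * σ + 2) := by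
  set p := 2 * σ + 2 with hp
  have hσ := h.pos
  have hp0 : 0 < p := by positivity
  obtain ⟨C, hC0, hC⟩ := h.exists_potential_le (n := n) (m := m)
  set S : Set ℝ := potential σ '' Metric.closedBall (0 : B1 n m) 1 with hS
  have hSb : BddAbove S := by
    refine ⟨C, ?_⟩
    rintro _ ⟨u, hu, rfl⟩
    rw [mem_closedBall_zero_iff] at hu
    refine (hC u).trans (mul_le_of_le_one_right hC0 ?_)
    exact Real.rpow_le_one (norm_nonneg _) hu hp0.le
  have hSn : S.Nonempty := ⟨_, 0, by simp, rfl⟩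
  set M := sSup S with hM
  have hle : ∀ u : B1 n m, potential σ u ≤ M * ‖u‖ ^ p := fun u => by
    by_cases hu : u = 0
    · rw [hu, potential_zero hσ, norm_zero, Real.zero_rpow hp0.ne', mul_zero]
    · have hu' : 0 < ‖u‖ := norm_pos_iff.2 hu
      have h1 : potential σ (((‖u‖⁻¹ : ℝ) : ℂ) • u) ≤ M := by
        refine le_csSup hSb ⟨_, ?_, rfl⟩
        rw [mem_closedBall_zero_iff, norm_smul, Complex.norm_real, norm_inv, norm_norm,
          inv_mul_cancel₀ hu'.ne']
      rw [potential_smul, Complex.norm_real, norm_inv, norm_norm, Real.inv_rpow hu'.le,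
        inv_mul_le_iff₀ (by positivity)] at h1
      linarith
  have hM0 : 0 < M := by
    obtain ⟨u, hu⟩ := exists_potential_pos (n := n) (m := m) σ hσ
    have := hu.trans_le (hle u)
    by_contra! hcon
    exact this.not_ge (mul_nonpos_of_nonpos_of_nonneg hcon (by positivity))
  obtain ⟨c, R, hc, hmass⟩ := h.exists_subst_mass (n := n) (m := m) (half_pos hM0)
  have hseq : ∀ j : ℕ, ∃ u : B1 n m, ‖u‖ ≤ 1 ∧ M - 1 / ((j : ℝ) + 1) ≤ potential σ u ∧
      ENNReal.ofReal c ≤ ∫⁻ x in Metric.ball 0 R, ‖val u x‖ₑ ^ 2 := by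
    intro j
    -- The minimum with `M / 2` keeps the potential above `M / 2`, the level at which the mass lemma
    -- was invoked.
    have hlt : M - min (M / 2) (1 / ((j : ℝ) + 1)) < M :=
      sub_lt_self _ (lt_min (by positivity) (by positivity))
    obtain ⟨_, ⟨u, hu, rfl⟩, hu2⟩ := exists_lt_of_lt_csSup hSn hlt
    rw [mem_closedBall_zero_iff] at hu
    have h1 := min_le_left (M / 2) (1 / ((j : ℝ) + 1))
    have h2 := min_le_right (M / 2) (1 / ((j : ℝ) + 1))
    obtain ⟨e, he⟩ := hmass u hu (by linarith)
    refine ⟨subst one_pos e u, (norm_subst_one e u).trans_le hu, ?_, he⟩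
    rw [potential_subst]
    simp only [one_pow, inv_one, one_mul]
    linarith
  choose u hu1 huM huc using hseq
  obtain ⟨v, φ, hφ, hweak⟩ := exists_weak_limit u hu1
  obtain ⟨ψ, hψ, hae⟩ := exists_ae_tendsto_of_weak (fun j => hu1 (φ j)) hweak
  have hinner : Tendsto (fun j => (inner ℂ v (u (φ j))).re) atTop (𝓝 (‖v‖ ^ 2)) := by
    have h1 := (Complex.continuous_re.tendsto _).comp (hweak (innerSL ℂ v))
    simp only [innerSL_apply_apply, Function.comp_def] at h1
    rwa [show (inner ℂ v v).re = ‖v‖ ^ 2 from (norm_sq_eq_re_inner (𝕜 := ℂ) v).symm] at h1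
  have hv1 : ‖v‖ ≤ 1 := by
    have h1 : ‖v‖ ^ 2 ≤ ‖v‖ := le_of_tendsto' hinner fun j => by
      refine (Complex.re_le_norm _).trans ((norm_inner_le_norm _ _).trans ?_)
      exact mul_le_of_le_one_right (norm_nonneg _) (hu1 _)
    nlinarith [norm_nonneg v]
  -- Otherwise local compactness would send the mass in the fixed ball to `0`, below `c`.
  have hv0 : v ≠ 0 := by
    rintro rfl
    have h1 : Tendsto (fun j => eLpNorm (val (u (φ j))) 2
        (volume.restrict (Metric.ball (0 : Space n m) R))) atTop (𝓝 0) := by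
      have : IsFiniteMeasure (volume.restrict (Metric.ball (0 : Space n m) R)) :=
        ⟨by rw [Measure.restrict_apply_univ]; exact measure_ball_lt_top⟩
      refine tendsto_eLpNorm_of_weak (fun j => hu1 (φ j)) (fun ℓ => ?_) Measure.restrict_le_self
      simpa using hweak ℓ
    have h2 := ((ENNReal.continuous_pow 2).tendsto _).comp h1
    have h3 : ENNReal.ofReal c ≤ 0 ^ 2 := ge_of_tendsto' h2 fun j => by
      rw [Function.comp_apply, eLpNorm_two_sq]
      exact huc _
    simp only [ne_eq, OfNat.ofNat_ne_zero, not_false_eq_true, zero_pow, nonpos_iff_eq_zero,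
      ENNReal.ofReal_eq_zero] at h3
    linarith
  set x := ‖v‖ ^ 2 with hx
  have hx0 : 0 < x := by have := norm_pos_iff.2 hv0; positivity
  have hx1 : x ≤ 1 := pow_le_one₀ (norm_nonneg _) hv1
  have hnp : ∀ w : B1 n m, ‖w‖ ^ p = (‖w‖ ^ 2) ^ (σ + 1) := fun w => by
    rw [← Real.rpow_two, ← Real.rpow_mul (norm_nonneg _), hp]; congr 1; ring
  -- The remainder satisfies `P(u - v) ≤ M ‖u - v‖ ^ p`, and weak convergence with `‖u‖ ≤ 1` makes
  -- `1 - x` the limit of an upper bound for `‖u - v‖²`.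
  have hBL : M ≤ potential σ v + M * (1 - x) ^ (σ + 1) := by
    have hψφ := hφ.comp hψ
    refine h.le_of_tendsto_ae (u := fun j => u (φ (ψ j))) hae hM0.le
      (a := fun j => M * (1 - 2 * (inner ℂ v (u (φ (ψ j)))).re + x) ^ (σ + 1))
      (b := fun j => M - 1 / (((φ (ψ j) : ℕ) : ℝ) + 1)) ?_ ?_ (fun j => ?_) (fun j => huM _)
    · have h1 := ((hinner.comp hψ.tendsto_atTop).const_mul 2).const_sub 1 |>.add_const x
      have h2 : 1 - 2 * x + x = 1 - x := by ring
      rw [h2] at h1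
      exact (h1.rpow_const (Or.inr (by positivity))).const_mul M
    · have h1 := (tendsto_one_div_add_atTop_nhds_zero_nat (𝕜 := ℝ)).comp hψφ.tendsto_atTop
      simpa using h1.const_sub M
    · refine (hle _).trans ?_
      rw [hnp]
      have h1 : ‖u (φ (ψ j)) - v‖ ^ 2
          = ‖u (φ (ψ j))‖ ^ 2 - 2 * (inner ℂ v (u (φ (ψ j)))).re + x := by
        rw [norm_sub_sq (𝕜 := ℂ), inner_re_symm, hx]
        rfl
      have h2 : ‖u (φ (ψ j))‖ ^ 2 ≤ 1 := pow_le_one₀ (norm_nonneg _) (hu1 _)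
      gcongr
      rw [h1]
      linarith
  have hPv : potential σ v ≤ M * x ^ (σ + 1) := by rw [hx, ← hnp]; exact hle v
  -- For `0 < x < 1` the exponent `σ + 1 > 1` gives `x ^ (σ+1) + (1 - x) ^ (σ+1) < 1`, contradicting
  -- `hBL` and `hPv`.
  have hx_eq : x = 1 := by
    by_contra hne
    have hlt : x < 1 := lt_of_le_of_ne hx1 hne
    have h1 : x ^ (σ + 1) < x := by
      have := Real.rpow_lt_rpow_of_exponent_gt hx0 hlt (by linarith : (1 : ℝ) < σ + 1)
      rwa [Real.rpow_one] at this
    have h2 : (1 - x) ^ (σ + 1) < 1 - x := by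
      have := Real.rpow_lt_rpow_of_exponent_gt (by linarith : 0 < 1 - x) (by linarith)
        (by linarith : (1 : ℝ) < σ + 1)
      rwa [Real.rpow_one] at this
    nlinarith
  have hMv : M ≤ potential σ v := by
    rw [hx_eq, sub_self, Real.zero_rpow (by positivity), mul_zero, add_zero] at hBL
    exact hBL
  refine ⟨v, ?_, hM0.trans_le hMv, fun w => (hle w).trans ?_⟩
  · exact (pow_eq_one_iff_of_nonneg (norm_nonneg v) two_ne_zero).1 hx_eq
  · gcongr

end

/-! ### Optimizers and solutions -/

variable {σ : ℝ}

theorem action_eq (u : B1 n m) : action σ u = ‖u‖ ^ 2 / 2 - potential σ u / (2 * σ + 2) := by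
  rw [norm_sq_eq, action]; ring

theorem J_one_zero (hσ : 0 < σ) (u : B1 n m) : J σ 1 0 u = ‖u‖ ^ 2 - potential σ u := by
  have : (2 * σ + 2) ≠ 0 := by positivity
  rw [norm_sq_eq, J]
  field_simp
  ring

/-- A function on the Nehari manifold realising the best constant of the embedding of the energy
space into `L^(2σ+2)`. -/
structure IsOptimizer (σ : ℝ) (Q : B1 n m) : Prop where
  norm_pos : 0 < ‖Q‖
  potential_eq : potential σ Q = ‖Q‖ ^ 2
  potential_mul_le : ∀ u : B1 n m, potential σ u * ‖Q‖ ^ (2 * σ) ≤ ‖u‖ ^ (2 * σ + 2)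

theorem rpow_two_mul_add_two (hσ : 0 < σ) {a : ℝ} (ha : 0 ≤ a) :
    a ^ (2 * σ + 2) = a ^ (2 * σ) * a ^ 2 := by
  rw [Real.rpow_add_of_nonneg ha (by positivity) (by norm_num), Real.rpow_two]

/-- On the ray through a unit maximiser the squared norm is `t²` and the potential `M t ^ (2σ+2)`;
they agree when `t ^ (2σ) = 1 / M`, and then `‖Q‖ ^ (2σ)` is the reciprocal of the best constant. -/
theorem Subcritical.exists_isOptimizer (h : Subcritical n m σ) :
    ∃ Q : B1 n m, IsOptimizer σ Q := by
  obtain ⟨R, hR1, hRP, hR⟩ := h.exists_maximizer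
  have hσ := h.pos
  set M := potential σ R
  set t : ℝ := (1 / M) ^ (1 / (2 * σ)) with ht
  have ht0 : 0 < t := by positivity
  have htp : t ^ (2 * σ) = 1 / M := by
    rw [ht, ← Real.rpow_mul (by positivity), one_div_mul_cancel (by positivity), Real.rpow_one]
  have hn : ‖((t : ℝ) : ℂ) • R‖ = t := by
    rw [norm_smul, Complex.norm_real, Real.norm_of_nonneg ht0.le, hR1, mul_one]
  refine ⟨(t : ℂ) • R, by rwa [hn], ?_, fun u => ?_⟩
  · rw [hn, potential_smul, Complex.norm_real, Real.norm_of_nonneg ht0.le,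
      rpow_two_mul_add_two hσ ht0.le, htp]
    change 1 / M * t ^ 2 * M = t ^ 2
    field_simp
  · rw [hn, htp, mul_one_div, div_le_iff₀ hRP, mul_comm]
    exact hR u

section optimizer

variable {Q : B1 n m}

theorem IsOptimizer.ne_zero (hQ : IsOptimizer σ Q) : Q ≠ 0 := norm_pos_iff.1 hQ.norm_pos

theorem action_of_nehari (hσ : 0 < σ) {u : B1 n m} (hu : potential σ u = ‖u‖ ^ 2) :
    action σ u = σ / (2 * σ + 2) * ‖u‖ ^ 2 := by
  have : (2 * σ + 2) ≠ 0 := by positivity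
  rw [action_eq, hu]
  field_simp
  ring

theorem IsOptimizer.action_pos (hσ : 0 < σ) (hQ : IsOptimizer σ Q) : 0 < action σ Q := by
  rw [action_of_nehari hσ hQ.potential_eq]
  have := hQ.norm_pos
  positivity

theorem IsOptimizer.norm_le_of_nehari (hσ : 0 < σ) (hQ : IsOptimizer σ Q) {u : B1 n m}
    (hu0 : u ≠ 0) (hu : potential σ u = ‖u‖ ^ 2) : ‖Q‖ ≤ ‖u‖ := by
  have h1 := hQ.potential_mul_le u
  have hu' : 0 < ‖u‖ := norm_pos_iff.2 hu0
  rw [hu, rpow_two_mul_add_two hσ hu'.le, mul_comm] at h1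
  have h2 := le_of_mul_le_mul_right h1 (by positivity)
  exact (Real.rpow_le_rpow_iff hQ.norm_pos.le hu'.le (by positivity)).1 h2

theorem IsOptimizer.action_le_of_nehari (hσ : 0 < σ) (hQ : IsOptimizer σ Q) {u : B1 n m}
    (hu0 : u ≠ 0) (hu : potential σ u = ‖u‖ ^ 2) : action σ Q ≤ action σ u := by
  rw [action_of_nehari hσ hQ.potential_eq, action_of_nehari hσ hu]
  gcongr
  exact hQ.norm_le_of_nehari hσ hu0 hu

/-- On the Nehari manifold the action determines the norm, and the sharp inequality involves `Q`
only through its norm. -/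
theorem IsOptimizer.of_action_eq (hσ : 0 < σ) (hQ : IsOptimizer σ Q) {u : B1 n m}
    (hu : potential σ u = ‖u‖ ^ 2) (hS : action σ u = action σ Q) : IsOptimizer σ u := by
  have h1 : ‖u‖ = ‖Q‖ := by
    rw [action_of_nehari hσ hQ.potential_eq, action_of_nehari hσ hu] at hS
    have h2 := mul_left_cancel₀ (by positivity) hS
    exact (sq_eq_sq₀ (norm_nonneg _) (norm_nonneg _)).1 h2
  exact ⟨h1 ▸ hQ.norm_pos, hu, h1 ▸ hQ.potential_mul_le⟩

theorem IsOptimizer.potential_le (hσ : 0 < σ) (hQ : IsOptimizer σ Q) {u : B1 n m}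
    (hu : ‖u‖ ≤ ‖Q‖) : potential σ u ≤ ‖u‖ ^ 2 := by
  have h1 := hQ.potential_mul_le u
  have h2 : 0 < ‖Q‖ ^ (2 * σ) := Real.rpow_pos_of_pos hQ.norm_pos _
  rw [rpow_two_mul_add_two hσ (norm_nonneg _)] at h1
  have h3 : ‖u‖ ^ (2 * σ) ≤ ‖Q‖ ^ (2 * σ) :=
    Real.rpow_le_rpow (norm_nonneg _) hu (by positivity)
  have h4 : potential σ u * ‖Q‖ ^ (2 * σ) ≤ ‖u‖ ^ 2 * ‖Q‖ ^ (2 * σ) := by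
    nlinarith [sq_nonneg ‖u‖]
  exact le_of_mul_le_mul_right h4 h2

/-! ### The Euler–Lagrange equation -/

/-- The tangent plane inequality for the convex function `‖·‖ ^ (2σ+2)`, obtained from
Cauchy–Schwarz and Bernoulli's inequality for the ratio `‖a + b‖ / ‖a‖`. -/
theorem rpow_norm_add_ge (hσ : 0 < σ) (a b : ℂ) :
    ‖a‖ ^ (2 * σ + 2) + (2 * σ + 2) * (((‖a‖ ^ (2 * σ) : ℝ) : ℂ) * a * (starRingEnd ℂ) b).re
      ≤ ‖a + b‖ ^ (2 * σ + 2) := by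
  rcases eq_or_ne a 0 with rfl | ha
  · rw [norm_zero, Real.zero_rpow (by positivity), mul_zero, zero_mul, Complex.zero_re]
    simp only [mul_zero, add_zero]
    positivity
  have hA : 0 < ‖a‖ := norm_pos_iff.2 ha
  have hre : (((‖a‖ ^ (2 * σ) : ℝ) : ℂ) * a * (starRingEnd ℂ) b).re
      = ‖a‖ ^ (2 * σ) * (a * (starRingEnd ℂ) b).re := by
    rw [mul_assoc, Complex.re_ofReal_mul]
  have h1 : (a * (starRingEnd ℂ) b).re ≤ ‖a‖ * ‖a + b‖ - ‖a‖ ^ 2 := by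
    have h2 : (a * (starRingEnd ℂ) (a + b)).re ≤ ‖a‖ * ‖a + b‖ := by
      refine (Complex.re_le_norm _).trans_eq ?_
      rw [norm_mul, RCLike.norm_conj]
    rw [map_add, mul_add, Complex.add_re, Complex.mul_conj, Complex.normSq_eq_norm_sq,
      Complex.ofReal_re] at h2
    linarith
  set y := ‖a + b‖ / ‖a‖ with hy
  have hy0 : 0 ≤ y := by positivity
  have hya : ‖a + b‖ = y * ‖a‖ := by rw [hy, div_mul_cancel₀ _ hA.ne']
  have hb := one_add_mul_self_le_rpow_one_add (by linarith : -1 ≤ y - 1)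
    (by linarith : 1 ≤ 2 * σ + 2)
  rw [add_sub_cancel] at hb
  have hp : 0 < ‖a‖ ^ (2 * σ) := by positivity
  rw [hre, hya, Real.mul_rpow hy0 hA.le, rpow_two_mul_add_two hσ hA.le]
  rw [hya] at h1
  have h3 := mul_le_mul_of_nonneg_left h1 (by positivity : 0 ≤ (2 * σ + 2) * ‖a‖ ^ (2 * σ))
  have h4 := mul_le_mul_of_nonneg_right hb (by positivity : 0 ≤ ‖a‖ ^ (2 * σ) * ‖a‖ ^ 2)
  nlinarith

theorem Subcritical.integrable_nonlinearity (h : Subcritical n m σ) (u v : B1 n m) :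
    Integrable fun x => ((‖val u x‖ ^ (2 * σ) : ℝ) : ℂ) * val u x
      * (starRingEnd ℂ) (val v x) := by
  have hσ := h.pos
  have hu := Lp.aestronglyMeasurable (val u)
  have hv := Lp.aestronglyMeasurable (val v)
  refine Integrable.mono' ((h.integrable_rpow u).add (h.integrable_rpow v)) ?_
    (Eventually.of_forall fun x => ?_)
  · exact ((Complex.continuous_ofReal.comp_aestronglyMeasurable
      (hu.norm.aemeasurable.pow_const _).aestronglyMeasurable).mul hu).mul
      (Complex.continuous_conj.comp_aestronglyMeasurable hv)
  · rw [norm_mul, norm_mul, RCLike.norm_conj, Complex.norm_real,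
      Real.norm_of_nonneg (by positivity), Pi.add_apply]
    have key : ∀ s : ℝ, 0 ≤ s → s ^ (2 * σ) * s * s = s ^ (2 * σ + 2) := fun s hs => by
      rw [rpow_two_mul_add_two hσ hs]; ring
    rcases le_total ‖val u x‖ ‖val v x‖ with hle | hle
    · calc _ ≤ ‖val v x‖ ^ (2 * σ) * ‖val v x‖ * ‖val v x‖ := by gcongr
        _ = ‖val v x‖ ^ (2 * σ + 2) := key _ (norm_nonneg _)
        _ ≤ _ := le_add_of_nonneg_left (by positivity)
    · calc _ ≤ ‖val u x‖ ^ (2 * σ) * ‖val u x‖ * ‖val u x‖ := by gcongr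
        _ = ‖val u x‖ ^ (2 * σ + 2) := key _ (norm_nonneg _)
        _ ≤ _ := le_add_of_nonneg_right (by positivity)

/-- The nonlinear term of the equation tested against `v`. -/
noncomputable def nonlinearity (σ : ℝ) (u v : B1 n m) : ℂ :=
  ∫ x, ((‖val u x‖ ^ (2 * σ) : ℝ) : ℂ) * val u x * (starRingEnd ℂ) (val v x)

theorem nonlinearity_smul (u v : B1 n m) (c : ℂ) :
    nonlinearity σ u (c • v) = (starRingEnd ℂ) c * nonlinearity σ u v := by
  rw [nonlinearity, nonlinearity, ← integral_const_mul]
  refine integral_congr_ae ?_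
  filter_upwards [Lp.coeFn_smul c (val v)] with x hx
  rw [val_smul, hx, Pi.smul_apply, smul_eq_mul, map_mul]
  ring

theorem nonlinearity_self (hσ : 0 < σ) (u : B1 n m) :
    nonlinearity σ u u = ((potential σ u : ℝ) : ℂ) := by
  rw [nonlinearity, potential, ← integral_complex_ofReal]
  refine integral_congr_ae (Eventually.of_forall fun x => ?_)
  dsimp only
  rw [mul_assoc, Complex.mul_conj, Complex.normSq_eq_norm_sq,
    rpow_two_mul_add_two hσ (norm_nonneg _), ← Complex.ofReal_mul]

theorem Subcritical.potential_add_ge (h : Subcritical n m σ) (u v : B1 n m) :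
    potential σ u + (2 * σ + 2) * (nonlinearity σ u v).re ≤ potential σ (u + v) := by
  have hi := h.integrable_nonlinearity u v
  have hre : (nonlinearity σ u v).re
      = ∫ x, (((‖val u x‖ ^ (2 * σ) : ℝ) : ℂ) * val u x * (starRingEnd ℂ) (val v x)).re := by
    rw [nonlinearity]; exact (integral_re hi).symm
  have hi' : Integrable fun x => (2 * σ + 2) *
      (((‖val u x‖ ^ (2 * σ) : ℝ) : ℂ) * val u x * (starRingEnd ℂ) (val v x)).re :=
    hi.re.const_mul _
  rw [hre, ← integral_const_mul, potential, potential, ← integral_add (h.integrable_rpow u) hi']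
  refine integral_mono_ae ((h.integrable_rpow u).add hi') (h.integrable_rpow (u + v)) ?_
  filter_upwards [Lp.coeFn_add (val u) (val v)] with x hx
  rw [val_add, hx]
  exact rpow_norm_add_ge h.pos _ _

theorem isSolution_iff (u : B1 n m) :
    IsSolution σ u ↔ u ≠ 0 ∧ ∀ v, inner ℂ v u = nonlinearity σ u v := by
  simp only [IsSolution, inner_eq, nonlinearity, sub_eq_zero]

/-- In the sharp inequality at `Q + t v`, replace the potential by its affine minorant from
`potential_add_ge`. The resulting gap `F` is nonnegative and vanishes at `t = 0`, so `F' 0 = 0`; the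
potential itself never has to be differentiated. -/
theorem IsOptimizer.re_inner_eq (h : Subcritical n m σ) (hQ : IsOptimizer σ Q) (v : B1 n m) :
    (inner ℂ v Q).re = (nonlinearity σ Q v).re := by
  have hσ := h.pos
  set D := (nonlinearity σ Q v).re
  set N := (inner ℂ v Q).re with hN
  have hq : 0 < ‖Q‖ ^ (2 * σ) := Real.rpow_pos_of_pos hQ.norm_pos _
  have hsq : ∀ s : ℝ, 0 ≤ s → s ^ (2 * σ) = (s ^ 2) ^ σ := fun s hs => by
    rw [← Real.rpow_two, ← Real.rpow_mul hs]
  set F : ℝ → ℝ := fun t => (‖Q‖ ^ 2 + t * (2 * N) + t ^ 2 * ‖v‖ ^ 2) ^ (σ + 1)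
    - (‖Q‖ ^ 2 + t * ((2 * σ + 2) * D)) * ‖Q‖ ^ (2 * σ) with hF
  have hnorm : ∀ t : ℝ, ‖Q + (t : ℂ) • v‖ ^ 2 = ‖Q‖ ^ 2 + t * (2 * N) + t ^ 2 * ‖v‖ ^ 2 := by
    intro t
    have hs : inner ℂ Q ((t : ℂ) • v) = (t : ℂ) * inner ℂ Q v := inner_smul_right Q v _
    rw [norm_add_sq (𝕜 := ℂ), hs, norm_smul, Complex.norm_real, mul_pow,
      Real.norm_eq_abs, sq_abs]
    have : RCLike.re ((t : ℂ) * inner ℂ Q v) = t * N := by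
      rw [hN]
      change ((t : ℂ) * inner ℂ Q v).re = _
      rw [Complex.re_ofReal_mul]
      congr 1
      exact inner_re_symm (𝕜 := ℂ) Q v
    rw [this]; ring
  have hF0 : ∀ t, 0 ≤ F t := fun t => by
    have h1 := h.potential_add_ge Q ((t : ℂ) • v)
    have h2 := hQ.potential_mul_le (Q + (t : ℂ) • v)
    rw [nonlinearity_smul, Complex.conj_ofReal, Complex.re_ofReal_mul, hQ.potential_eq] at h1
    have h3 : ‖Q + (t : ℂ) • v‖ ^ (2 * σ + 2) = (‖Q + (t : ℂ) • v‖ ^ 2) ^ (σ + 1) := by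
      rw [← Real.rpow_two, ← Real.rpow_mul (norm_nonneg _)]; congr 1; ring
    rw [h3, hnorm] at h2
    have h4 := mul_le_mul_of_nonneg_right h1 hq.le
    simp only [hF]
    have h5 : (‖Q‖ ^ 2 + (2 * σ + 2) * (t * D)) = ‖Q‖ ^ 2 + t * ((2 * σ + 2) * D) := by ring
    rw [h5] at h4
    linarith
  have hFz : F 0 = 0 := by
    simp only [hF]
    rw [hsq _ (norm_nonneg _)]
    have := Real.rpow_add_one (x := ‖Q‖ ^ 2) (pow_pos hQ.norm_pos 2).ne' σ
    simp only [zero_mul, add_zero, ne_eq, OfNat.ofNat_ne_zero, not_false_eq_true, zero_pow, this]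
    ring
  have hmin : IsLocalMin F 0 := Eventually.of_forall fun t => by rw [hFz]; exact hF0 t
  have hder : HasDerivAt F ((2 * N) * (σ + 1) * (‖Q‖ ^ 2) ^ σ
      - (2 * σ + 2) * D * ‖Q‖ ^ (2 * σ)) 0 := by
    have h1 : HasDerivAt (fun t : ℝ => ‖Q‖ ^ 2 + t * (2 * N) + t ^ 2 * ‖v‖ ^ 2) (2 * N) 0 := by
      have := (((hasDerivAt_id (0 : ℝ)).mul_const (2 * N)).const_add (‖Q‖ ^ 2)).add
        ((hasDerivAt_pow 2 (0 : ℝ)).mul_const (‖v‖ ^ 2))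
      exact this.congr_deriv (by simp)
    have h2 := h1.rpow_const (p := σ + 1) (Or.inr (by linarith))
    have h3 : HasDerivAt (fun t : ℝ => (‖Q‖ ^ 2 + t * ((2 * σ + 2) * D)) * ‖Q‖ ^ (2 * σ))
        ((2 * σ + 2) * D * ‖Q‖ ^ (2 * σ)) 0 := by
      have := (((hasDerivAt_id (0 : ℝ)).mul_const ((2 * σ + 2) * D)).const_add
        (‖Q‖ ^ 2)).mul_const (‖Q‖ ^ (2 * σ))
      exact this.congr_deriv (by simp)
    have h4 := h2.sub h3
    exact h4.congr_deriv (by simp)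
  have hz := hmin.hasDerivAt_eq_zero hder
  rw [← hsq _ (norm_nonneg _)] at hz
  have h6 : (N - D) * ((2 * σ + 2) * ‖Q‖ ^ (2 * σ)) = 0 := by linarith
  have h7 := (mul_eq_zero.1 h6).resolve_right (by positivity)
  linarith

/-- Testing with `I • v` recovers the imaginary part of the equation. -/
theorem IsOptimizer.isSolution (h : Subcritical n m σ) (hQ : IsOptimizer σ Q) :
    IsSolution σ Q := by
  refine (isSolution_iff Q).2 ⟨hQ.ne_zero, fun v => ?_⟩
  have h1 := hQ.re_inner_eq h v
  have h2 := hQ.re_inner_eq h (Complex.I • v)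
  have hs : inner ℂ (Complex.I • v) Q = (starRingEnd ℂ) Complex.I * inner ℂ v Q :=
    inner_smul_left v Q _
  rw [hs, nonlinearity_smul] at h2
  refine Complex.ext h1 ?_
  simpa using h2

/-- Testing with the solution itself places it on the Nehari manifold. -/
theorem IsSolution.potential_eq (hσ : 0 < σ) {u : B1 n m} (hu : IsSolution σ u) :
    potential σ u = ‖u‖ ^ 2 := by
  have h1 := ((isSolution_iff u).1 hu).2 u
  rw [nonlinearity_self hσ] at h1
  have h2 := congrArg Complex.re h1
  rw [Complex.ofReal_re] at h2
  rw [← h2]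
  exact (norm_sq_eq_re_inner (𝕜 := ℂ) u).symm

end optimizer

/-! ### The scaling `u ↦ exp (a s) u (y, exp (-b s) z)` -/

/-- The part of the squared norm that scales like the mass. -/
noncomputable def slowSq (u : B1 n m) : ℝ := gradYSq u + ‖moment u‖ ^ 2 + ‖val u‖ ^ 2

theorem slowSq_nonneg (u : B1 n m) : 0 ≤ slowSq u := by
  have := gradYSq_nonneg u
  unfold slowSq; positivity

theorem norm_sq_eq_slowSq_add (u : B1 n m) : ‖u‖ ^ 2 = slowSq u + gradZSq u := by
  rw [norm_sq_eq, slowSq]; ring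

/-- In this form the numerators are the exponential rates at which `slowSq`, `gradZSq` and
`potential` grow under `rescale`. -/
theorem J_eq_slowSq (σ a b : ℝ) (u : B1 n m) :
    J σ a b u = (2 * a + b * m) / 2 * slowSq u + (2 * a + b * m - 2 * b) / 2 * gradZSq u
      - (2 * a + b * m + 2 * a * σ) / (2 * σ + 2) * potential σ u := by
  rw [J, slowSq]; ring

/-- The scaled function `exp (a s) u (y, exp (-b s) z)`. -/
noncomputable def rescale (a b s : ℝ) (u : B1 n m) : B1 n m :=
  ((Real.exp (a * s) : ℝ) : ℂ) • subst (Real.exp_pos (-(b * s))) 0 u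

theorem exp_mul_jacobian (a b s : ℝ) :
    Real.exp (a * s) ^ 2 * (Real.exp (-(b * s)) ^ m)⁻¹ = Real.exp ((2 * a + b * m) * s) := by
  rw [← Real.exp_nat_mul, ← Real.exp_nat_mul, ← Real.exp_neg, ← Real.exp_add]
  congr 1; push_cast; ring

theorem slowSq_rescale (a b s : ℝ) (u : B1 n m) :
    slowSq (rescale a b s u) = Real.exp ((2 * a + b * m) * s) * slowSq u := by
  rw [slowSq, rescale, gradYSq_smul, moment_smul, val_smul, norm_smul, norm_smul, mul_pow, mul_pow,
    gradYSq_subst, norm_sq_moment_subst, norm_sq_val_subst, Complex.norm_real,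
    Real.norm_of_nonneg (Real.exp_pos _).le, slowSq, ← exp_mul_jacobian]
  ring

theorem gradZSq_rescale (a b s : ℝ) (u : B1 n m) :
    gradZSq (rescale a b s u) = Real.exp ((2 * a + b * m - 2 * b) * s) * gradZSq u := by
  have h : Real.exp ((2 * a + b * m - 2 * b) * s)
      = Real.exp ((2 * a + b * m) * s) * Real.exp (-(b * s)) ^ 2 := by
    rw [← Real.exp_nat_mul, ← Real.exp_add]; congr 1; push_cast; ring
  rw [rescale, gradZSq_smul, gradZSq_subst, Complex.norm_real,
    Real.norm_of_nonneg (Real.exp_pos _).le, h, ← exp_mul_jacobian]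
  ring

theorem potential_rescale (a b s : ℝ) (u : B1 n m) :
    potential σ (rescale a b s u)
      = Real.exp ((2 * a + b * m + 2 * a * σ) * s) * potential σ u := by
  have h : Real.exp ((2 * a + b * m + 2 * a * σ) * s)
      = Real.exp (a * s) ^ (2 * σ + 2) * (Real.exp (-(b * s)) ^ m)⁻¹ := by
    rw [← Real.exp_mul, ← Real.exp_nat_mul, ← Real.exp_neg, ← Real.exp_add]; congr 1; ring
  rw [rescale, potential_smul, potential_subst, Complex.norm_real,
    Real.norm_of_nonneg (Real.exp_pos _).le, h]
  ring

theorem norm_sq_rescale (a b s : ℝ) (u : B1 n m) :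
    ‖rescale a b s u‖ ^ 2 = Real.exp ((2 * a + b * m) * s) * slowSq u
      + Real.exp ((2 * a + b * m - 2 * b) * s) * gradZSq u := by
  rw [norm_sq_eq_slowSq_add, slowSq_rescale, gradZSq_rescale]

/-- Bernoulli's inequality with exponent `β / α`, valid for either sign of `s`. -/
theorem exp_sub_one_div_le {α β : ℝ} (hα : 0 < α) (hαβ : α ≤ β) (s : ℝ) :
    (Real.exp (α * s) - 1) / α ≤ (Real.exp (β * s) - 1) / β := by
  have hβ : 0 < β := hα.trans_le hαβ
  have h1 := one_add_mul_self_le_rpow_one_add (s := Real.exp (α * s) - 1)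
    (by linarith [Real.exp_pos (α * s)]) ((one_le_div hα).2 hαβ)
  have h2 : (1 + (Real.exp (α * s) - 1)) ^ (β / α) = Real.exp (β * s) := by
    rw [add_sub_cancel, ← Real.exp_mul]; congr 1; field_simp
  rw [h2] at h1
  rw [div_le_div_iff₀ hα hβ]
  have h3 : α * (β / α * (Real.exp (α * s) - 1)) = β * (Real.exp (α * s) - 1) := by
    field_simp
  nlinarith

section level

variable {Q : B1 n m} {a b : ℝ}

/-- On `J^{a,b} = 0` the action is maximal along the scaling. -/
theorem action_rescale_le (hσ : 0 < σ) (hab : AdmissibleExponents m σ a b)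
    (hpos : 0 < 2 * a + b * m) {u : B1 n m} (hu : J σ a b u = 0) (s : ℝ) :
    action σ (rescale a b s u) ≤ action σ u := by
  obtain ⟨ha, hb, -, hσab, -⟩ := hab
  rw [J_eq_slowSq] at hu
  rw [action_eq, action_eq, norm_sq_rescale, potential_rescale, norm_sq_eq_slowSq_add]
  set α := 2 * a + b * m with hα
  set A := slowSq u
  set G := gradZSq u
  set P := potential σ u
  have hA : 0 ≤ A := slowSq_nonneg u
  have hG : 0 ≤ G := gradZSq_nonneg u
  set β := α + 2 * a * σ with hβ
  have hβ0 : 0 < β := by positivity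
  -- The potential has the largest rate `β`: `α - 2b ≤ β` is a consequence of `σ a + b > 0`.
  have h1 := exp_sub_one_div_le hpos (by nlinarith : α ≤ β) s
  have h2 := exp_sub_one_div_le (by linarith : 0 < α - 2 * b) (by nlinarith : α - 2 * b ≤ β) s
  set E := (Real.exp (β * s) - 1) / β with hE
  rw [div_le_iff₀ hpos] at h1
  rw [div_le_iff₀ (by linarith)] at h2
  have h3 : Real.exp (β * s) - 1 = E * β := by rw [hE]; field_simp
  have h4 := mul_le_mul_of_nonneg_right h1 hA
  have h5 := mul_le_mul_of_nonneg_right h2 hG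
  have h6 : Real.exp (β * s) * P / (2 * σ + 2) = P / (2 * σ + 2) + E * (β / (2 * σ + 2) * P) := by
    have : Real.exp (β * s) = 1 + E * β := by linarith
    rw [this]; ring
  rw [h6]
  -- The constraint `J = 0` trades the potential for the quadratic terms, so the change in action is
  -- a sum of two terms of the sign fixed by `h4` and `h5`.
  have h7 : β / (2 * σ + 2) * P = α / 2 * A + (α - 2 * b) / 2 * G := by linarith
  rw [h7]
  nlinarith

/-- Without the potential, `J` is a combination of `slowSq` and `gradZSq` with positive
coefficients, since `b ≤ 0 < 2a + b m`. -/
theorem potential_pos_of_J_eq_zero (hab : AdmissibleExponents m σ a b)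
    (hpos : 0 < 2 * a + b * m) {u : B1 n m} (hu0 : u ≠ 0) (hu : J σ a b u = 0) :
    0 < potential σ u := by
  obtain ⟨ha, hb, -, hσab, -⟩ := hab
  refine lt_of_le_of_ne (potential_nonneg σ u) fun h0 => ?_
  rw [J_eq_slowSq, ← h0, mul_zero, sub_zero] at hu
  have hn : 0 < ‖u‖ ^ 2 := pow_pos (norm_pos_iff.2 hu0) 2
  rw [norm_sq_eq_slowSq_add] at hn
  have hA := slowSq_nonneg u
  have hG := gradZSq_nonneg u
  nlinarith [mul_nonneg hpos.le hA, mul_nonneg hpos.le hG, mul_nonneg (neg_nonneg.2 hb) hG,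
    mul_pos hpos hn]

/-- Every nonzero function of positive potential can be scaled to the Nehari manifold. -/
theorem exists_rescale_nehari (hσ : 0 < σ) (hab : AdmissibleExponents m σ a b) {u : B1 n m}
    (hu : 0 < potential σ u) :
    ∃ s, potential σ (rescale a b s u) = ‖rescale a b s u‖ ^ 2 := by
  obtain ⟨ha, hb, -, hσab, -⟩ := hab
  have hu0 : u ≠ 0 := by
    rintro rfl
    exact hu.ne' (potential_zero hσ)
  have hn : 0 < slowSq u + gradZSq u := by
    rw [← norm_sq_eq_slowSq_add]; exact pow_pos (norm_pos_iff.2 hu0) 2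
  have hA := slowSq_nonneg u
  have hG := gradZSq_nonneg u
  set γ := 2 * a * σ with hγ
  have hγ0 : 0 < γ := by positivity
  have hδ0 : 0 < γ + 2 * b := by rw [hγ]; linarith
  -- Dividing the Nehari equation by the growth factor of the potential turns it into `P(u) = k s`.
  -- Both rates are positive, so `k` runs from `+∞` to `0` and takes the value `P(u)`.
  set k : ℝ → ℝ := fun s => Real.exp (-γ * s) * slowSq u + Real.exp (-(γ + 2 * b) * s) * gradZSq u
    with hk
  have hkc : Continuous k := by fun_prop
  have htop : Tendsto k atTop (𝓝 0) := by
    have h1 : ∀ c : ℝ, 0 < c → Tendsto (fun s : ℝ => Real.exp (-c * s)) atTop (𝓝 0) := fun c hc =>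
      Real.tendsto_exp_atBot.comp (tendsto_id.const_mul_atTop_of_neg (by linarith))
    have h2 := ((h1 γ hγ0).mul_const (slowSq u)).add ((h1 _ hδ0).mul_const (gradZSq u))
    rw [zero_mul, zero_mul, add_zero] at h2
    exact h2
  have hbot : Tendsto k atBot atTop := by
    have h1 : Tendsto (fun s : ℝ => Real.exp (-(γ + 2 * b) * s) * (slowSq u + gradZSq u))
        atBot atTop :=
      (Real.tendsto_exp_atTop.comp
        (tendsto_id.const_mul_atBot_of_neg (by linarith))).atTop_mul_const hn
    refine tendsto_atTop_mono' _ ?_ h1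
    filter_upwards [eventually_le_atBot (0 : ℝ)] with s hs
    have : Real.exp (-(γ + 2 * b) * s) ≤ Real.exp (-γ * s) := Real.exp_le_exp.2 (by nlinarith)
    simp only [hk]
    nlinarith
  obtain ⟨s, hs⟩ : potential σ u ∈ Set.range k := mem_range_of_exists_le_of_exists_ge hkc
    ((htop.eventually (gt_mem_nhds hu)).exists.imp fun _ h => le_of_lt h)
    (hbot.eventually (eventually_ge_atTop _)).exists
  refine ⟨s, ?_⟩
  rw [potential_rescale, norm_sq_rescale, ← hs]
  simp only [hk]
  rw [mul_add, ← mul_assoc, ← mul_assoc, ← Real.exp_add, ← Real.exp_add]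
  congr 3 <;> (rw [hγ]; ring)

/-- Scaling `u` to the Nehari manifold cannot raise the action, and there `Q` is minimal. -/
theorem IsOptimizer.action_le_of_J_eq_zero (hσ : 0 < σ) (hQ : IsOptimizer σ Q)
    (hab : AdmissibleExponents m σ a b) (hpos : 0 < 2 * a + b * m) {u : B1 n m} (hu0 : u ≠ 0)
    (hu : J σ a b u = 0) : action σ Q ≤ action σ u := by
  have hP := potential_pos_of_J_eq_zero hab hpos hu0 hu
  obtain ⟨s, hs⟩ := exists_rescale_nehari hσ hab hP
  refine le_trans (hQ.action_le_of_nehari hσ ?_ hs) (action_rescale_le hσ hab hpos hu s)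
  intro h0
  have h1 := potential_rescale (σ := σ) a b s u
  rw [h0, potential_zero hσ] at h1
  exact (mul_pos (Real.exp_pos _) hP).ne h1

/-- An optimizer lies on `J^{a,b} = 0` for all `a` and `b`. -/
theorem IsOptimizer.J_eq_zero (hσ : 0 < σ) (hQ : IsOptimizer σ Q) (a b : ℝ) : J σ a b Q = 0 := by
  rw [J_eq_slowSq, hQ.potential_eq]
  set α := 2 * a + b * m
  set A := slowSq Q
  set G := gradZSq Q
  set β := α + 2 * a * σ
  have hAG : ‖Q‖ ^ 2 = A + G := norm_sq_eq_slowSq_add Q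
  have hN : 0 < A + G := by rw [← hAG]; exact pow_pos hQ.norm_pos 2
  have hq : ‖Q‖ ^ (2 * σ) = (A + G) ^ σ := by
    rw [← hAG, ← Real.rpow_two, ← Real.rpow_mul (norm_nonneg _)]
  -- The gap in the sharp inequality along the scaling orbit of `Q` is minimal at `s = 0`; its
  -- derivative there is a positive multiple of `J σ a b Q`.
  set F : ℝ → ℝ := fun s => (Real.exp (α * s) * A + Real.exp ((α - 2 * b) * s) * G) ^ (σ + 1)
    - Real.exp (β * s) * (A + G) * (A + G) ^ σ with hF
  have hF0 : ∀ s, 0 ≤ F s := fun s => by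
    have h1 := hQ.potential_mul_le (rescale a b s Q)
    have h2 : ‖rescale a b s Q‖ ^ (2 * σ + 2) = (‖rescale a b s Q‖ ^ 2) ^ (σ + 1) := by
      rw [← Real.rpow_two, ← Real.rpow_mul (norm_nonneg _)]; congr 1; ring
    rw [h2, norm_sq_rescale, potential_rescale, hQ.potential_eq, hAG, hq] at h1
    simp only [hF]
    exact sub_nonneg.2 h1
  have hFz : F 0 = 0 := by
    simp only [hF, mul_zero, Real.exp_zero, one_mul, Real.rpow_add_one hN.ne']
    ring
  have hmin : IsLocalMin F 0 := Eventually.of_forall fun s => by rw [hFz]; exact hF0 s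
  have hexp : ∀ c : ℝ, HasDerivAt (fun s : ℝ => Real.exp (c * s)) c 0 := fun c => by
    have := ((hasDerivAt_id (0 : ℝ)).const_mul c).exp
    exact this.congr_deriv (by simp)
  have hder : HasDerivAt F ((α * A + (α - 2 * b) * G) * (σ + 1) * (A + G) ^ σ
      - β * (A + G) * (A + G) ^ σ) 0 := by
    have h1 := (((hexp α).mul_const A).add ((hexp (α - 2 * b)).mul_const G)).rpow_const
      (p := σ + 1) (Or.inr (by linarith))
    have h2 := ((hexp β).mul_const (A + G)).mul_const ((A + G) ^ σ)
    exact (h1.sub h2).congr_deriv (by simp)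
  have hz := hmin.hasDerivAt_eq_zero hder
  have hz2 : ((α * A + (α - 2 * b) * G) * (σ + 1) - β * (A + G)) * (A + G) ^ σ = 0 := by linarith
  have hz3 := (mul_eq_zero.1 hz2).resolve_right (Real.rpow_pos_of_pos hN σ).ne'
  rw [hAG]
  have h2 : 2 * σ + 2 ≠ 0 := by positivity
  field_simp
  linarith

theorem IsOptimizer.isLeast (hσ : 0 < σ) (hQ : IsOptimizer σ Q)
    (hab : AdmissibleExponents m σ a b) (hpos : 0 < 2 * a + b * m) :
    IsLeast (action σ '' {u : B1 n m | u ≠ 0 ∧ J σ a b u = 0}) (action σ Q) := by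
  refine ⟨⟨Q, ⟨hQ.ne_zero, hQ.J_eq_zero hσ a b⟩, rfl⟩, ?_⟩
  rintro _ ⟨u, ⟨hu0, hu⟩, rfl⟩
  exact hQ.action_le_of_J_eq_zero hσ hab hpos hu0 hu

theorem IsOptimizer.minLevel_eq (hσ : 0 < σ) (hQ : IsOptimizer σ Q)
    (hab : AdmissibleExponents m σ a b) (hpos : 0 < 2 * a + b * m) :
    minLevel n m σ a b = action σ Q :=
  (hQ.isLeast hσ hab hpos).csInf_eq

end level

/-! ### The mountain pass level -/

theorem Subcritical.continuous_action (h : Subcritical n m σ) :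
    Continuous (action σ : B1 n m → ℝ) := by
  have : (action σ : B1 n m → ℝ) = fun u => ‖u‖ ^ 2 / 2 - potential σ u / (2 * σ + 2) :=
    funext action_eq
  rw [this]
  exact ((continuous_norm.pow 2).div_const 2).sub (h.continuous_potential.div_const _)

section pass

variable {Q : B1 n m}

/-- Where `‖u‖ ≤ ‖Q‖` one has `P(u) ≤ ‖u‖²`, so the action is nonnegative and the path must end
outside. It therefore crosses `‖u‖ = ‖Q‖`, and there `P(u) ≤ P(Q)` gives `S(u) ≥ S(Q)`. -/
theorem IsOptimizer.exists_action_ge_of_path (hσ : 0 < σ) (hQ : IsOptimizer σ Q)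
    {γ : C(unitInterval, B1 n m)} (hγ : γ ∈ mountainPaths n m σ) :
    ∃ s, action σ Q ≤ action σ (γ s) := by
  obtain ⟨h0, h1⟩ := hγ
  have hQ1 : ‖Q‖ ≤ ‖γ 1‖ := by
    by_contra! hcon
    have h2 := hQ.potential_le hσ hcon.le
    rw [action_eq] at h1
    have h3 : potential σ (γ 1) / (2 * σ + 2) ≤ ‖γ 1‖ ^ 2 / 2 :=
      div_le_div₀ (by positivity) h2 (by norm_num) (by linarith)
    linarith
  obtain ⟨s, hs⟩ : ‖Q‖ ∈ Set.range fun s => ‖γ s‖ :=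
    mem_range_of_exists_le_of_exists_ge γ.continuous.norm
      ⟨0, by rw [h0, norm_zero]; exact norm_nonneg _⟩ ⟨1, hQ1⟩
  dsimp only at hs
  refine ⟨s, ?_⟩
  have h2 := hQ.potential_le hσ hs.le
  rw [action_eq, action_eq, hQ.potential_eq, ← hs]
  gcongr

theorem action_ofReal_smul (hσ : 0 < σ) (hQ : IsOptimizer σ Q) {t : ℝ} (ht : 0 ≤ t) :
    action σ ((t : ℂ) • Q) = ‖Q‖ ^ 2 * (t ^ 2 / 2 - t ^ (2 * σ) * t ^ 2 / (2 * σ + 2)) := by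
  rw [action_eq, potential_smul, norm_smul, Complex.norm_real, Real.norm_of_nonneg ht,
    hQ.potential_eq, rpow_two_mul_add_two hσ ht]
  ring

/-- Bernoulli's inequality for `t²` with exponent `σ + 1`. -/
theorem IsOptimizer.action_smul_le (hσ : 0 < σ) (hQ : IsOptimizer σ Q) {t : ℝ} (ht : 0 ≤ t) :
    action σ ((t : ℂ) • Q) ≤ action σ Q := by
  rw [action_ofReal_smul hσ hQ ht, action_of_nehari hσ hQ.potential_eq, mul_comm]
  gcongr
  have hb := one_add_mul_self_le_rpow_one_add (s := t ^ 2 - 1) (by nlinarith)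
    (by linarith : 1 ≤ σ + 1)
  have h1 : (1 + (t ^ 2 - 1)) ^ (σ + 1) = t ^ (2 * σ) * t ^ 2 := by
    rw [add_sub_cancel, ← rpow_two_mul_add_two hσ ht, ← Real.rpow_two, ← Real.rpow_mul ht]
    congr 1; ring
  rw [h1] at hb
  have h2 : σ / (2 * σ + 2) - (t ^ 2 / 2 - t ^ (2 * σ) * t ^ 2 / (2 * σ + 2))
      = (t ^ (2 * σ) * t ^ 2 - (1 + (σ + 1) * (t ^ 2 - 1))) / (2 * σ + 2) := by
    field_simp
    ring
  have h3 : 0 ≤ (t ^ (2 * σ) * t ^ 2 - (1 + (σ + 1) * (t ^ 2 - 1))) / (2 * σ + 2) :=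
    div_nonneg (by linarith) (by positivity)
  linarith

theorem IsOptimizer.exists_path (hσ : 0 < σ) (hQ : IsOptimizer σ Q) :
    ∃ γ ∈ mountainPaths n m σ,
      IsGreatest (Set.range fun s => action σ (γ s)) (action σ Q) := by
  -- With `T ^ (2σ) = 2σ + 2` the action at `T Q` equals `-‖Q‖² T² / 2 < 0`. The path is the segment
  -- from `0` to `T Q`, passing through `Q` at parameter `1 / T`.
  set T : ℝ := (2 * σ + 2) ^ (1 / (2 * σ)) with hT
  have hT1 : 1 ≤ T := Real.one_le_rpow (by linarith) (by positivity)
  have hT0 : 0 < T := by linarith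
  have hTp : T ^ (2 * σ) = 2 * σ + 2 := by
    rw [hT, ← Real.rpow_mul (by positivity), one_div_mul_cancel (by positivity), Real.rpow_one]
  set γ : C(unitInterval, B1 n m) :=
    ⟨fun s => (((s : ℝ) * T : ℝ) : ℂ) • Q, by fun_prop⟩ with hγ
  have happ : ∀ s, γ s = (((s : ℝ) * T : ℝ) : ℂ) • Q := fun s => rfl
  refine ⟨γ, ⟨?_, ?_⟩, ⟨⟨1 / T, by positivity, (div_le_one hT0).2 hT1⟩, ?_⟩, ?_⟩
  · rw [happ]; simp
  · rw [happ, Set.Icc.coe_one, one_mul, action_ofReal_smul hσ hQ hT0.le, hTp]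
    have := hQ.norm_pos
    refine mul_neg_of_pos_of_neg (by positivity) ?_
    rw [mul_div_cancel_left₀ _ (by positivity)]
    nlinarith [pow_pos hT0 2]
  · dsimp only
    rw [happ]
    simp [hT0.ne']
  · rintro _ ⟨s, rfl⟩
    exact hQ.action_smul_le hσ (mul_nonneg s.2.1 hT0.le)

theorem IsOptimizer.isLeast_mountainPass (hσ : 0 < σ) (hQ : IsOptimizer σ Q) :
    IsLeast {M | ∃ γ ∈ mountainPaths n m σ, IsGreatest (Set.range fun s => action σ (γ s)) M}
      (action σ Q) := by
  refine ⟨hQ.exists_path hσ, ?_⟩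
  rintro M ⟨γ, hγ, hM⟩
  obtain ⟨s, hs⟩ := hQ.exists_action_ge_of_path hσ hγ
  exact hs.trans (hM.2 ⟨s, rfl⟩)

theorem IsOptimizer.mountainPassLevel_eq (hσ : 0 < σ) (hQ : IsOptimizer σ Q) :
    mountainPassLevel n m σ = action σ Q :=
  (hQ.isLeast_mountainPass hσ).csInf_eq

/-! ### Ground states and conclusion. -/

theorem IsOptimizer.isGroundState (h : Subcritical n m σ) (hQ : IsOptimizer σ Q) :
    IsGroundState σ Q :=
  ⟨hQ.isSolution h, fun _ hφ => hQ.action_le_of_nehari h.pos hφ.1 (hφ.potential_eq h.pos)⟩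

theorem admissibleExponents_one_zero (hσ : 0 < σ) : AdmissibleExponents m σ 1 0 := by
  refine ⟨one_pos, le_rfl, by simp, by simpa using hσ, by simp⟩

theorem subcritical_of_bounds (hn : 1 ≤ n) (hm : 1 ≤ m) (hσ_lower : 2 / (m : ℝ) < σ)
    (hσ_upper : σ * ((n : ℝ) + m - 2) < 2) : Subcritical n m σ :=
  ⟨by lia, lt_of_le_of_lt (by positivity) hσ_lower, hσ_upper⟩

end pass

end PartialNLS

theorem lemma3p2 (n m : ℕ) (hn : 1 ≤ n) (hm : 1 ≤ m) (σ : ℝ)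
    (hσ_lower : 2 / (m : ℝ) < σ) (hσ_upper : σ * ((n : ℝ) + m - 2) < 2) :
    -- for all admissible (a, b), the infimum is attained, and it is the mountain pass level
    (∀ a b : ℝ, PartialNLS.AdmissibleExponents m σ a b → 0 < 2 * a + b * m →
      (∃ Q ∈ PartialNLS.minimisers n m σ a b, Q ≠ 0) ∧
      PartialNLS.minLevel n m σ a b = PartialNLS.mountainPassLevel n m σ ∧
      0 < PartialNLS.minLevel n m σ a b) ∧
    -- the level does not depend on (a, b)
    (∀ a b a' b' : ℝ, PartialNLS.AdmissibleExponents m σ a b → 0 < 2 * a + b * m →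
      PartialNLS.AdmissibleExponents m σ a' b' → 0 < 2 * a' + b' * m →
      PartialNLS.minLevel n m σ a b = PartialNLS.minLevel n m σ a' b') ∧
    -- mountain pass geometry; the maximum along each path is attained
    (PartialNLS.mountainPaths n m σ).Nonempty ∧
    (∀ γ ∈ PartialNLS.mountainPaths n m σ,
      ∃ s, ∀ t, PartialNLS.action σ (γ t) ≤ PartialNLS.action σ (γ s)) ∧
    0 < PartialNLS.mountainPassLevel n m σ ∧
    -- ground states exist, minimisers for (1, 0) are ground states, and all have action β
    (∃ Q : PartialNLS.B1 n m, PartialNLS.IsGroundState σ Q) ∧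
    (∀ Q ∈ PartialNLS.minimisers n m σ 1 0, PartialNLS.IsGroundState σ Q) ∧
    (∀ Q : PartialNLS.B1 n m, PartialNLS.IsGroundState σ Q →
      PartialNLS.action σ Q = PartialNLS.mountainPassLevel n m σ) := by
  have h := PartialNLS.subcritical_of_bounds hn hm hσ_lower hσ_upper
  have hσ := h.pos
  obtain ⟨Q, hQ⟩ := h.exists_isOptimizer
  have hβ := hQ.mountainPassLevel_eq hσ
  have hlevel : ∀ a b : ℝ, PartialNLS.AdmissibleExponents m σ a b → 0 < 2 * a + b * m →
      PartialNLS.minLevel n m σ a b = PartialNLS.action σ Q :=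
    fun a b hab hpos => hQ.minLevel_eq hσ hab hpos
  -- A single optimizer `Q` serves all `(a, b)`, so every level equals `S(Q)`.
  refine ⟨fun a b hab hpos => ⟨⟨Q, ⟨(hlevel a b hab hpos).symm, hQ.J_eq_zero hσ a b⟩,
      hQ.ne_zero⟩, (hlevel a b hab hpos).trans hβ.symm, ?_⟩,
    fun a b a' b' hab hpos hab' hpos' =>
      (hlevel a b hab hpos).trans (hlevel a' b' hab' hpos').symm,
    ?_, fun γ _ => ?_, ?_, ⟨Q, hQ.isGroundState h⟩, fun R hR => ?_, fun R hR => ?_⟩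
  · rw [hlevel a b hab hpos]; exact hQ.action_pos hσ
  · obtain ⟨γ, hγ, -⟩ := hQ.exists_path hσ
    exact ⟨γ, hγ⟩
  · obtain ⟨s, -, hs⟩ := isCompact_univ.exists_isMaxOn Set.univ_nonempty
      (h.continuous_action.comp γ.continuous).continuousOn
    exact ⟨s, fun t => hs (Set.mem_univ t)⟩
  · rw [hβ]; exact hQ.action_pos hσ
  -- For `(1, 0)` the constraint is the Nehari condition, so a minimiser is itself an optimizer; its
  -- norm is nonzero because its action equals `S(Q)`.
  · obtain ⟨hR1, hR2⟩ := hR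
    rw [PartialNLS.J_one_zero hσ, sub_eq_zero] at hR2
    rw [hlevel 1 0 (PartialNLS.admissibleExponents_one_zero hσ) (by simp)] at hR1
    exact (hQ.of_action_eq hσ hR2.symm hR1).isGroundState h
  -- A ground state and `Q` are both solutions of least action, so each bounds the other.
  · rw [hβ]
    exact le_antisymm (hR.2 Q (hQ.isSolution h))
      ((hQ.isGroundState h).2 R hR.1)
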